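/- **Setting.** For each $n$, let $\mathbf d_n=((d_v^-,d_v^+))_{v\in[n]}$ be a bi-degree sequence of non-negative integers with $\sum_v d_v^+=\sum_v d_v^-$. Assume that there are constants $\eta,C>0$ and an integer $K\ge 2$ such that, for all $n$, $2\le d_v^+\le K$ for all $v\in[n]$ and $\sum_{v\in[n]}(d_v^-)^{2+\eta}\le Cn$. Let $G_n$ be the directed configuration model: attach $d_v^+$ tails and $d_v^-$ heads to each vertex $v$, match tails to heads by a uniformly random bijection, and put an edge $(u,v)$ for each tail of $u$ matched to a head of $v$. Let $P(y,x)=m(y,x)/d_y^+$, where $m(y,x)$ is the multiplicity of the edge $(y,x)$. Events hold whp if their probability tends to $1$ as $n\to\infty$. For an empirical distribution $\mu_n=\frac1n\sum_{v\in[n]}\delta_{x_v}$ on $[0,\infty)$ write $\mu_n(t,\infty)=\frac1n|\{v: x_v>t\}|$. Let $\kappa>2$ and assume that the empirical in-degree distribution $\phi_n$ (with $x_v=d_v^-$) has power-law behavior with index $\kappa$: for all $\varepsilon>0$ and all $a\in(0,1/\kappa)$, for all sufficiently large $n$, $$n^{-a\kappa-\varepsilon}\le\phi_n(n^a,\infty)\le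 n^{-a\kappa+\varepsilon},\qquad \phi_n(n^{1/\kappa+\varepsilon},\infty)=0 .$$ For $n\ge1$ let $\lambda=\lambda_n$ be a (deterministic) probability distribution on $[n]$ such that for all $\varepsilon>0$, for all sufficiently large $n$, $n^{-1-\varepsilon}\le\lambda_n(x)\le n^{-1+\varepsilon}$ for all $x\in[n]$. For $\alpha\in[0,1]$ let $\pi_{\alpha,\lambda}$ be the PageRank score, i.e. the unique stationary probability distribution (when there is exactly one) of the transition matrix $P_{\alpha,\lambda}(x,y)=(1-\alpha)P(x,y)+\alpha\lambda(y)$, and let $\psi_{\alpha,\lambda}=\frac1n\sum_{v\in[n]}\delta_{n\pi_{\alpha,\lambda}(v)}$. **Theorem.** 1. For every constant $\alpha\in(0,1)$, the distribution $\psi_{\alpha,\lambda}$ has power-law behavior with the same index $\kappa$ whp, in the following sense: for all $\varepsilon>0$ and all $b\in(0,1/\kappa)$, whp $\pi_{\alpha,\lambda}$ is well defined, $\psi_{\alpha,\lambda}(n^{1/\kappa+\varepsilon},\infty)=0$, $\psi_{\alpha,\lambda}(n^a,\infty)\le n^{-a\kappa+\varepsilon}$ for all $a\in(0,1/\kappa)$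 simultaneously, and $\psi_{\alpha,\lambda}(n^a,\infty)\ge n^{-a\kappa-\varepsilon}$ for all $a\in(0,b]$ simultaneously. 2. The upper tail bound is uniform in $\alpha\in[0,1]$: for all $\varepsilon>0$ and $\delta>0$ there is $n_0$ such that for all $n\ge n_0$ and all $\alpha\in[0,1]$, with probability at least $1-\delta$, $\pi_{\alpha,\lambda}$ is well defined, $\psi_{\alpha,\lambda}(n^{1/\kappa+\varepsilon},\infty)=0$, and $\psi_{\alpha,\lambda}(n^a,\infty)\le n^{-a\kappa+\varepsilon}$ for all $a\in(0,1/\kappa)$. Equivalently, for an arbitrary sequence $\alpha_n\in[0,1]$ these upper bounds hold whp for $\psi_{\alpha_n,\lambda}$. -/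

import Mathlib

open Filter Topology MeasureTheory ProbabilityTheory
open scoped Matrix

namespace DCM

/-- A bi-degree sequence on the vertex set `Fin n`: in-degrees and out-degrees with the same sum. -/
structure BiDegree (n : ℕ) where
  inDeg : Fin n → ℕ
  outDeg : Fin n → ℕ
  sum_eq : ∑ v, outDeg v = ∑ v, inDeg v

namespace BiDegree

variable {n : ℕ}

/-- The tails: `d⁺_v` of them at each vertex `v`. -/
abbrev Tail (d : BiDegree n) : Type := Σ v : Fin n, Fin (d.outDeg v)

/-- The heads: `d⁻_v` of them at each vertex `v`. -/
abbrev Head (d : BiDegree n) : Type := Σ v : Fin n, Fin (d.inDeg v)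

/-- The configurations: bijections from tails to heads. Each of them is a directed multigraph
on `Fin n`, with one edge `(u, v)` for each tail of `u` that is matched to a head of `v`. -/
abbrev Matching (d : BiDegree n) : Type := d.Tail ≃ d.Head

/-- All sets of matchings are events. -/
instance instMeasurableSpaceMatching (d : BiDegree n) : MeasurableSpace d.Matching := ⊤

/-- The law of the directed configuration model: a uniformly random matching. -/
noncomputable def law (d : BiDegree n) : Measure d.Matching :=
  uniformOn (Set.univ : Set d.Matching)

/-- The multiplicity of the directed edge `(y, x)`. -/
noncomputable def mult (d : BiDegree n) (σ : d.Matching) (y x : Fin n) : ℕ :=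
  Nat.card {i : Fin (d.outDeg y) // (σ ⟨y, i⟩).1 = x}

/-- The transition matrix of the simple random walk on the multigraph. -/
noncomputable def walk (d : BiDegree n) (σ : d.Matching) : Matrix (Fin n) (Fin n) ℝ :=
  fun y x => (d.mult σ y x : ℝ) / (d.outDeg y : ℝ)

/-- The transition matrix of the PageRank surfer with teleporting probability `α` and
teleporting distribution `lam`. -/
noncomputable def surfer (d : BiDegree n) (σ : d.Matching) (α : ℝ) (lam : Fin n → ℝ) :
    Matrix (Fin n) (Fin n) ℝ :=
  fun x y => (1 - α) * d.walk σ x y + α * lam y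

end BiDegree

/-- `π` is a stationary probability distribution of the transition matrix `P`. -/
def IsStationary {n : ℕ} (P : Matrix (Fin n) (Fin n) ℝ) (π : Fin n → ℝ) : Prop :=
  π ∈ stdSimplex ℝ (Fin n) ∧ π ᵥ* P = π

/-- `π` is the stationary distribution of `P`, that is, the only one. -/
def IsTheStationary {n : ℕ} (P : Matrix (Fin n) (Fin n) ℝ) (π : Fin n → ℝ) : Prop :=
  IsStationary P π ∧ ∀ π' : Fin n → ℝ, IsStationary P π' → π' = π

/-- The assumption on the degrees: out-degrees between `2` and a constant `K`, and a bounded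
`(2 + η)`-moment of the in-degrees. -/
def DegreeAssumption (d : ∀ n : ℕ, BiDegree n) : Prop :=
  ∃ η C : ℝ, ∃ K : ℕ, 0 < η ∧ 0 < C ∧ 2 ≤ K ∧ ∀ n : ℕ,
    (∀ v, 2 ≤ (d n).outDeg v) ∧ (∀ v, (d n).outDeg v ≤ K) ∧
    ∑ v, ((d n).inDeg v : ℝ) ^ (2 + η) ≤ C * (n : ℝ)

/-- The right tail `μ (t, ∞)` of the empirical distribution `μ = (1 / n) ∑ᵥ δ_{x v}`. -/
noncomputable def tail {n : ℕ} (x : Fin n → ℝ) (t : ℝ) : ℝ :=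
  (Nat.card {v : Fin n // t < x v} : ℝ) / (n : ℝ)

/-- Power-law behaviour with index `κ` of the empirical distributions of the vectors `x n`. -/
def HasPowerLaw (κ : ℝ) (x : ∀ n : ℕ, Fin n → ℝ) : Prop :=
  ∀ ε : ℝ, 0 < ε → ∀ a : ℝ, 0 < a → a < 1 / κ → ∀ᶠ n : ℕ in atTop,
    (n : ℝ) ^ (-a * κ - ε) ≤ tail (x n) ((n : ℝ) ^ a) ∧
    tail (x n) ((n : ℝ) ^ a) ≤ (n : ℝ) ^ (-a * κ + ε) ∧
    tail (x n) ((n : ℝ) ^ (1 / κ + ε)) = 0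

/-- The upper half of the power-law bounds at size `n`, with error exponent `ε`, simultaneously
for all exponents `a ∈ (0, 1 / κ)`. -/
def UpperBounds {n : ℕ} (κ ε : ℝ) (x : Fin n → ℝ) : Prop :=
  tail x ((n : ℝ) ^ (1 / κ + ε)) = 0 ∧
  ∀ a : ℝ, 0 < a → a < 1 / κ → tail x ((n : ℝ) ^ a) ≤ (n : ℝ) ^ (-a * κ + ε)

/-- The lower half of the power-law bounds at size `n`, with error exponent `ε`, simultaneously
for all exponents `a ∈ (0, b]`. -/
def LowerBounds {n : ℕ} (κ ε b : ℝ) (x : Fin n → ℝ) : Prop :=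
  ∀ a : ℝ, 0 < a → a ≤ b → (n : ℝ) ^ (-a * κ - ε) ≤ tail x ((n : ℝ) ^ a)

/-- `lam n` is, for each `n ≥ 1`, a probability distribution on `Fin n`, uniform up to
sub-polynomial factors. -/
def NearUniform (lam : ∀ n : ℕ, Fin n → ℝ) : Prop :=
  (∀ n : ℕ, 1 ≤ n → lam n ∈ stdSimplex ℝ (Fin n)) ∧
  ∀ ε : ℝ, 0 < ε → ∀ᶠ n : ℕ in atTop, ∀ x : Fin n,
    (n : ℝ) ^ (-1 - ε) ≤ lam n x ∧ lam n x ≤ (n : ℝ) ^ (-1 + ε)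

end DCM

/-!
Iterating `T ≈ log n` times, a stationary distribution of the surfer is a mixture of the laws
`lam P ^ k`, `k < T`, and of laws of walks of length `T`. So, whatever `α` is, it suffices to bound
all of these at `v` by `n ^ (ε - 1)` times the *influence* of `v`, the maximum of
`d⁻_w P ^ t (w, v)` over `w` and `t ≤ T`. As `∑_v P ^ t (w, v) ≤ 1` and `κ ≥ 1`, at most
`(T + 1) ∑_w (d⁻_w / D) ^ κ` vertices have influence above `D`, and `∑_w (d⁻_w) ^ κ` is at most
`n ^ (1 + ε)`.

The moments of these laws are estimated by running several walks one after another and revealing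
edges only when they are used. A walk reaches `v` along revealed edges or enters the revealed part
through a new edge, at `w` with probability about `d⁻_w / n`; from there it goes to `v` with
probability at most `influence / d⁻_w`, so the in-degrees cancel. When the start is fixed, the
revealed part must not trap a later walk. This holds because the walk spreads out in `log n` steps,
which can only fail after two collisions, an event of probability `o(1 / n)` for each start since
`d⁻_w` is at most `n ^ (1 / 2 - 3 γ)`.

For `α > 0` uniqueness is immediate. For `α = 0` the upper bound forces every absorbing set to have
at least `N = n ^ (1 / 2 + γ)` vertices. Revealing about `N` edges from one vertex leaves of the
order of `N` free heads, which an equally long exploration from another vertex must avoid if the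
two lie in disjoint absorbing sets; since `N ^ 2` is much larger than `n`, this is unlikely. The
lower tail comes from a single step after a teleportation: `π v ≥ (1 - α) α (min lam) d⁻_v / K`.
-/

namespace DCM

open scoped BigOperators

section RandomBijection

variable {α β : Type*} [Fintype α] [Fintype β] [DecidableEq α] [DecidableEq β]
  {S : Finset α} {e : α} {σ₀ σ₁ σ : α ≃ β}

/-- The bijections that agree with `σ₀` on `S`. Averaging over `cylinder S σ₀` is conditioning a
uniformly random bijection on having revealed its values on `S`, namely those of `σ₀`. -/
def cylinder (S : Finset α) (σ₀ : α ≃ β) : Finset (α ≃ β) :=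
  {σ | ∀ e ∈ S, σ e = σ₀ e}

theorem mem_cylinder : σ ∈ cylinder S σ₀ ↔ ∀ e ∈ S, σ e = σ₀ e := by
  simp only [cylinder, Finset.mem_filter_univ]

theorem self_mem_cylinder : σ ∈ cylinder S σ :=
  mem_cylinder.2 fun _ _ => rfl

theorem cylinder_nonempty : (cylinder S σ₀).Nonempty :=
  ⟨σ₀, self_mem_cylinder⟩

theorem mem_cylinder_comm : σ ∈ cylinder S σ₀ ↔ σ₀ ∈ cylinder S σ := by
  simp only [mem_cylinder, eq_comm]

theorem cylinder_empty (σ₀ : α ≃ β) : cylinder ∅ σ₀ = Finset.univ := by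
  ext σ
  simp [mem_cylinder]

theorem cylinder_insert_subset (h : σ₁ ∈ cylinder S σ₀) :
    cylinder (insert e S) σ₁ ⊆ cylinder S σ₀ := by
  intro σ hσ
  rw [mem_cylinder] at *
  intro e' he'
  rw [hσ e' (Finset.mem_insert_of_mem he'), h e' he']

theorem card_cylinder (S : Finset α) (σ₀ : α ≃ β) :
    (cylinder S σ₀).card = (Fintype.card α - S.card).factorial := by
  have toFixing : {σ // σ ∈ cylinder S σ₀} ≃ {f : Equiv.Perm α // ∀ a, ¬ (a ∉ S) → f a = a} :=
    { toFun := fun σ => ⟨σ.1.trans σ₀.symm, fun a ha => by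
        simp [mem_cylinder.1 σ.2 a (not_not.1 ha)]⟩
      invFun := fun f => ⟨f.1.trans σ₀, mem_cylinder.2 fun a ha => by
        simp [f.2 a (not_not.2 ha)]⟩
      left_inv := fun σ => by ext a : 2; simp
      right_inv := fun f => by ext a : 2; simp }
  have toPerm := toFixing.trans (Equiv.Perm.subtypeEquivSubtypePerm fun a => a ∉ S).symm
  rw [← Fintype.card_coe, Fintype.card_congr toPerm, Fintype.card_perm,
    Fintype.card_subtype_compl, Fintype.card_coe]

theorem card_filter_cylinder_le (he : e ∉ S) (f : β) :
    ((cylinder S σ₀).filter fun σ => σ e = f).card ≤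
      (Fintype.card α - (S.card + 1)).factorial := by
  rcases ((cylinder S σ₀).filter fun σ => σ e = f).eq_empty_or_nonempty with h | ⟨σ₁, h₁⟩
  · simp [h]
  rw [← Finset.card_insert_of_notMem he, ← card_cylinder (insert e S) σ₁]
  refine Finset.card_le_card fun σ hσ => ?_
  simp only [Finset.mem_filter, mem_cylinder] at h₁ hσ
  refine mem_cylinder.2 ((Finset.forall_mem_insert _ _ _).2 ⟨hσ.2.trans h₁.2.symm, ?_⟩)
  exact fun e' he' => (hσ.1 e' he').trans (h₁.1 e' he').symm

theorem expect_cylinder_const (S : Finset α) (σ₀ : α ≃ β) (c : ℝ) :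
    𝔼 _σ ∈ cylinder S σ₀, c = c :=
  Finset.expect_const cylinder_nonempty c

theorem expect_cylinder_tower (S : Finset α) (e : α) (σ₀ : α ≃ β) (g : (α ≃ β) → ℝ) :
    𝔼 σ₁ ∈ cylinder S σ₀, 𝔼 σ ∈ cylinder (insert e S) σ₁, g σ = 𝔼 σ ∈ cylinder S σ₀, g σ := by
  simp only [Finset.expect_eq_sum_div_card (cylinder _ _), card_cylinder, Finset.sum_div]
  rw [Finset.sum_comm' (t' := cylinder S σ₀) (s' := fun σ => cylinder (insert e S) σ)]
  · refine Finset.sum_congr rfl fun σ _ => ?_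
    have hcard : ((Fintype.card α - (insert e S).card).factorial : ℝ) ≠ 0 := by positivity
    rw [Finset.sum_const, card_cylinder, nsmul_eq_mul, ← mul_div_assoc,
      mul_div_cancel₀ _ hcard]
  · intro σ₁ σ
    constructor
    · rintro ⟨h₁, h₂⟩
      exact ⟨mem_cylinder_comm.1 h₂, cylinder_insert_subset h₁ h₂⟩
    · rintro ⟨h₁, h₂⟩
      exact ⟨cylinder_insert_subset h₂ h₁, mem_cylinder_comm.1 h₁⟩

theorem expect_ite_apply_eq_le (he : e ∉ S) (f : β) (σ₀ : α ≃ β) :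
    𝔼 σ ∈ cylinder S σ₀, (if σ e = f then 1 else 0 : ℝ) ≤
      ((Fintype.card α : ℝ) - S.card)⁻¹ := by
  obtain ⟨k, hk⟩ := Nat.exists_eq_add_of_lt (Finset.card_lt_univ_of_notMem he)
  have hcount := card_filter_cylinder_le (σ₀ := σ₀) he f
  rw [Finset.expect_eq_sum_div_card, Finset.sum_boole, card_cylinder]
  rw [show Fintype.card α - (S.card + 1) = k by omega] at hcount
  rw [show Fintype.card α - S.card = k + 1 by omega, hk, Nat.factorial_succ,
    div_le_iff₀ (by positivity)]
  calc (((cylinder S σ₀).filter fun σ => σ e = f).card : ℝ) ≤ k.factorial := by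
        exact_mod_cast hcount
    _ = (((S.card + k + 1 : ℕ) : ℝ) - S.card)⁻¹ * ((k + 1) * k.factorial : ℕ) := by
        push_cast
        rw [show (S.card : ℝ) + k + 1 - S.card = k + 1 by ring,
          inv_mul_cancel_left₀ (by positivity)]

theorem expect_apply_le (he : e ∉ S) (σ₀ : α ≃ β) {φ : β → ℝ} (hφ : ∀ f, 0 ≤ φ f)
    (F : Finset β) (hF : ∀ f, f ∉ F → φ f ≠ 0 → ∃ e' ∈ S, σ₀ e' = f) :
    𝔼 σ ∈ cylinder S σ₀, φ (σ e) ≤ (∑ f ∈ F, φ f) / ((Fintype.card α : ℝ) - S.card) := by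
  have hφ_sum : ∀ σ ∈ cylinder S σ₀, φ (σ e) = ∑ f ∈ F, φ f * if σ e = f then 1 else 0 := by
    intro σ hσ
    simp only [mul_ite, mul_one, mul_zero, Finset.sum_ite_eq]
    split_ifs with hmem
    · rfl
    by_contra hne
    obtain ⟨e', he', hσe'⟩ := hF _ hmem hne
    rw [← mem_cylinder.1 hσ e' he'] at hσe'
    exact he (σ.injective hσe' ▸ he')
  rw [Finset.expect_congr rfl hφ_sum, Finset.expect_sum_comm, div_eq_mul_inv, Finset.sum_mul]
  refine Finset.sum_le_sum fun f _ => ?_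
  rw [← Finset.mul_expect]
  exact mul_le_mul_of_nonneg_left (expect_ite_apply_eq_le he f σ₀) (hφ f)

theorem expect_ite_apply_mem_le (he : e ∉ S) {σ₀ : α ≃ β} {F : Finset β}
    (hF : ∀ e' ∈ S, σ₀ e' ∉ F) {p : ℝ} (hp : 0 ≤ p) :
    𝔼 σ ∈ cylinder S σ₀, (if σ e ∈ F then 0 else p) ≤
      (1 - (F.card : ℝ) / Fintype.card α) * p := by
  have hlt : (0 : ℝ) < (Fintype.card α : ℝ) - S.card :=
    sub_pos.2 (mod_cast Finset.card_lt_univ_of_notMem he)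
  have hdisj : Disjoint F (S.map σ₀.toEmbedding) :=
    Finset.disjoint_right.2 (Finset.forall_mem_map.2 hF)
  have hcard : ((F ∪ S.map σ₀.toEmbedding)ᶜ.card : ℝ) =
      (Fintype.card α : ℝ) - S.card - F.card := by
    rw [Finset.card_compl, Nat.cast_sub (Finset.card_le_univ _),
      Finset.card_union_of_disjoint hdisj, Finset.card_map, ← Fintype.card_congr σ₀]
    push_cast
    ring
  calc 𝔼 σ ∈ cylinder S σ₀, (if σ e ∈ F then 0 else p)
      ≤ (∑ f ∈ (F ∪ S.map σ₀.toEmbedding)ᶜ, if f ∈ F then 0 else p) /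
          ((Fintype.card α : ℝ) - S.card) := by
        refine expect_apply_le he σ₀ (φ := fun f => if f ∈ F then 0 else p)
          (fun f => by split_ifs <;> simp [hp]) _ fun f hf h0 => ?_
        have hfF : f ∉ F := fun h => h0 (if_pos h)
        exact ⟨σ₀.symm f, by simpa [hfF] using hf, σ₀.apply_symm_apply f⟩
    _ = ((Fintype.card α : ℝ) - S.card - F.card) * p / ((Fintype.card α : ℝ) - S.card) := by
        rw [Finset.sum_congr rfl (g := fun _ => p), Finset.sum_const, nsmul_eq_mul, hcard]
        intro f hf
        exact if_neg fun h => Finset.mem_compl.1 hf (Finset.mem_union_left _ h)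
    _ = (1 - (F.card : ℝ) / ((Fintype.card α : ℝ) - S.card)) * p := by field_simp
    _ ≤ (1 - (F.card : ℝ) / Fintype.card α) * p := by
        gcongr
        exact sub_le_self _ (Nat.cast_nonneg _)

end RandomBijection

section NonnegativeMatrix

variable {ι R : Type*} [Fintype ι] [Semiring R] [PartialOrder R] [IsOrderedRing R]
  {A B : Matrix ι ι R}

theorem mulVec_le_mulVec (hA : ∀ i j, 0 ≤ A i j) {u v : ι → R} (huv : u ≤ v) :
    A *ᵥ u ≤ A *ᵥ v := fun i =>
  Finset.sum_le_sum fun j _ => mul_le_mul_of_nonneg_left (huv j) (hA i j)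

variable [DecidableEq ι]

theorem matrix_pow_apply_le_pow_apply (hA : ∀ i j, 0 ≤ A i j) (hAB : ∀ i j, A i j ≤ B i j)
    (t : ℕ) (i j : ι) : (A ^ t) i j ≤ (B ^ t) i j := by
  induction t generalizing i j with
  | zero => simp
  | succ t ih =>
    simp only [pow_succ', Matrix.mul_apply]
    exact Finset.sum_le_sum fun k _ => mul_le_mul (hAB i k) (ih k j)
      (Matrix.pow_apply_nonneg hA t k j) ((hA i k).trans (hAB i k))

theorem pow_mulVec_one_le_one (hA : ∀ i j, 0 ≤ A i j) (hA1 : A *ᵥ 1 ≤ 1) (t : ℕ) :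
    A ^ t *ᵥ 1 ≤ 1 := by
  induction t with
  | zero => simp
  | succ t ih =>
    rw [pow_succ', ← Matrix.mulVec_mulVec]
    exact (mulVec_le_mulVec hA ih).trans hA1

end NonnegativeMatrix

theorem mul_pow_succ_apply_eq_mulVec {ι R : Type*} [Fintype ι] [DecidableEq ι] [CommSemiring R]
    (A : Matrix ι ι R) (c : R) (t : ℕ) (i j : ι) :
    c * (A ^ (t + 1)) i j = (A *ᵥ fun k => c * (A ^ t) k j) i := by
  rw [pow_succ', Matrix.mul_apply, Finset.mul_sum]
  exact Finset.sum_congr rfl fun k _ => mul_left_comm _ _ _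

namespace BiDegree

section RevealedEdges

variable {n : ℕ} {d : BiDegree n} {S S' : Finset d.Tail} {σ τ : d.Matching}

theorem card_head (d : BiDegree n) : Fintype.card d.Head = Fintype.card d.Tail := by
  simp [d.sum_eq]

instance (d : BiDegree n) : Nonempty d.Matching :=
  ⟨Fintype.equivOfCardEq d.card_head.symm⟩

instance (d : BiDegree n) : IsProbabilityMeasure d.law := by
  unfold law
  exact isProbabilityMeasure_uniformOn Set.finite_univ Set.univ_nonempty

theorem law_real_eq_expect (d : BiDegree n) (p : d.Matching → Prop) [DecidablePred p] :
    d.law.real {σ | p σ} = 𝔼 σ, if p σ then 1 else 0 := by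
  rw [law, Measure.real, uniformOn_univ, ENNReal.toReal_div,
    Measure.count_apply_finite _ (Set.toFinite _), Fintype.expect_eq_sum_div_card,
    Finset.sum_boole]
  simp

theorem sum_head (d : BiDegree n) (φ : Fin n → ℝ) :
    ∑ f : d.Head, φ f.1 = ∑ w, (d.inDeg w : ℝ) * φ w := by
  rw [Fintype.sum_sigma]
  simp

/-- The adjacency matrix, with multiplicities, of the edges whose tails are in `S`. -/
def edgeCount (d : BiDegree n) (S : Finset d.Tail) (σ : d.Matching) : Matrix (Fin n) (Fin n) ℕ :=
  ∑ e ∈ S, Matrix.single e.1 (σ e).1 1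

theorem edgeCount_congr (h : ∀ e ∈ S, σ e = τ e) : d.edgeCount S σ = d.edgeCount S τ :=
  Finset.sum_congr rfl fun e he => by rw [h e he]

theorem edgeCount_insert {e : d.Tail} (he : e ∉ S) (σ : d.Matching) :
    d.edgeCount (insert e S) σ = d.edgeCount S σ + Matrix.single e.1 (σ e).1 1 := by
  rw [edgeCount, Finset.sum_insert he, add_comm, edgeCount]

theorem edgeCount_apply (S : Finset d.Tail) (σ : d.Matching) (y x : Fin n) :
    d.edgeCount S σ y x =
      ∑ i : Fin (d.outDeg y), if (⟨y, i⟩ : d.Tail) ∈ S ∧ (σ ⟨y, i⟩).1 = x then 1 else 0 := by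
  simp only [edgeCount, Matrix.sum_apply, Matrix.single_apply, ite_and]
  rw [← Fintype.sum_ite_mem, Fintype.sum_sigma,
    Finset.sum_eq_single_of_mem y (Finset.mem_univ y)]
  · simp only [if_true]
  · intro z _ hz
    simp only [hz, if_false, ite_self, Finset.sum_const_zero]

theorem edgeCount_mono (h : S ⊆ S') (σ : d.Matching) (y x : Fin n) :
    d.edgeCount S σ y x ≤ d.edgeCount S' σ y x := by
  simp only [edgeCount_apply, Finset.sum_boole]
  exact Finset.card_le_card (Finset.monotone_filter_right _ fun i _ => And.imp_left (@h _))

theorem edgeCount_univ (σ : d.Matching) (y x : Fin n) :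
    d.edgeCount Finset.univ σ y x = d.mult σ y x := by
  rw [edgeCount_apply, Finset.sum_boole, mult, Nat.card_eq_fintype_card, Fintype.card_subtype]
  simp only [Finset.mem_univ, true_and, Nat.cast_id]

/-- The random walk that uses only the tails in `S`, killed when it takes another one. -/
noncomputable def walkOn (d : BiDegree n) (S : Finset d.Tail) (σ : d.Matching) :
    Matrix (Fin n) (Fin n) ℝ :=
  fun y x => (d.edgeCount S σ y x : ℝ) / (d.outDeg y : ℝ)

theorem walkOn_univ (σ : d.Matching) : d.walkOn Finset.univ σ = d.walk σ := by
  ext y x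
  rw [walkOn, edgeCount_univ, walk]

theorem walkOn_congr (h : ∀ e ∈ S, σ e = τ e) : d.walkOn S σ = d.walkOn S τ := by
  unfold walkOn
  rw [edgeCount_congr h]

theorem walkOn_nonneg (S : Finset d.Tail) (σ : d.Matching) (y x : Fin n) :
    0 ≤ d.walkOn S σ y x := by
  unfold walkOn
  positivity

theorem walkOn_mono (h : S ⊆ S') (σ : d.Matching) (y x : Fin n) :
    d.walkOn S σ y x ≤ d.walkOn S' σ y x := by
  have := edgeCount_mono h σ y x
  unfold walkOn
  gcongr

theorem walkOn_mulVec (S : Finset d.Tail) (σ : d.Matching) (h : Fin n → ℝ) (y : Fin n) :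
    (d.walkOn S σ *ᵥ h) y =
      𝔼 i : Fin (d.outDeg y), if (⟨y, i⟩ : d.Tail) ∈ S then h (σ ⟨y, i⟩).1 else 0 := by
  simp only [Matrix.mulVec, dotProduct, walkOn, edgeCount_apply, Nat.cast_sum, div_mul_eq_mul_div,
    Finset.sum_mul, ← Finset.sum_div]
  rw [Fintype.expect_eq_sum_div_card, Fintype.card_fin, Finset.sum_comm]
  congr 1
  refine Finset.sum_congr rfl fun i _ => ?_
  by_cases hi : (⟨y, i⟩ : d.Tail) ∈ S <;> simp [hi]

theorem walk_mulVec (σ : d.Matching) (h : Fin n → ℝ) (y : Fin n) :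
    (d.walk σ *ᵥ h) y = 𝔼 i : Fin (d.outDeg y), h (σ ⟨y, i⟩).1 := by
  simp only [← walkOn_univ, walkOn_mulVec, Finset.mem_univ, if_true]

theorem walkOn_mulVec_one_le_one (S : Finset d.Tail) (σ : d.Matching) :
    d.walkOn S σ *ᵥ 1 ≤ 1 := by
  intro y
  simp only [walkOn_mulVec, Pi.one_apply]
  rw [Fintype.expect_eq_sum_div_card, Finset.sum_boole]
  exact div_le_one_of_le₀ (mod_cast Finset.card_le_univ _) (Nat.cast_nonneg _)

theorem walkOn_pow_nonneg (S : Finset d.Tail) (σ : d.Matching) (t : ℕ) (y x : Fin n) :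
    0 ≤ (d.walkOn S σ ^ t) y x :=
  Matrix.pow_apply_nonneg (walkOn_nonneg S σ) t y x

theorem walkOn_pow_le_walk_pow (S : Finset d.Tail) (σ : d.Matching) (t : ℕ) (y x : Fin n) :
    (d.walkOn S σ ^ t) y x ≤ (d.walk σ ^ t) y x := by
  rw [← walkOn_univ]
  exact matrix_pow_apply_le_pow_apply (walkOn_nonneg S σ) (walkOn_mono S.subset_univ σ) t y x

theorem sum_walkOn_pow_le_one (S : Finset d.Tail) (σ : d.Matching) (t : ℕ) (y : Fin n) :
    ∑ x, (d.walkOn S σ ^ t) y x ≤ 1 := by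
  simpa only [Matrix.mulVec, dotProduct, Pi.one_apply, mul_one] using
    pow_mulVec_one_le_one (walkOn_nonneg S σ) (walkOn_mulVec_one_le_one S σ) t y

theorem walk_pow_nonneg (σ : d.Matching) (t : ℕ) (y x : Fin n) : 0 ≤ (d.walk σ ^ t) y x := by
  rw [← walkOn_univ]
  exact walkOn_pow_nonneg _ σ t y x

theorem sum_walk_pow_le_one (σ : d.Matching) (t : ℕ) (y : Fin n) :
    ∑ x, (d.walk σ ^ t) y x ≤ 1 := by
  rw [← walkOn_univ]
  exact sum_walkOn_pow_le_one _ σ t y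

theorem walk_pow_le_one (σ : d.Matching) (t : ℕ) (y x : Fin n) : (d.walk σ ^ t) y x ≤ 1 :=
  (Finset.single_le_sum (fun z _ => walk_pow_nonneg σ t y z) (Finset.mem_univ x)).trans
    (sum_walk_pow_le_one σ t y)

theorem walkOn_pow_eq_zero {w v : Fin n} (hw : ∀ e ∈ S, e.1 ≠ w) (hwv : w ≠ v)
    (σ : d.Matching) (t : ℕ) : (d.walkOn S σ ^ t) w v = 0 := by
  cases t with
  | zero => simp [hwv]
  | succ t =>
    have hout : ∀ i, (⟨w, i⟩ : d.Tail) ∉ S := fun i hi => hw _ hi rfl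
    rw [← one_mul ((d.walkOn S σ ^ (t + 1)) w v), mul_pow_succ_apply_eq_mulVec]
    simp only [walkOn_mulVec, hout, if_false, Finset.expect_const_zero]

/-- One step of the walk, with the matching revealed along the way: either the step uses a
revealed tail, or its tail is revealed by the step. -/
theorem expect_walk_mulVec_le {S : Finset d.Tail} {σ₀ : d.Matching} {y : Fin n}
    {H : d.Matching → Fin n → ℝ} {φ : Fin n → ℝ} {B : ℝ} (hB : 0 ≤ B)
    (hold : ∀ i, (⟨y, i⟩ : d.Tail) ∈ S →
      𝔼 σ ∈ cylinder S σ₀, H σ (σ₀ ⟨y, i⟩).1 ≤ φ (σ₀ ⟨y, i⟩).1 + B)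
    (hnew : ∀ i, (⟨y, i⟩ : d.Tail) ∉ S →
      𝔼 σ₁ ∈ cylinder S σ₀, 𝔼 σ ∈ cylinder (insert ⟨y, i⟩ S) σ₁, H σ (σ₁ ⟨y, i⟩).1 ≤ B) :
    𝔼 σ ∈ cylinder S σ₀, (d.walk σ *ᵥ H σ) y ≤ (d.walkOn S σ₀ *ᵥ φ) y + B := by
  have hstep : ∀ i, 𝔼 σ ∈ cylinder S σ₀, H σ (σ ⟨y, i⟩).1 ≤
      (if (⟨y, i⟩ : d.Tail) ∈ S then φ (σ₀ ⟨y, i⟩).1 else 0) + B := by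
    intro i
    split_ifs with hi
    · refine le_of_eq_of_le (Finset.expect_congr rfl fun σ hσ => ?_) (hold i hi)
      rw [mem_cylinder.1 hσ _ hi]
    · rw [zero_add, ← expect_cylinder_tower S ⟨y, i⟩]
      refine le_of_eq_of_le (Finset.expect_congr rfl fun σ₁ _ =>
        Finset.expect_congr rfl fun σ hσ => ?_) (hnew i hi)
      rw [mem_cylinder.1 hσ _ (Finset.mem_insert_self _ _)]
  have hconst : 𝔼 _i : Fin (d.outDeg y), B ≤ B := by
    rcases isEmpty_or_nonempty (Fin (d.outDeg y)) with _ | _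
    · simpa using hB
    · rw [Fintype.expect_const]
  simp only [walk_mulVec]
  rw [Finset.expect_comm, walkOn_mulVec]
  refine (Finset.expect_le_expect fun i _ => hstep i).trans ?_
  rw [Finset.expect_add_distrib]
  gcongr

end RevealedEdges

section SizeBias

variable {n : ℕ} {d : BiDegree n}

/-- A bound for the probability, weighted by inverse in-degrees, that a newly revealed edge leads
to one of the at most `L + 2` vertices met so far, when at most `L` edges have been revealed. -/
noncomputable def entranceRate (d : BiDegree n) (L : ℕ) : ℝ :=
  ((L : ℝ) + 2) / ((Fintype.card d.Tail : ℝ) - L)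

theorem entranceRate_nonneg {L : ℕ} (hL : L ≤ Fintype.card d.Tail) : 0 ≤ d.entranceRate L :=
  div_nonneg (by positivity) (sub_nonneg.2 (mod_cast hL))

theorem entranceRate_mono {L L' : ℕ} (h : L ≤ L') (hL' : L' < Fintype.card d.Tail) :
    d.entranceRate L ≤ d.entranceRate L' := by
  have hpos : (0 : ℝ) < (Fintype.card d.Tail : ℝ) - L' := sub_pos.2 (mod_cast hL')
  unfold entranceRate
  gcongr

/-- Size bias: a new edge leads to `w` with probability proportional to the in-degree of `w`,
which the weight cancels. -/
theorem expect_inv_inDeg_le {S : Finset d.Tail} {e : d.Tail} (he : e ∉ S) (σ₀ : d.Matching)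
    (W : Finset (Fin n)) :
    𝔼 σ ∈ cylinder S σ₀, (if (σ e).1 ∈ W then ((d.inDeg (σ e).1 : ℝ))⁻¹ else 0) ≤
      W.card / ((Fintype.card d.Tail : ℝ) - S.card) := by
  set ψ : Fin n → ℝ := fun w => if w ∈ W then ((d.inDeg w : ℝ))⁻¹ else 0 with hψ
  have hψ0 : ∀ w, 0 ≤ ψ w := fun w => by simp only [hψ]; split_ifs <;> positivity
  have hlt : (S.card : ℝ) < Fintype.card d.Tail := mod_cast Finset.card_lt_univ_of_notMem he
  have hsum : ∑ f : d.Head, ψ f.1 ≤ W.card := by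
    rw [sum_head]
    calc ∑ w, (d.inDeg w : ℝ) * ψ w ≤ ∑ w, if w ∈ W then (1 : ℝ) else 0 := by
          refine Finset.sum_le_sum fun w _ => ?_
          simp only [hψ]
          split_ifs
          · exact mul_inv_le_one
          · simp
      _ = W.card := by simp
  refine (expect_apply_le he σ₀ (φ := fun f => ψ f.1) (fun f => hψ0 f.1) Finset.univ
    (fun f hf => absurd (Finset.mem_univ f) hf)).trans ?_
  exact div_le_div_of_nonneg_right hsum (sub_pos.2 hlt).le

theorem expect_inv_inDeg_le_entranceRate {L : ℕ} {S : Finset d.Tail} {e : d.Tail} (he : e ∉ S)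
    (hS : S.card < L) (hL : L < Fintype.card d.Tail) (σ₀ : d.Matching) (v : Fin n) :
    𝔼 σ ∈ cylinder S σ₀, (if (σ e).1 ∈ insert v ((insert e S).image Sigma.fst)
      then ((d.inDeg (σ e).1 : ℝ))⁻¹ else 0) ≤ d.entranceRate L := by
  have hcard : (insert v ((insert e S).image Sigma.fst)).card ≤ L + 2 := by
    have hins : (insert e S).card = S.card + 1 := Finset.card_insert_of_notMem he
    have himg := Finset.card_image_le (s := insert e S) (f := Sigma.fst)
    exact (Finset.card_insert_le _ _).trans (by omega)
  have hpos : (0 : ℝ) < (Fintype.card d.Tail : ℝ) - L := sub_pos.2 (mod_cast hL)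
  refine (expect_inv_inDeg_le he σ₀ _).trans ?_
  unfold entranceRate
  gcongr
  exact_mod_cast hcard

section Weighted

variable {g k : d.Matching → ℝ} {v : Fin n} {h : ℕ} {G : ℝ}

theorem expect_mul_walkOn_pow_le (hg : ∀ σ, 0 ≤ g σ) (hk : ∀ σ, 0 ≤ k σ) {t : ℕ}
    (hkv : ∀ σ w, k σ * ((d.inDeg w : ℝ) * (d.walk σ ^ t) w v) ≤ 1)
    {S : Finset d.Tail} {σ₀ : d.Matching} (hG : 𝔼 σ ∈ cylinder S σ₀, g σ ≤ G)
    {w : Fin n} (hw : 0 < d.inDeg w) :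
    (𝔼 σ ∈ cylinder S σ₀, g σ * k σ) * (d.walkOn S σ₀ ^ t) w v ≤
      G * if w ∈ insert v (S.image Sigma.fst) then ((d.inDeg w : ℝ))⁻¹ else 0 := by
  have hw' : (0 : ℝ) < d.inDeg w := mod_cast hw
  split_ifs with hmem
  · have hweight : ∀ σ ∈ cylinder S σ₀,
        g σ * k σ * (d.walkOn S σ₀ ^ t) w v ≤ g σ * ((d.inDeg w : ℝ))⁻¹ := by
      intro σ hσ
      have hkσ : k σ * (d.walk σ ^ t) w v ≤ ((d.inDeg w : ℝ))⁻¹ := by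
        rw [← one_div, le_div_iff₀ hw']
        linarith [hkv σ w]
      rw [← walkOn_congr (mem_cylinder.1 hσ), mul_assoc]
      exact mul_le_mul_of_nonneg_left ((mul_le_mul_of_nonneg_left
        (walkOn_pow_le_walk_pow S σ t w v) (hk σ)).trans hkσ) (hg σ)
    rw [Finset.expect_mul]
    refine (Finset.expect_le_expect hweight).trans ?_
    rw [← Finset.expect_mul]
    gcongr
  · obtain ⟨hwv, hwS⟩ := not_or.1 (Finset.mem_insert.not.1 hmem)
    rw [walkOn_pow_eq_zero (fun e he hew => hwS (Finset.mem_image.2 ⟨e, he, hew⟩)) hwv,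
      mul_zero, mul_zero]

/-- Given what has been revealed, a further walk reaches `v` along revealed edges, or else enters
the revealed part through a new edge. -/
theorem expect_mul_walk_pow_le (hg : ∀ σ, 0 ≤ g σ) (hk : ∀ σ, 0 ≤ k σ) {L : ℕ}
    (hL : L < Fintype.card d.Tail)
    (hkv : ∀ σ w, ∀ t ≤ h, k σ * ((d.inDeg w : ℝ) * (d.walk σ ^ t) w v) ≤ 1)
    (hG : ∀ (S : Finset d.Tail) σ₀, S.card ≤ L → 𝔼 σ ∈ cylinder S σ₀, g σ ≤ G) (hG0 : 0 ≤ G)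
    {t : ℕ} (ht : t ≤ h) {S : Finset d.Tail} (hS : S.card + t ≤ L) (σ₀ : d.Matching)
    (y : Fin n) :
    𝔼 σ ∈ cylinder S σ₀, g σ * k σ * (d.walk σ ^ t) y v ≤
      (𝔼 σ ∈ cylinder S σ₀, g σ * k σ) * (d.walkOn S σ₀ ^ t) y v +
        t * (d.entranceRate L * G) := by
  have hrate := entranceRate_nonneg hL.le
  induction t generalizing S σ₀ y with
  | zero => simp [Finset.expect_mul]
  | succ t ih =>
    have hnew : ∀ i, (⟨y, i⟩ : d.Tail) ∉ S → 𝔼 σ₁ ∈ cylinder S σ₀,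
        𝔼 σ ∈ cylinder (insert ⟨y, i⟩ S) σ₁, g σ * k σ * (d.walk σ ^ t) (σ₁ ⟨y, i⟩).1 v ≤
          ((t + 1 : ℕ) : ℝ) * (d.entranceRate L * G) := by
      intro i hi
      have hcard := Finset.card_insert_of_notMem hi
      refine (Finset.expect_le_expect fun σ₁ _ => (ih (by omega) (by omega) σ₁ _).trans
        (add_le_add_left (expect_mul_walkOn_pow_le hg hk (fun σ w => hkv σ w t (by omega))
          (hG _ σ₁ (by omega)) (σ₁ ⟨y, i⟩).2.pos) _)).trans ?_
      rw [Finset.expect_add_distrib, ← Finset.mul_expect, expect_cylinder_const]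
      refine (add_le_add_left (mul_le_mul_of_nonneg_left
        (expect_inv_inDeg_le_entranceRate hi (by omega) hL σ₀ v) hG0) _).trans_eq ?_
      push_cast
      ring
    have hold : ∀ i, (⟨y, i⟩ : d.Tail) ∈ S →
        𝔼 σ ∈ cylinder S σ₀, g σ * k σ * (d.walk σ ^ t) (σ₀ ⟨y, i⟩).1 v ≤
          (𝔼 σ ∈ cylinder S σ₀, g σ * k σ) * (d.walkOn S σ₀ ^ t) (σ₀ ⟨y, i⟩).1 v +
            ((t + 1 : ℕ) : ℝ) * (d.entranceRate L * G) := by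
      intro i _
      refine (ih (by omega) (by omega) σ₀ _).trans ?_
      gcongr
      exact Nat.le_succ t
    simp only [mul_pow_succ_apply_eq_mulVec]
    exact expect_walk_mulVec_le (by positivity) hold hnew

variable {ν : Fin n → ℝ}

theorem expect_mul_vecMul_walk_pow_le (hg : ∀ σ, 0 ≤ g σ) (hk : ∀ σ, 0 ≤ k σ) {L : ℕ}
    (hL : L < Fintype.card d.Tail)
    (hkv : ∀ σ w, ∀ t ≤ h, k σ * ((d.inDeg w : ℝ) * (d.walk σ ^ t) w v) ≤ 1)
    (hG : ∀ (S : Finset d.Tail) σ₀, S.card ≤ L → 𝔼 σ ∈ cylinder S σ₀, g σ ≤ G) (hG0 : 0 ≤ G)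
    (hν : 0 ≤ ν) (hν1 : ∑ x, ν x ≤ 1) {S : Finset d.Tail} (hS : S.card + h ≤ L)
    (σ₀ : d.Matching) :
    𝔼 σ ∈ cylinder S σ₀, g σ * k σ * (ν ᵥ* d.walk σ ^ h) v ≤
      (𝔼 σ ∈ cylinder S σ₀, g σ * k σ) * (ν ᵥ* d.walkOn S σ₀ ^ h) v +
        h * (d.entranceRate L * G) := by
  have hrate := entranceRate_nonneg hL.le
  simp only [Matrix.vecMul, dotProduct, Finset.mul_sum, mul_left_comm _ (ν _)]
  rw [Finset.expect_sum_comm]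
  simp only [← Finset.mul_expect]
  calc _ ≤ ∑ x, ν x * ((𝔼 σ ∈ cylinder S σ₀, g σ * k σ) * (d.walkOn S σ₀ ^ h) x v +
          h * (d.entranceRate L * G)) :=
        Finset.sum_le_sum fun x _ => mul_le_mul_of_nonneg_left
          (expect_mul_walk_pow_le hg hk hL hkv hG hG0 le_rfl hS σ₀ x) (hν x)
    _ ≤ _ := by
        simp only [mul_add, Finset.sum_add_distrib, ← Finset.sum_mul]
        exact add_le_add le_rfl (mul_le_of_le_one_left (by positivity) hν1)

/-- Moments of the probability to be at `v`, relative to a weight `k` for which all entrances into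
the revealed part are cheap: the `q` factors are the laws of `q` walks, run one after another. -/
theorem expect_mul_vecMul_walk_pow_pow_le (hg : ∀ σ, 0 ≤ g σ) (hg1 : ∀ σ, g σ ≤ 1)
    (hk : ∀ σ, 0 ≤ k σ) {L : ℕ} (hL : L < Fintype.card d.Tail)
    (hkv : ∀ σ w, ∀ t ≤ h, k σ * ((d.inDeg w : ℝ) * (d.walk σ ^ t) w v) ≤ 1)
    (hν : 0 ≤ ν) (hν1 : ∑ x, ν x ≤ 1) {β : ℝ} (hβ0 : 0 ≤ β)
    (hβ : ∀ σ (S : Finset d.Tail), g σ ≠ 0 → S.card ≤ L →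
      k σ * (ν ᵥ* d.walkOn S σ ^ h) v ≤ β)
    {q : ℕ} {S : Finset d.Tail} (hS : S.card + q * h ≤ L) (σ₀ : d.Matching) :
    𝔼 σ ∈ cylinder S σ₀, g σ * (k σ * (ν ᵥ* d.walk σ ^ h) v) ^ q ≤
      (β + h * d.entranceRate L) ^ q := by
  have hrate := entranceRate_nonneg hL.le
  induction q generalizing S σ₀ with
  | zero => exact Finset.expect_le cylinder_nonempty fun σ _ => by simpa using hg1 σ
  | succ q ih =>
    have hqh : (q + 1) * h = q * h + h := Nat.succ_mul q h
    set g' : d.Matching → ℝ := fun σ => g σ * (k σ * (ν ᵥ* d.walk σ ^ h) v) ^ q with hg'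
    set G : ℝ := (β + h * d.entranceRate L) ^ q with hG
    have hg'0 : ∀ σ, 0 ≤ g' σ := fun σ => mul_nonneg (hg σ) (pow_nonneg (mul_nonneg (hk σ)
      (dotProduct_nonneg_of_nonneg hν (walk_pow_nonneg σ h · v))) q)
    have hrevealed : (𝔼 σ ∈ cylinder S σ₀, g' σ * k σ) * (ν ᵥ* d.walkOn S σ₀ ^ h) v ≤
        β * G := by
      refine le_trans ?_ (mul_le_mul_of_nonneg_left (ih (S := S) (by omega) σ₀) hβ0)
      rw [Finset.expect_mul, Finset.mul_expect]
      refine Finset.expect_le_expect fun σ hσ => ?_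
      rw [← walkOn_congr (mem_cylinder.1 hσ), mul_assoc, mul_comm (g' σ)]
      by_cases hgσ : g σ = 0
      · simp [hg', hgσ]
      · exact mul_le_mul_of_nonneg_right (hβ σ S hgσ (by omega)) (hg'0 σ)
    have hstep := expect_mul_vecMul_walk_pow_le (L := L - q * h) hg'0 hk (by omega) hkv
      (fun S' τ hS' => ih (by omega) τ) (by positivity) hν hν1 (S := S) (by omega) σ₀
    have hrate' : d.entranceRate (L - q * h) ≤ d.entranceRate L :=
      entranceRate_mono (Nat.sub_le _ _) hL
    calc _ = 𝔼 σ ∈ cylinder S σ₀, g' σ * k σ * (ν ᵥ* d.walk σ ^ h) v :=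
          Finset.expect_congr rfl fun σ _ => by rw [hg', pow_succ]; ring
      _ ≤ β * G + h * (d.entranceRate L * G) := by
          refine hstep.trans (add_le_add hrevealed ?_)
          gcongr
      _ = (β + h * d.entranceRate L) ^ (q + 1) := by rw [pow_succ, ← hG]; ring

end Weighted

end SizeBias

end BiDegree

theorem add_pow_eq_pow_add_sum {R : Type*} [Semiring R] (A E : R) (t : ℕ) :
    (A + E) ^ t = A ^ t + ∑ b ∈ Finset.range t, (A + E) ^ (t - 1 - b) * E * A ^ b := by
  induction t with
  | zero => simp
  | succ t ih =>
    have hshift : ∀ b ∈ Finset.range t, (A + E) ^ (t + 1 - 1 - b) * E * A ^ b =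
        (A + E) * ((A + E) ^ (t - 1 - b) * E * A ^ b) := by
      intro b hb
      have hbt : t + 1 - 1 - b = t - 1 - b + 1 := by
        have := Finset.mem_range.1 hb
        omega
      simp only [hbt, pow_succ', mul_assoc]
    calc (A + E) ^ (t + 1) = A ^ (t + 1) + (E * A ^ t +
          (A + E) * ∑ b ∈ Finset.range t, (A + E) ^ (t - 1 - b) * E * A ^ b) := by
          rw [← add_assoc, pow_succ' A, ← add_mul, ← mul_add, ← ih, pow_succ']
      _ = A ^ (t + 1) + ∑ b ∈ Finset.range (t + 1), (A + E) ^ (t + 1 - 1 - b) * E * A ^ b := by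
          rw [Finset.sum_range_succ, Finset.sum_congr rfl hshift, ← Finset.mul_sum,
            add_comm (E * _)]
          simp only [Nat.add_sub_cancel, Nat.sub_self, pow_zero, one_mul]

/-- The walks of length `t` along `A` and a new edge `p → w`, sorted by the last use of that
edge. -/
theorem add_single_pow_apply {ι R : Type*} [Fintype ι] [DecidableEq ι] [Semiring R]
    (A : Matrix ι ι R) (p w : ι) (t : ℕ) (u z : ι) :
    ((A + Matrix.single p w 1 : Matrix ι ι R) ^ t) u z = (A ^ t) u z +
      ∑ b ∈ Finset.range t,
        ((A + Matrix.single p w 1 : Matrix ι ι R) ^ (t - 1 - b)) u p * (A ^ b) w z := by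
  rw [add_pow_eq_pow_add_sum, Matrix.add_apply, Matrix.sum_apply]
  congr 1
  refine Finset.sum_congr rfl fun b _ => ?_
  rw [Matrix.mul_apply, Finset.sum_eq_single w]
  · rw [Matrix.mul_single_apply_same, mul_one]
  · intro x _ hx
    rw [Matrix.mul_single_apply_of_ne _ _ _ _ _ hx, zero_mul]
  · exact fun hw => absurd (Finset.mem_univ w) hw

namespace BiDegree

section Paths

variable {n : ℕ} {d : BiDegree n} {S : Finset d.Tail} {σ τ : d.Matching} {e : d.Tail}

theorem walkOn_pow_le_edgeCount_pow (hout : ∀ v, 2 ≤ d.outDeg v) (S : Finset d.Tail)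
    (σ : d.Matching) (t : ℕ) (y x : Fin n) :
    (d.walkOn S σ ^ t) y x ≤ (1 / 2) ^ t * ((d.edgeCount S σ ^ t) y x : ℝ) := by
  induction t generalizing y with
  | zero => simp [Matrix.one_apply]
  | succ t ih =>
    simp only [pow_succ', Matrix.mul_apply, Nat.cast_sum, Finset.mul_sum, Nat.cast_mul]
    refine Finset.sum_le_sum fun z _ => ?_
    have hhalf : (d.outDeg y : ℝ)⁻¹ ≤ 1 / 2 := by
      rw [one_div]
      gcongr
      exact_mod_cast hout y
    have hstep : d.walkOn S σ y z ≤ 1 / 2 * (d.edgeCount S σ y z : ℝ) := by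
      rw [walkOn, div_eq_inv_mul]
      gcongr
    calc _ ≤ (1 / 2 * (d.edgeCount S σ y z : ℝ)) *
            ((1 / 2) ^ t * ((d.edgeCount S σ ^ t) z x : ℝ)) :=
          mul_le_mul hstep (ih z) (walkOn_pow_nonneg S σ t z x) (by positivity)
      _ = _ := by ring

/-- The tails in `S` span at most one path, of any length, between any two vertices. -/
def UniquePaths (d : BiDegree n) (S : Finset d.Tail) (σ : d.Matching) : Prop :=
  ∀ u z N, ∑ t ∈ Finset.range N, (d.edgeCount S σ ^ t) u z ≤ 1

/-- The tails in `S` span at most `t + 1` paths of length `t` between any two vertices. -/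
def FewPaths (d : BiDegree n) (S : Finset d.Tail) (σ : d.Matching) : Prop :=
  ∀ u z t, (d.edgeCount S σ ^ t) u z ≤ t + 1

theorem UniquePaths.pow_le_one (h : d.UniquePaths S σ) (u z : Fin n) (t : ℕ) :
    (d.edgeCount S σ ^ t) u z ≤ 1 :=
  (Finset.single_le_sum (f := fun t => (d.edgeCount S σ ^ t) u z) (fun _ _ => Nat.zero_le _)
    (Finset.self_mem_range_succ t)).trans (h u z (t + 1))

theorem UniquePaths.fewPaths (h : d.UniquePaths S σ) : d.FewPaths S σ := fun u z t =>
  (h.pow_le_one u z t).trans (Nat.le_add_left 1 t)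

theorem uniquePaths_empty (σ : d.Matching) : d.UniquePaths ∅ σ := by
  intro u z N
  have hempty : d.edgeCount ∅ σ = 0 := Finset.sum_empty
  calc ∑ t ∈ Finset.range N, (d.edgeCount ∅ σ ^ t) u z
      ≤ ∑ t ∈ Finset.range N, if t = 0 then 1 else 0 := by
        refine Finset.sum_le_sum fun t _ => ?_
        rcases t.eq_zero_or_pos with rfl | ht
        · rw [pow_zero, Matrix.one_apply, if_pos rfl]
          split_ifs <;> simp
        · simp [hempty, ht.ne']
    _ ≤ 1 := by
        rw [Finset.sum_ite_eq']
        split_ifs <;> simp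

theorem UniquePaths.fewPaths_insert (h : d.UniquePaths S σ) (he : e ∉ S) :
    d.FewPaths (insert e S) σ := by
  intro u z t
  induction t using Nat.strong_induction_on generalizing u z with
  | _ t ih =>
    rw [edgeCount_insert he, add_single_pow_apply, ← edgeCount_insert he]
    calc _ ≤ 1 + ∑ b ∈ Finset.range t, t * (d.edgeCount S σ ^ b) (σ e).1 z := by
          refine Nat.add_le_add (h.pow_le_one u z t) (Finset.sum_le_sum fun b hb => ?_)
          have hbt := Finset.mem_range.1 hb
          exact Nat.mul_le_mul_right _ ((ih (t - 1 - b) (by omega) u e.1).trans (by omega))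
      _ ≤ 1 + t * 1 := by
          rw [← Finset.mul_sum]
          gcongr
          exact h _ _ _
      _ = t + 1 := by ring

/-- The head matched to `e` belongs to a vertex that neither `e` nor the edges from `S` touch. -/
def IsFresh (d : BiDegree n) (S : Finset d.Tail) (σ : d.Matching) (e : d.Tail) : Prop :=
  (σ e).1 ≠ e.1 ∧ ∀ e' ∈ S, e'.1 ≠ (σ e).1 ∧ (σ e').1 ≠ (σ e).1

theorem edgeCount_pow_row_eq_zero {w : Fin n} (hw : ∀ e' ∈ S, e'.1 ≠ w) {b : ℕ} {z : Fin n}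
    (h : b ≠ 0 ∨ w ≠ z) : (d.edgeCount S σ ^ b) w z = 0 := by
  cases b with
  | zero => rw [pow_zero, Matrix.one_apply_ne (h.resolve_left (absurd rfl))]
  | succ b =>
    have hrow : ∀ x, d.edgeCount S σ w x = 0 := fun x => by
      rw [edgeCount_apply]
      exact Finset.sum_eq_zero fun i _ => if_neg fun hi => hw _ hi.1 rfl
    simp only [pow_succ', Matrix.mul_apply, hrow, zero_mul, Finset.sum_const_zero]

theorem edgeCount_pow_col_eq_zero {w : Fin n} (hw : ∀ e' ∈ S, (σ e').1 ≠ w) {b : ℕ} (u : Fin n)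
    (hb : b ≠ 0) : (d.edgeCount S σ ^ b) u w = 0 := by
  obtain ⟨b, rfl⟩ := Nat.exists_eq_succ_of_ne_zero hb
  have hcol : ∀ x, d.edgeCount S σ x w = 0 := fun x => by
    rw [edgeCount_apply]
    exact Finset.sum_eq_zero fun i _ => if_neg fun hi => hw _ hi.1 hi.2
  simp only [pow_succ, Matrix.mul_apply, hcol, mul_zero, Finset.sum_const_zero]

namespace IsFresh

variable (hf : d.IsFresh S σ e) (he : e ∉ S)

include hf he

theorem edgeCount_insert_pow_of_ne {u z : Fin n} (hz : z ≠ (σ e).1) (t : ℕ) :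
    (d.edgeCount (insert e S) σ ^ t) u z = (d.edgeCount S σ ^ t) u z := by
  rw [edgeCount_insert he, add_single_pow_apply, Finset.sum_eq_zero, add_zero]
  intro b _
  rw [edgeCount_pow_row_eq_zero (fun e' he' => (hf.2 e' he').1) (Or.inr hz.symm), mul_zero]

theorem edgeCount_insert_pow_succ (u : Fin n) (t : ℕ) :
    (d.edgeCount (insert e S) σ ^ (t + 1)) u (σ e).1 = (d.edgeCount S σ ^ t) u e.1 := by
  conv_lhs => rw [edgeCount_insert he, add_single_pow_apply, ← edgeCount_insert he]
  rw [edgeCount_pow_col_eq_zero (fun e' he' => (hf.2 e' he').2) u t.succ_ne_zero, zero_add,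
    Finset.sum_range_succ', Finset.sum_eq_zero, zero_add]
  · simp only [Nat.add_sub_cancel, Nat.sub_zero, pow_zero, Matrix.one_apply_eq, mul_one]
    exact hf.edgeCount_insert_pow_of_ne he hf.1.symm t
  · intro b _
    rw [edgeCount_pow_row_eq_zero (fun e' he' => (hf.2 e' he').1) (Or.inl b.succ_ne_zero),
      mul_zero]

end IsFresh

theorem UniquePaths.insert_of_isFresh (h : d.UniquePaths S σ) (he : e ∉ S)
    (hf : d.IsFresh S σ e) : d.UniquePaths (insert e S) σ := by
  intro u z N
  by_cases hz : z = (σ e).1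
  · subst hz
    cases N with
    | zero => simp
    | succ N =>
      rw [Finset.sum_range_succ', pow_zero]
      simp only [hf.edgeCount_insert_pow_succ he]
      by_cases hu : u = (σ e).1
      · rw [hu, Matrix.one_apply_eq, Finset.sum_eq_zero fun t _ =>
          edgeCount_pow_row_eq_zero (fun e' he' => (hf.2 e' he').1) (Or.inr hf.1), zero_add]
      · rw [Matrix.one_apply_ne hu, add_zero]
        exact h _ _ _
  · simp only [hf.edgeCount_insert_pow_of_ne he hz]
    exact h _ _ _

theorem FewPaths.insert_of_isFresh (h : d.FewPaths S σ) (he : e ∉ S)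
    (hf : d.IsFresh S σ e) : d.FewPaths (insert e S) σ := by
  intro u z t
  by_cases hz : z = (σ e).1
  · subst hz
    cases t with
    | zero =>
      rw [pow_zero, Matrix.one_apply]
      split_ifs <;> simp
    | succ t =>
      rw [hf.edgeCount_insert_pow_succ he]
      exact (h _ _ _).trans (Nat.le_succ _)
  · rw [hf.edgeCount_insert_pow_of_ne he hz]
    exact h _ _ _

/-- The vertices touched when the tails in `S` are revealed and `e` is about to be. -/
def seen (d : BiDegree n) (S : Finset d.Tail) (σ : d.Matching) (e : d.Tail) : Finset (Fin n) :=
  insert e.1 (S.image Sigma.fst ∪ S.image fun e' => (σ e').1)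

theorem card_seen_le (S : Finset d.Tail) (σ : d.Matching) (e : d.Tail) :
    (d.seen S σ e).card ≤ 2 * S.card + 1 := by
  have hinsert := Finset.card_insert_le e.1 (S.image Sigma.fst ∪ S.image fun e' => (σ e').1)
  have hunion := Finset.card_union_le (S.image Sigma.fst) (S.image fun e' => (σ e').1)
  have htails := Finset.card_image_le (s := S) (f := Sigma.fst)
  have hheads := Finset.card_image_le (s := S) (f := fun e' => (σ e').1)
  unfold seen
  omega

theorem isFresh_of_notMem_seen (hσ : σ ∈ cylinder S τ) (h : (σ e).1 ∉ d.seen S τ e) :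
    d.IsFresh S σ e := by
  simp only [seen, Finset.mem_insert, Finset.mem_union, Finset.mem_image, not_or, not_exists,
    not_and] at h
  refine ⟨h.1, fun e' he' => ⟨h.2.1 e' he', ?_⟩⟩
  rw [mem_cylinder.1 hσ e' he']
  exact h.2.2 e' he'

end Paths

section Collisions

variable {n : ℕ} {d : BiDegree n} {L : ℕ} {ρ : ℝ}

/-- While at most `L` heads are revealed, the next one belongs to a given set of at most `2 L + 2`
vertices with probability at most `ρ`: the heads of such a set are a fraction `ρ` of the
`card d.Tail - L` heads that are surely left. -/
structure CollisionBound (d : BiDegree n) (L : ℕ) (ρ : ℝ) : Prop where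
  lt_card : L < Fintype.card d.Tail
  sum_inDeg_le : ∀ V : Finset (Fin n), V.card ≤ 2 * L + 2 →
    ∑ w ∈ V, (d.inDeg w : ℝ) ≤ ρ * ((Fintype.card d.Tail : ℝ) - L)

namespace CollisionBound

theorem nonneg (hC : d.CollisionBound L ρ) : 0 ≤ ρ := by
  have hpos : (0 : ℝ) < (Fintype.card d.Tail : ℝ) - L := sub_pos.2 (mod_cast hC.lt_card)
  have hempty := hC.sum_inDeg_le ∅ (Nat.zero_le _)
  rw [Finset.sum_empty] at hempty
  exact nonneg_of_mul_nonneg_left hempty hpos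

theorem of_le (hC : d.CollisionBound L ρ) {L' : ℕ} (h : L' ≤ L) : d.CollisionBound L' ρ where
  lt_card := h.trans_lt hC.lt_card
  sum_inDeg_le V hV := (hC.sum_inDeg_le V (by omega)).trans <| by
    have := hC.nonneg
    gcongr

theorem of_inDeg_le {Δ : ℝ} (hL : L < Fintype.card d.Tail) (hΔ0 : 0 ≤ Δ)
    (hΔ : ∀ w, (d.inDeg w : ℝ) ≤ Δ)
    (hρ : (2 * (L : ℝ) + 2) * Δ ≤ ρ * ((Fintype.card d.Tail : ℝ) - L)) :
    d.CollisionBound L ρ where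
  lt_card := hL
  sum_inDeg_le V hV := by
    have hcard : (V.card : ℝ) ≤ 2 * L + 2 := mod_cast hV
    calc ∑ w ∈ V, (d.inDeg w : ℝ) ≤ V.card • Δ := Finset.sum_le_card_nsmul V _ Δ fun w _ => hΔ w
      _ = V.card * Δ := nsmul_eq_mul _ _
      _ ≤ (2 * (L : ℝ) + 2) * Δ := by gcongr
      _ ≤ _ := hρ

end CollisionBound

theorem expect_le_of_collisionBound (hC : d.CollisionBound L ρ) {S : Finset d.Tail} {e : d.Tail}
    (he : e ∉ S) (hS : S.card ≤ L) {V : Finset (Fin n)} (hV : V.card ≤ 2 * L + 2)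
    {F : d.Matching → ℝ} {σ₀ : d.Matching} {B X : ℝ} (hX : 0 ≤ X)
    (hout : ∀ σ ∈ cylinder S σ₀, (σ e).1 ∉ V → F σ ≤ B)
    (hin : ∀ σ ∈ cylinder S σ₀, F σ ≤ B + X) : 𝔼 σ ∈ cylinder S σ₀, F σ ≤ B + ρ * X := by
  have hpos : (0 : ℝ) < (Fintype.card d.Tail : ℝ) - L := sub_pos.2 (mod_cast hC.lt_card)
  set φ : Fin n → ℝ := fun w => if w ∈ V then 1 else 0 with hφ
  have hφ0 : ∀ w, 0 ≤ φ w := fun w => by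
    simp only [hφ]
    split_ifs <;> norm_num
  have hheads : ∑ f : d.Head, φ f.1 = ∑ w ∈ V, (d.inDeg w : ℝ) := by
    rw [sum_head d φ]
    simp only [hφ, mul_ite, mul_one, mul_zero, Finset.sum_ite_mem, Finset.univ_inter]
  have hhit : 𝔼 σ ∈ cylinder S σ₀, φ (σ e).1 ≤ ρ :=
    calc 𝔼 σ ∈ cylinder S σ₀, φ (σ e).1
        ≤ (∑ w ∈ V, (d.inDeg w : ℝ)) / ((Fintype.card d.Tail : ℝ) - S.card) := by
          rw [← hheads]
          exact expect_apply_le he σ₀ (φ := fun f => φ f.1) (fun f => hφ0 f.1) Finset.univ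
            fun f hf => absurd (Finset.mem_univ f) hf
      _ ≤ (∑ w ∈ V, (d.inDeg w : ℝ)) / ((Fintype.card d.Tail : ℝ) - L) := by gcongr
      _ ≤ ρ := div_le_of_le_mul₀ hpos.le hC.nonneg (hC.sum_inDeg_le V hV)
  calc 𝔼 σ ∈ cylinder S σ₀, F σ ≤ 𝔼 σ ∈ cylinder S σ₀, (B + X * φ (σ e).1) := by
        refine Finset.expect_le_expect fun σ hσ => ?_
        by_cases hw : (σ e).1 ∈ V
        · simpa [hφ, hw] using hin σ hσ
        · simpa [hφ, hw] using hout σ hσ hw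
    _ = B + X * 𝔼 σ ∈ cylinder S σ₀, φ (σ e).1 := by
        rw [Finset.expect_add_distrib, expect_cylinder_const, Finset.mul_expect]
    _ ≤ B + ρ * X := by
        rw [mul_comm ρ]
        gcongr

/-- The property `Q` of the revealed edges survives when a fresh edge is revealed, and any other
new edge leaves the weaker property `Q'`. -/
structure Degrades (d : BiDegree n) (Q Q' : Finset d.Tail → d.Matching → Prop) : Prop where
  congr : ∀ {S σ τ}, τ ∈ cylinder S σ → Q S σ → Q S τ
  insert_of_isFresh : ∀ {S σ e}, Q S σ → e ∉ S → d.IsFresh S σ e → Q (insert e S) σ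
  of_insert : ∀ {S σ e}, Q S σ → e ∉ S → Q' (insert e S) σ

theorem degrades_uniquePaths_fewPaths : Degrades d d.UniquePaths d.FewPaths where
  congr hτ h := by
    unfold UniquePaths
    rwa [edgeCount_congr (mem_cylinder.1 hτ)]
  insert_of_isFresh := UniquePaths.insert_of_isFresh
  of_insert := UniquePaths.fewPaths_insert

theorem degrades_fewPaths_true : Degrades d d.FewPaths fun _ _ => True where
  congr hτ h := by
    unfold FewPaths
    rwa [edgeCount_congr (mem_cylinder.1 hτ)]
  insert_of_isFresh := FewPaths.insert_of_isFresh
  of_insert _ _ := trivial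

variable {Q Q' : Finset d.Tail → d.Matching → Prop}

/-- Either all the heads revealed by the walk are fresh, and then it ends at a vertex outside `V`
or stays on the edges that were revealed at the start, or else a collision occurs, whose
cost is bounded by `X`. -/
theorem Degrades.expect_walk_pow_mulVec_le (hQ : Degrades d Q Q') (hC : d.CollisionBound L ρ)
    {H : d.Matching → Fin n → ℝ} {V : Finset (Fin n)} (hV : V.card ≤ 1) {F : Fin n → ℝ}
    (hFV : ∀ z ∉ V, F z = 0) {G X : ℝ} (hG : 0 ≤ G) (hX : 0 ≤ X)
    (hbase : ∀ (S : Finset d.Tail) σ z, S.card ≤ L → Q S σ →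
      𝔼 τ ∈ cylinder S σ, H τ z ≤ F z + G)
    (hcoll : ∀ (S : Finset d.Tail) σ y t, S.card + t ≤ L → Q' S σ →
      𝔼 τ ∈ cylinder S σ, (d.walk τ ^ t *ᵥ H τ) y ≤ X)
    {t : ℕ} {S : Finset d.Tail} {σ₀ : d.Matching} (hS : S.card + t ≤ L) (h : Q S σ₀)
    (y : Fin n) :
    𝔼 σ ∈ cylinder S σ₀, (d.walk σ ^ t *ᵥ H σ) y ≤
      (d.walkOn S σ₀ ^ t *ᵥ F) y + (G + t * (ρ * X)) := by
  have hρ := hC.nonneg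
  induction t generalizing S σ₀ y with
  | zero => simpa using hbase S σ₀ y (by omega) h
  | succ t ih =>
    have hlink : (t : ℝ) * (ρ * X) + ρ * X = ((t + 1 : ℕ) : ℝ) * (ρ * X) := by
      push_cast
      ring
    simp only [pow_succ', ← Matrix.mulVec_mulVec]
    refine expect_walk_mulVec_le (by positivity) (fun i _ => ?_) (fun i hi => ?_)
    · refine (ih (by omega) h _).trans ?_
      gcongr
      exact Nat.le_succ t
    have hcard := Finset.card_insert_of_notMem hi
    have hseen := card_seen_le S σ₀ ⟨y, i⟩
    have hunion := Finset.card_union_le V (d.seen S σ₀ ⟨y, i⟩)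
    rw [← hlink, ← add_assoc]
    refine expect_le_of_collisionBound hC hi (by omega) (by omega) hX
      (V := V ∪ d.seen S σ₀ ⟨y, i⟩) (fun σ hσ hw => ?_) (fun σ hσ => ?_)
    · obtain ⟨hwV, hw⟩ := not_or.1 (Finset.mem_union.not.1 hw)
      have hf := isFresh_of_notMem_seen hσ hw
      have htails : ∀ e' ∈ insert ⟨y, i⟩ S, e'.1 ≠ (σ ⟨y, i⟩).1 :=
        Finset.forall_mem_insert _ _ _ |>.2 ⟨hf.1.symm, fun e' he' => (hf.2 e' he').1⟩
      have hzero : (d.walkOn (insert ⟨y, i⟩ S) σ ^ t *ᵥ F) (σ ⟨y, i⟩).1 = 0 := by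
        rw [Matrix.mulVec, dotProduct]
        refine Finset.sum_eq_zero fun z _ => ?_
        by_cases hz : z ∈ V
        · rw [walkOn_pow_eq_zero htails fun hwz => hwV (hwz ▸ hz), zero_mul]
        · rw [hFV z hz, mul_zero]
      refine (ih (by omega) (hQ.insert_of_isFresh (hQ.congr hσ h) hi hf) _).trans_eq ?_
      rw [hzero, zero_add]
    · exact (hcoll _ σ _ t (by omega) (hQ.of_insert (hQ.congr hσ h) hi)).trans
        (le_add_of_nonneg_left (by positivity))

theorem Degrades.expect_mul_walk_pow_le (hQ : Degrades d Q Q') (hC : d.CollisionBound L ρ)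
    {g : d.Matching → ℝ} {z : Fin n} {G X : ℝ} (hX : 0 ≤ X)
    (hbase : ∀ (S : Finset d.Tail) σ, S.card ≤ L → Q S σ → 𝔼 τ ∈ cylinder S σ, g τ ≤ G)
    (hcoll : ∀ (S : Finset d.Tail) σ y t, S.card + t ≤ L → Q' S σ →
      𝔼 τ ∈ cylinder S σ, g τ * (d.walk τ ^ t) y z ≤ X)
    {t : ℕ} {S : Finset d.Tail} {σ₀ : d.Matching} (hS : S.card + t ≤ L) (h : Q S σ₀)
    (y : Fin n) :
    𝔼 σ ∈ cylinder S σ₀, g σ * (d.walk σ ^ t) y z ≤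
      G * (d.walkOn S σ₀ ^ t) y z + t * (ρ * X) := by
  have hsingle : ∀ (A : Matrix (Fin n) (Fin n) ℝ) (c : ℝ) (x : Fin n),
      (A *ᵥ Pi.single z c) x = c * A x z := fun A c x => by
    rw [Matrix.mulVec_single]
    simp [mul_comm]
  have hwalk := hQ.expect_walk_pow_mulVec_le hC (H := fun σ => Pi.single z (g σ)) (V := {z})
    (F := Pi.single z G) (by simp) (fun x hx => by
      rw [Pi.single_eq_of_ne (Finset.mem_singleton.not.1 hx)]) le_rfl hX
    (fun S σ x hS hS' => ?_) (by simpa only [hsingle] using hcoll) hS h y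
  · simpa only [hsingle, zero_add] using hwalk
  · rcases eq_or_ne x z with rfl | hx
    · simpa using hbase S σ hS hS'
    · simp [Pi.single_eq_of_ne hx]

theorem Degrades.expect_walk_pow_pow_le (hQ : Degrades d Q Q') (hC : d.CollisionBound L ρ)
    {R : ℕ} {y z : Fin n} {β x : ℝ} (hx : L * ρ ≤ x)
    (hβ : ∀ S σ, Q S σ → (d.walkOn S σ ^ R) y z ≤ β) {u X : ℕ → ℝ} (hu0 : 1 ≤ u 0)
    (hu : ∀ j, 0 ≤ u j) (hX : ∀ j, 0 ≤ X j) (hrec : ∀ j, u j * β + x * X j ≤ u (j + 1))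
    (hcoll : ∀ j (S : Finset d.Tail) σ w t, S.card + t + j * R ≤ L → Q' S σ →
      𝔼 τ ∈ cylinder S σ, (d.walk τ ^ R) y z ^ j * (d.walk τ ^ t) w z ≤ X j)
    {j : ℕ} {S : Finset d.Tail} {σ₀ : d.Matching} (hS : S.card + j * R ≤ L) (h : Q S σ₀) :
    𝔼 σ ∈ cylinder S σ₀, (d.walk σ ^ R) y z ^ j ≤ u j := by
  induction j generalizing S σ₀ with
  | zero => simpa only [pow_zero, expect_cylinder_const] using hu0
  | succ j ih =>
    have hjR : (j + 1) * R = j * R + R := Nat.succ_mul j R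
    have hρ := hC.nonneg
    have hR : (R : ℝ) ≤ L := mod_cast (by omega : R ≤ L)
    simp only [pow_succ]
    calc _ ≤ u j * (d.walkOn S σ₀ ^ R) y z + R * (ρ * X j) :=
          hQ.expect_mul_walk_pow_le (hC.of_le (Nat.sub_le L (j * R))) (hX j)
            (fun S' σ hS' => ih (by omega))
            (fun S' σ w t hS' => hcoll j S' σ w t (by omega)) (by omega) h y
      _ ≤ u j * β + L * ρ * X j := by
          rw [mul_assoc]
          have := hX j
          exact add_le_add (mul_le_mul_of_nonneg_left (hβ S σ₀ h) (hu j)) (by gcongr)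
      _ ≤ u j * β + x * X j := by
          have := hX j
          gcongr
      _ ≤ u (j + 1) := hrec j

section Spread

variable {R : ℕ} {x : ℝ}

theorem FewPaths.walkOn_pow_le (hout : ∀ v, 2 ≤ d.outDeg v) {S : Finset d.Tail}
    {σ : d.Matching} (h : d.FewPaths S σ) (t : ℕ) (y z : Fin n) :
    (d.walkOn S σ ^ t) y z ≤ ((t : ℝ) + 1) * (1 / 2) ^ t := by
  refine (walkOn_pow_le_edgeCount_pow hout S σ t y z).trans ?_
  rw [mul_comm]
  gcongr
  exact_mod_cast h y z t

theorem expect_walk_pow_pow_le_of_fewPaths (hC : d.CollisionBound L ρ)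
    (hout : ∀ v, 2 ≤ d.outDeg v) (hR : ((R : ℝ) + 1) * (1 / 2) ^ R ≤ x) (hx : L * ρ ≤ x)
    (hx1 : x ≤ 1) {j : ℕ} {S : Finset d.Tail} {σ₀ : d.Matching} (hS : S.card + j * R ≤ L)
    (h : d.FewPaths S σ₀) (y z : Fin n) :
    𝔼 σ ∈ cylinder S σ₀, (d.walk σ ^ R) y z ^ j ≤ x ^ j + j * x := by
  have hx0 : 0 ≤ x := le_trans (by positivity) hR
  refine degrades_fewPaths_true.expect_walk_pow_pow_le hC hx
    (fun S σ hS => (hS.walkOn_pow_le hout R y z).trans hR) (u := fun j => x ^ j + j * x)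
    (X := fun _ => 1) (by simp) (fun j => by positivity) (fun _ => zero_le_one) (fun j => ?_)
    (fun j S σ w t _ _ => Finset.expect_le cylinder_nonempty fun τ _ => ?_) hS h
  · have hjx : (j : ℝ) * x * x ≤ j * x := mul_le_of_le_one_right (by positivity) hx1
    rw [pow_succ]
    push_cast
    linarith
  · exact mul_le_one₀ (pow_le_one₀ (walk_pow_nonneg τ R y z) (walk_pow_le_one τ R y z))
      (walk_pow_nonneg τ t w z) (walk_pow_le_one τ t w z)

theorem expect_walk_pow_pow_mul_walk_pow_le_of_fewPaths (hC : d.CollisionBound L ρ)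
    (hout : ∀ v, 2 ≤ d.outDeg v) (hR : ((R : ℝ) + 1) * (1 / 2) ^ R ≤ x) (hx : L * ρ ≤ x)
    (hx1 : x ≤ 1) {j t : ℕ} {S : Finset d.Tail} {σ₀ : d.Matching} (hS : S.card + t + j * R ≤ L)
    (h : d.FewPaths S σ₀) (y z w : Fin n) :
    𝔼 σ ∈ cylinder S σ₀, (d.walk σ ^ R) y z ^ j * (d.walk σ ^ t) w z ≤
      x ^ j + ((j : ℝ) + 1) * x := by
  have hx0 : 0 ≤ x := le_trans (by positivity) hR
  have hρ := hC.nonneg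
  have ht : (t : ℝ) ≤ L := mod_cast (by omega : t ≤ L)
  have hle1 : (d.walkOn S σ₀ ^ t) w z ≤ 1 :=
    (walkOn_pow_le_walk_pow S σ₀ t w z).trans (walk_pow_le_one σ₀ t w z)
  calc _ ≤ (x ^ j + j * x) * (d.walkOn S σ₀ ^ t) w z + t * (ρ * 1) :=
        degrades_fewPaths_true.expect_mul_walk_pow_le (hC.of_le (Nat.sub_le L (j * R)))
          zero_le_one
          (fun S' σ hS' h' => expect_walk_pow_pow_le_of_fewPaths hC hout hR hx hx1 (by omega) h'
            y z)
          (fun S' σ w' t' _ _ => Finset.expect_le cylinder_nonempty fun τ _ =>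
            mul_le_one₀ (pow_le_one₀ (walk_pow_nonneg τ R y z) (walk_pow_le_one τ R y z))
              (walk_pow_nonneg τ t' w' z) (walk_pow_le_one τ t' w' z)) (by omega) h w
    _ ≤ (x ^ j + j * x) * 1 + L * ρ := by
        rw [mul_one]
        gcongr
    _ ≤ _ := by linarith

theorem expect_walk_pow_pow_le_of_uniquePaths (hC : d.CollisionBound L ρ)
    (hout : ∀ v, 2 ≤ d.outDeg v) (hR : ((R : ℝ) + 1) * (1 / 2) ^ R ≤ x) (hx : L * ρ ≤ x)
    (hx1 : x ≤ 1) {j : ℕ} {S : Finset d.Tail} {σ₀ : d.Matching} (hS : S.card + j * R ≤ L)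
    (h : d.UniquePaths S σ₀) (y z : Fin n) :
    𝔼 σ ∈ cylinder S σ₀, (d.walk σ ^ R) y z ^ j ≤ ((j : ℝ) + 1) * x ^ j + j ^ 2 * x ^ 2 := by
  have hx0 : 0 ≤ x := le_trans (by positivity) hR
  refine degrades_uniquePaths_fewPaths.expect_walk_pow_pow_le hC hx
    (fun S σ hS => (hS.fewPaths.walkOn_pow_le hout R y z).trans hR)
    (u := fun j => ((j : ℝ) + 1) * x ^ j + j ^ 2 * x ^ 2)
    (X := fun j => x ^ j + ((j : ℝ) + 1) * x) (by simp) (fun j => by positivity)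
    (fun j => by positivity) (fun j => ?_)
    (fun j S σ w t hS' h' =>
      expect_walk_pow_pow_mul_walk_pow_le_of_fewPaths hC hout hR hx hx1 hS' h' y z w) hS h
  have hjx : (j : ℝ) ^ 2 * x ^ 2 * x ≤ j ^ 2 * x ^ 2 :=
    mul_le_of_le_one_right (by positivity) hx1
  have hjx2 : 0 ≤ (j : ℝ) * x ^ 2 := by positivity
  rw [pow_succ x j]
  push_cast
  linarith

theorem expect_walk_pow_mulVec_le_of_fewPaths (hC : d.CollisionBound (4 * R) ρ)
    (hout : ∀ v, 2 ≤ d.outDeg v) (hR : ((R : ℝ) + 1) * (1 / 2) ^ R ≤ x)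
    (hx : ((4 * R : ℕ) : ℝ) * ρ ≤ x) (hx1 : x ≤ 1) {S : Finset d.Tail} {σ₀ : d.Matching} {t : ℕ}
    (hS : S.card + t ≤ R) (h : d.FewPaths S σ₀) (y w : Fin n) :
    𝔼 σ ∈ cylinder S σ₀, (d.walk σ ^ t *ᵥ fun z => (d.walk σ ^ R) y z ^ 3) w ≤ 5 * x := by
  have hx0 : 0 ≤ x := le_trans (by positivity) hR
  have hR4 : R ≤ 4 * R := Nat.le_mul_of_pos_left R four_pos
  have ht : (t : ℝ) ≤ (4 * R : ℕ) := mod_cast (by omega : t ≤ 4 * R)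
  have htρ : (t : ℝ) * ρ ≤ x := (mul_le_mul_of_nonneg_right ht hC.nonneg).trans hx
  have hx3 : x ^ 3 ≤ x := pow_le_of_le_one hx0 hx1 three_ne_zero
  have hwalk := degrades_fewPaths_true.expect_walk_pow_mulVec_le (hC.of_le hR4) (V := ∅)
    (H := fun σ z => (d.walk σ ^ R) y z ^ 3) (F := 0) (G := x ^ 3 + 3 * x) (X := 1) (by simp)
    (fun _ _ => rfl) (by positivity) zero_le_one (fun S σ z hS h => ?_)
    (fun S σ w t _ _ => Finset.expect_le cylinder_nonempty fun τ _ => ?_) hS h w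
  · rw [Matrix.mulVec_zero, Pi.zero_apply] at hwalk
    linarith
  · rw [Pi.zero_apply, zero_add]
    exact_mod_cast expect_walk_pow_pow_le_of_fewPaths hC hout hR hx hx1 (j := 3) (by omega) h y z
  · calc (d.walk τ ^ t *ᵥ fun z => (d.walk τ ^ R) y z ^ 3) w
        = ∑ z, (d.walk τ ^ t) w z * (d.walk τ ^ R) y z ^ 3 := rfl
      _ ≤ ∑ z, (d.walk τ ^ t) w z :=
          Finset.sum_le_sum fun z _ => mul_le_of_le_one_right (walk_pow_nonneg τ t w z)
            (pow_le_one₀ (walk_pow_nonneg τ R y z) (walk_pow_le_one τ R y z))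
      _ ≤ 1 := sum_walk_pow_le_one τ t w

/-- Two collisions are needed for the walk not to spread out, whence the square. -/
theorem expect_sum_walk_pow_pow_four_le (hC : d.CollisionBound (4 * R) ρ)
    (hout : ∀ v, 2 ≤ d.outDeg v) (hR : ((R : ℝ) + 1) * (1 / 2) ^ R ≤ x)
    (hx : ((4 * R : ℕ) : ℝ) * ρ ≤ x) (hx1 : x ≤ 1) (y : Fin n) :
    𝔼 σ : d.Matching, ∑ z, (d.walk σ ^ R) y z ^ 4 ≤ 18 * x ^ 2 := by
  have hx0 : 0 ≤ x := le_trans (by positivity) hR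
  have hR4 : R ≤ 4 * R := Nat.le_mul_of_pos_left R four_pos
  have hRρ : (R : ℝ) * ρ ≤ x := (mul_le_mul_of_nonneg_right (mod_cast hR4) hC.nonneg).trans hx
  have hx3 : x ^ 3 ≤ x ^ 2 := pow_le_pow_of_le_one hx0 hx1 (by norm_num)
  obtain ⟨σ₀⟩ : Nonempty d.Matching := inferInstance
  have hwalk := degrades_uniquePaths_fewPaths.expect_walk_pow_mulVec_le (hC.of_le hR4) (V := ∅)
    (H := fun σ z => (d.walk σ ^ R) y z ^ 3) (F := 0) (G := 4 * x ^ 3 + 9 * x ^ 2) (X := 5 * x)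
    (by simp) (fun _ _ => rfl) (by positivity) (by positivity) (fun S σ z hS h => ?_)
    (fun S σ w t hS h => expect_walk_pow_mulVec_le_of_fewPaths hC hout hR hx hx1 hS h y w)
    (S := ∅) (t := R) (by simp) (uniquePaths_empty σ₀) y
  · rw [cylinder_empty, Matrix.mulVec_zero, Pi.zero_apply, zero_add] at hwalk
    calc 𝔼 σ : d.Matching, ∑ z, (d.walk σ ^ R) y z ^ 4
        = 𝔼 σ : d.Matching, (d.walk σ ^ R *ᵥ fun z => (d.walk σ ^ R) y z ^ 3) y := by
          simp only [Matrix.mulVec, dotProduct, ← pow_succ']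
      _ ≤ 4 * x ^ 3 + 9 * x ^ 2 + R * (ρ * (5 * x)) := hwalk
      _ = 4 * x ^ 3 + 9 * x ^ 2 + 5 * (R * ρ) * x := by ring
      _ ≤ 4 * x ^ 2 + 9 * x ^ 2 + 5 * x * x := by gcongr
      _ = 18 * x ^ 2 := by ring
  · rw [Pi.zero_apply, zero_add]
    refine (expect_walk_pow_pow_le_of_uniquePaths hC hout hR hx hx1 (j := 3) (by omega) h
      y z).trans_eq ?_
    norm_num

end Spread

end Collisions

section Split

variable {n : ℕ} {d : BiDegree n} {S S' : Finset d.Tail} {σ σ₀ : d.Matching} {e : d.Tail}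
  {A B C : Finset (Fin n)} {x x' : Fin n} {N : ℕ}

/-- A set of vertices that cannot be left along the edges whose tails are in `S`. -/
def AbsorbingOn (d : BiDegree n) (S : Finset d.Tail) (σ : d.Matching) (C : Finset (Fin n)) :
    Prop :=
  ∀ e ∈ S, e.1 ∈ C → (σ e).1 ∈ C

theorem AbsorbingOn.anti (hC : d.AbsorbingOn S' σ C) (h : S ⊆ S') : d.AbsorbingOn S σ C :=
  fun e he => hC e (h he)

theorem absorbingOn_congr (hσ : σ ∈ cylinder S σ₀) :
    d.AbsorbingOn S σ C ↔ d.AbsorbingOn S σ₀ C :=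
  forall₂_congr fun e he => by rw [mem_cylinder.1 hσ e he]

/-- A set of vertices that the walk cannot leave. -/
abbrev Absorbing (d : BiDegree n) (σ : d.Matching) (C : Finset (Fin n)) : Prop :=
  d.AbsorbingOn Finset.univ σ C

/-- All absorbing sets are large, and two disjoint ones contain `x` and `x'`. -/
def Split (d : BiDegree n) (N : ℕ) (x x' : Fin n) (σ : d.Matching) : Prop :=
  (∀ C, d.Absorbing σ C → C.Nonempty → N ≤ C.card) ∧
    ∃ C C', d.Absorbing σ C ∧ d.Absorbing σ C' ∧ Disjoint C C' ∧ x ∈ C ∧ x' ∈ C'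

/-- The edges with tails in `S` lead from `x` to all the vertices of `A`. This is expressed through
the absorbing sets that contain `x`, which is how it enters the analysis of `Split`. -/
def Reaches (d : BiDegree n) (S : Finset d.Tail) (σ : d.Matching) (x : Fin n)
    (A : Finset (Fin n)) : Prop :=
  x ∈ A ∧ ∀ C, d.AbsorbingOn S σ C → x ∈ C → A ⊆ C

theorem reaches_singleton (S : Finset d.Tail) (σ : d.Matching) (x : Fin n) :
    d.Reaches S σ x {x} :=
  ⟨Finset.mem_singleton_self x, fun _ _ => Finset.singleton_subset_iff.2⟩

theorem Reaches.mono (h : d.Reaches S σ x A) (hS : S ⊆ S') : d.Reaches S' σ x A :=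
  ⟨h.1, fun C hC => h.2 C (hC.anti hS)⟩

theorem Reaches.congr (h : d.Reaches S σ₀ x A) (hσ : σ ∈ cylinder S σ₀) : d.Reaches S σ x A :=
  ⟨h.1, fun C hC => h.2 C ((absorbingOn_congr hσ).1 hC)⟩

theorem Reaches.subset_of_absorbing (h : d.Reaches S σ x A) (hC : d.Absorbing σ C)
    (hx : x ∈ C) : A ⊆ C :=
  h.2 C (hC.anti (Finset.subset_univ S)) hx

theorem Reaches.insert (h : d.Reaches S σ x A) (he : e.1 ∈ A) :
    d.Reaches (insert e S) σ x (insert (σ e).1 A) :=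
  ⟨Finset.mem_insert_of_mem h.1, fun C hC hx =>
    have hAC := h.2 C (hC.anti (Finset.subset_insert e S)) hx
    Finset.insert_subset (hC e (Finset.mem_insert_self e S) (hAC he)) hAC⟩

theorem exists_notMem_of_card_lt (hlarge : ∀ C, d.Absorbing σ C → C.Nonempty → N ≤ C.card)
    (hA : d.AbsorbingOn S σ A) (hne : A.Nonempty) (hcard : A.card < N) :
    ∃ e : d.Tail, e.1 ∈ A ∧ e ∉ S := by
  by_contra! hall
  exact hcard.not_ge (hlarge A (fun e _ he => hA e (hall e he) he) hne)

open scoped Classical in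
/-- As long as the set reached from `x'` is small, it has to be left through a new edge, which has
to avoid the heads in `F`, since these belong to vertices reached from `x`. -/
theorem expect_split_le_of_reaches {F : Finset d.Head} (hFA : ∀ f ∈ F, f.1 ∈ A) {j : ℕ}
    (hF : ∀ e ∈ S, σ₀ e ∉ F) (hA : d.Reaches S σ₀ x A) (hB : d.Reaches S σ₀ x' B)
    (hcard : B.card + j ≤ N) (hS : ∀ e ∈ S, e.1 ∈ A ∨ (σ₀ e).1 ∈ B) :
    𝔼 σ ∈ cylinder S σ₀, (if d.Split N x x' σ then 1 else 0 : ℝ) ≤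
      (1 - (F.card : ℝ) / Fintype.card d.Tail) ^ j := by
  have hle1 : (0 : ℝ) ≤ 1 - (F.card : ℝ) / Fintype.card d.Tail :=
    sub_nonneg.2 <| div_le_one_of_le₀ (mod_cast card_head d ▸ Finset.card_le_univ F)
      (Nat.cast_nonneg _)
  induction j generalizing S σ₀ B with
  | zero => exact Finset.expect_le cylinder_nonempty fun σ _ => by split_ifs <;> norm_num
  | succ j ih =>
    by_cases hex : ∃ σ ∈ cylinder S σ₀, d.Split N x x' σ
    swap
    · rw [Finset.expect_eq_zero fun σ hσ => if_neg fun h => hex ⟨σ, hσ, h⟩]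
      positivity
    obtain ⟨τ, hτ, hlarge, C, C', hC, hC', hdisj, hxC, hxC'⟩ := hex
    have hBabs : d.AbsorbingOn S τ B := (absorbingOn_congr hτ).2 fun e he heB =>
      (hS e he).resolve_left fun heA => Finset.disjoint_left.1 hdisj
        ((hA.congr hτ).subset_of_absorbing hC hxC heA)
        ((hB.congr hτ).subset_of_absorbing hC' hxC' heB)
    obtain ⟨e, heB, heS⟩ := exists_notMem_of_card_lt hlarge hBabs ⟨x', hB.1⟩ (by omega)
    rw [pow_succ', ← expect_cylinder_tower S e]
    refine (Finset.expect_le_expect fun τ hτ => ?_).trans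
      (expect_ite_apply_mem_le heS hF (pow_nonneg hle1 j))
    have hAτ := (hA.congr hτ).mono (Finset.subset_insert e S)
    have hBτ := (hB.congr hτ).insert heB
    split_ifs with hf
    · refine (Finset.expect_eq_zero fun σ hσ => if_neg ?_).le
      rintro ⟨-, C, C', hC, hC', hdisj, hxC, hxC'⟩
      exact Finset.disjoint_left.1 hdisj ((hAτ.congr hσ).subset_of_absorbing hC hxC (hFA _ hf))
        ((hBτ.congr hσ).subset_of_absorbing hC' hxC' (Finset.mem_insert_self _ _))
    · refine ih (Finset.forall_mem_insert _ _ _ |>.2 ⟨hf, fun e' he' => ?_⟩) hAτ hBτ ?_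
        (Finset.forall_mem_insert _ _ _ |>.2
          ⟨Or.inr (Finset.mem_insert_self _ _), fun e' he' => ?_⟩)
      · exact mem_cylinder.1 hτ e' he' ▸ hF e' he'
      · have := Finset.card_insert_le (τ e).1 B
        omega
      · exact mem_cylinder.1 hτ e' he' ▸ (hS e' he').imp_right Finset.mem_insert_of_mem

/-- The heads of the vertices of `A` that are not matched to a tail in `S`. -/
def freeHeads (d : BiDegree n) (A : Finset (Fin n)) (S : Finset d.Tail) (σ : d.Matching) :
    Finset d.Head :=
  {f | f.1 ∈ A ∧ ∀ e ∈ S, σ e ≠ f}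

theorem mem_freeHeads {f : d.Head} :
    f ∈ d.freeHeads A S σ ↔ f.1 ∈ A ∧ ∀ e ∈ S, σ e ≠ f := by
  simp only [freeHeads, Finset.mem_filter_univ]

theorem freeHeads_congr (hσ : σ ∈ cylinder S σ₀) : d.freeHeads A S σ = d.freeHeads A S σ₀ := by
  ext f
  rw [mem_freeHeads, mem_freeHeads]
  exact and_congr_right fun _ => forall₂_congr fun e he => by rw [mem_cylinder.1 hσ e he]

theorem erase_freeHeads_subset :
    (d.freeHeads A S σ).erase (σ e) ⊆ d.freeHeads (insert (σ e).1 A) (insert e S) σ := by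
  intro f hf
  obtain ⟨hne, hfA, hfS⟩ := (Finset.mem_erase.trans (and_congr_right' mem_freeHeads)).1 hf
  exact mem_freeHeads.2 ⟨Finset.mem_insert_of_mem hfA,
    Finset.forall_mem_insert _ _ _ |>.2 ⟨hne.symm, hfS⟩⟩

theorem card_freeHeads_le_card_insert (he : (σ e).1 ∉ A) : (d.freeHeads A S σ).card ≤
    (d.freeHeads (insert (σ e).1 A) (insert e S) σ).card := by
  have hnot : σ e ∉ d.freeHeads A S σ := fun h => he (mem_freeHeads.1 h).1
  exact Finset.card_le_card (Finset.erase_eq_of_notMem hnot ▸ erase_freeHeads_subset)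

theorem card_freeHeads_lt_card_insert (hS : ∀ e ∈ S, (σ e).1 ∈ A) (he : (σ e).1 ∉ A)
    (hdeg : 2 ≤ d.inDeg (σ e).1) : (d.freeHeads A S σ).card <
      (d.freeHeads (insert (σ e).1 A) (insert e S) σ).card := by
  have : Nontrivial (Fin (d.inDeg (σ e).1)) := Fin.nontrivial_iff_two_le.2 hdeg
  obtain ⟨i, hi⟩ := exists_ne (σ e).2
  have hnot : σ e ∉ d.freeHeads A S σ := fun h => he (mem_freeHeads.1 h).1
  refine Finset.card_lt_card (Finset.ssubset_iff.2 ⟨⟨(σ e).1, i⟩,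
    fun h => he (mem_freeHeads.1 h).1, Finset.insert_subset ?_
      (Finset.erase_eq_of_notMem hnot ▸ erase_freeHeads_subset)⟩)
  refine mem_freeHeads.2 ⟨Finset.mem_insert_self _ _, Finset.forall_mem_insert _ _ _ |>.2
    ⟨fun h => hi (Sigma.ext_iff.1 h).2.eq.symm, fun e' he' h => he ?_⟩⟩
  simpa only [h] using hS e' he'

/-- Bounds the factor by which `r ^ k` changes when a head of `w` is revealed, where `k` is the
number of free heads of `A`: one of these is lost if `w` is in `A`, and otherwise at least one is
gained unless the revealed head is the only one of `w`. -/
noncomputable def freeHeadFactor (d : BiDegree n) (A : Finset (Fin n)) (r : ℝ) (w : Fin n) : ℝ :=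
  r + ((if w ∈ A then r⁻¹ - r else 0) + (if d.inDeg w = 1 then 1 - r else 0))

theorem pow_card_freeHeads_insert_le {r : ℝ} (hr0 : 0 < r) (hr1 : r ≤ 1)
    (hS : ∀ e ∈ S, (σ e).1 ∈ A) (e : d.Tail) :
    r ^ (d.freeHeads (insert (σ e).1 A) (insert e S) σ).card ≤
      r ^ (d.freeHeads A S σ).card * d.freeHeadFactor A r (σ e).1 := by
  unfold freeHeadFactor
  by_cases heA : (σ e).1 ∈ A
  · have hpow : r ^ ((d.freeHeads (insert (σ e).1 A) (insert e S) σ).card + 1) ≤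
        r ^ (d.freeHeads A S σ).card := pow_le_pow_of_le_one hr0.le hr1 <|
      Nat.le_add_of_sub_le <| Finset.pred_card_le_card_erase.trans <|
        Finset.card_le_card erase_freeHeads_subset
    calc _ ≤ r ^ (d.freeHeads A S σ).card * r⁻¹ := by
          rwa [← div_eq_mul_inv, le_div_iff₀ hr0, ← pow_succ]
      _ ≤ _ := by
          gcongr
          rw [if_pos heA]
          split_ifs <;> linarith
  · rw [if_neg heA, zero_add]
    split_ifs with hdeg
    · rw [add_sub_cancel, mul_one]
      exact pow_le_pow_of_le_one hr0.le hr1 (card_freeHeads_le_card_insert heA)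
    · have hpos := (σ e).2.pos
      rw [add_zero, ← pow_succ]
      exact pow_le_pow_of_le_one hr0.le hr1
        (card_freeHeads_lt_card_insert hS heA (by omega))

theorem expect_freeHeadFactor_le {L : ℕ} {Δ r : ℝ} (he : e ∉ S) (hS : S.card ≤ L)
    (hA : A.card ≤ L + 1) (hL : L < Fintype.card d.Tail) (hΔ : ∀ w, (d.inDeg w : ℝ) ≤ Δ)
    (hΔ0 : 0 ≤ Δ) (hr0 : 0 < r) (hr1 : r ≤ 1) :
    𝔼 σ ∈ cylinder S σ₀, d.freeHeadFactor A r (σ e).1 ≤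
      r + ((L + 1) * Δ * (r⁻¹ - r) + n * (1 - r)) / ((Fintype.card d.Tail : ℝ) - L) := by
  have hr_inv : 0 ≤ r⁻¹ - r := by linarith [(one_le_inv₀ hr0).2 hr1]
  have : 0 ≤ 1 - r := sub_nonneg.2 hr1
  have hLpos : (0 : ℝ) < (Fintype.card d.Tail : ℝ) - L := sub_pos.2 (mod_cast hL)
  set φ : Fin n → ℝ := fun w =>
    (if w ∈ A then r⁻¹ - r else 0) + (if d.inDeg w = 1 then 1 - r else 0) with hφ
  have hφ0 : ∀ w, 0 ≤ φ w := fun w => by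
    simp only [hφ]
    positivity
  have hsum : ∑ f : d.Head, φ f.1 ≤ (L + 1) * Δ * (r⁻¹ - r) + n * (1 - r) := by
    rw [sum_head d φ]
    simp only [hφ, mul_add, Finset.sum_add_distrib, mul_ite, mul_zero]
    refine add_le_add ?_ ?_
    · rw [Finset.sum_ite_mem, Finset.univ_inter, ← Finset.sum_mul]
      gcongr
      calc ∑ w ∈ A, (d.inDeg w : ℝ) ≤ A.card • Δ := Finset.sum_le_card_nsmul A _ Δ fun w _ => hΔ w
        _ = A.card * Δ := nsmul_eq_mul _ _
        _ ≤ (L + 1) * Δ := by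
          gcongr
          exact_mod_cast hA
    · calc _ ≤ ∑ _w : Fin n, (1 - r) := Finset.sum_le_sum fun w _ => by
            split_ifs with h <;> simp [h, hr1]
        _ = n * (1 - r) := by rw [Finset.sum_const, Finset.card_fin, nsmul_eq_mul]
  calc _ = r + 𝔼 σ ∈ cylinder S σ₀, φ (σ e).1 := by
        simp only [freeHeadFactor]
        rw [Finset.expect_add_distrib, expect_cylinder_const]
    _ ≤ r + (∑ f : d.Head, φ f.1) / ((Fintype.card d.Tail : ℝ) - S.card) := by
        gcongr
        exact expect_apply_le he σ₀ (φ := fun f => φ f.1) (fun f => hφ0 f.1) Finset.univ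
          fun f hf => absurd (Finset.mem_univ f) hf
    _ ≤ _ := by
        gcongr

open scoped Classical in
/-- The exploration from `x` collects free heads, each of which the exploration from `x'` then has
to avoid. -/
theorem expect_split_le {L : ℕ} {Δ r γ : ℝ} (hLN : L < N) (hL : L < Fintype.card d.Tail)
    (hΔ : ∀ w, (d.inDeg w : ℝ) ≤ Δ) (hΔ0 : 0 ≤ Δ) (hr0 : 0 < r) (hr1 : r ≤ 1)
    (hr : ∀ k : ℕ, k ≤ Fintype.card d.Tail → (1 - (k : ℝ) / Fintype.card d.Tail) ^ L ≤ r ^ k)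
    (hγ0 : 0 ≤ γ)
    (hγ : r + ((L + 1) * Δ * (r⁻¹ - r) + n * (1 - r)) / ((Fintype.card d.Tail : ℝ) - L) ≤ γ)
    {j : ℕ} (hcard : S.card + j = L) (hA : d.Reaches S σ₀ x A) (hAS : A.card ≤ S.card + 1)
    (hhead : ∀ e ∈ S, (σ₀ e).1 ∈ A) (htail : ∀ e ∈ S, e.1 ∈ A) :
    𝔼 σ ∈ cylinder S σ₀, (if d.Split N x x' σ then 1 else 0 : ℝ) ≤
      γ ^ j * r ^ (d.freeHeads A S σ₀).card := by
  induction j generalizing S σ₀ A with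
  | zero =>
    rw [pow_zero, one_mul]
    exact (expect_split_le_of_reaches (fun f hf => (mem_freeHeads.1 hf).1) (j := L)
      (fun e he hf => (mem_freeHeads.1 hf).2 e he rfl) hA (reaches_singleton S σ₀ x')
      (by rw [Finset.card_singleton]; omega) fun e he => Or.inl (htail e he)).trans
      (hr _ (card_head d ▸ Finset.card_le_univ _))
  | succ j ih =>
    by_cases hex : ∃ σ ∈ cylinder S σ₀, d.Split N x x' σ
    swap
    · rw [Finset.expect_eq_zero fun σ hσ => if_neg fun h => hex ⟨σ, hσ, h⟩]
      positivity
    obtain ⟨τ, hτ, hlarge, -⟩ := hex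
    obtain ⟨e, heA, heS⟩ := exists_notMem_of_card_lt hlarge
      ((absorbingOn_congr hτ).2 fun e he _ => hhead e he) ⟨x, hA.1⟩ (by omega)
    have hstep : ∀ τ ∈ cylinder S σ₀, 𝔼 σ ∈ cylinder (insert e S) τ,
        (if d.Split N x x' σ then 1 else 0 : ℝ) ≤
          γ ^ j * r ^ (d.freeHeads A S σ₀).card * d.freeHeadFactor A r (τ e).1 := by
      intro τ hτ
      have hheadτ : ∀ e' ∈ S, (τ e').1 ∈ A := fun e' he' =>
        mem_cylinder.1 hτ e' he' ▸ hhead e' he'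
      have hcardA := Finset.card_insert_le (τ e).1 A
      have hcardS := Finset.card_insert_of_notMem heS
      refine (ih (by omega) ((hA.congr hτ).insert heA) (by omega)
        (Finset.forall_mem_insert _ _ _ |>.2 ⟨Finset.mem_insert_self _ _, fun e' he' =>
          Finset.mem_insert_of_mem (hheadτ e' he')⟩)
        (Finset.forall_mem_insert _ _ _ |>.2 ⟨Finset.mem_insert_of_mem heA, fun e' he' =>
          Finset.mem_insert_of_mem (htail e' he')⟩)).trans ?_
      rw [mul_assoc, ← freeHeads_congr hτ]
      gcongr
      exact pow_card_freeHeads_insert_le hr0 hr1 hheadτ e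
    rw [← expect_cylinder_tower S e]
    calc _ ≤ 𝔼 τ ∈ cylinder S σ₀,
          γ ^ j * r ^ (d.freeHeads A S σ₀).card * d.freeHeadFactor A r (τ e).1 :=
          Finset.expect_le_expect hstep
      _ ≤ γ ^ j * r ^ (d.freeHeads A S σ₀).card * γ := by
          rw [← Finset.mul_expect]
          gcongr
          exact (expect_freeHeadFactor_le heS (by omega) (by omega) hL hΔ hΔ0 hr0 hr1).trans hγ
      _ = γ ^ (j + 1) * r ^ (d.freeHeads A S σ₀).card := by ring

end Split

end BiDegree

section Stationary

open Matrix (rowStochastic)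

variable {ι : Type*} [Fintype ι] {n : ℕ}

theorem posPart_ne_zero_of_sum_eq_zero {w : ι → ℝ} (hsum : ∑ v, w v = 0) (hne : w ≠ 0) :
    w⁺ ≠ 0 := by
  intro h
  have hle : ∀ v ∈ Finset.univ, w v ≤ 0 := fun v _ => posPart_eq_zero.1 h v
  exact hne (funext fun v => (Finset.sum_eq_zero_iff_of_nonpos hle).1 hsum v (Finset.mem_univ v))

theorem posPart_vecMul_eq [DecidableEq ι] {P : Matrix ι ι ℝ} (hP : P ∈ rowStochastic ℝ ι)
    {w : ι → ℝ} (hw : w ᵥ* P = w) : w⁺ ᵥ* P = w⁺ := by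
  have hle : w⁺ ≤ w⁺ ᵥ* P := by
    refine sup_le (fun v => ?_) (Matrix.nonneg_vecMul_of_mem_rowStochastic hP (posPart_nonneg w))
    calc w v = (w ᵥ* P) v := by rw [hw]
      _ ≤ (w⁺ ᵥ* P) v :=
        Finset.sum_le_sum fun u _ => mul_le_mul_of_nonneg_right (le_posPart w u) (hP.1 u v)
  have hsum : ∑ v, (w⁺ ᵥ* P) v = ∑ v, w⁺ v := by
    rw [← dotProduct_one, ← dotProduct_one, ← Matrix.dotProduct_mulVec, hP.2]
  exact funext fun v =>
    ((Finset.sum_eq_sum_iff_of_le fun v _ => hle v).1 hsum.symm v (Finset.mem_univ v)).symm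

variable {P : Matrix (Fin n) (Fin n) ℝ} {w π π' : Fin n → ℝ}

theorem isStationary_normalize (hw0 : 0 ≤ w) (hne : w ≠ 0) (hw : w ᵥ* P = w) :
    IsStationary P ((∑ u, w u)⁻¹ • w) := by
  have hsum : 0 < ∑ u, w u := Fintype.sum_pos (hw0.lt_of_ne hne.symm)
  refine ⟨⟨smul_nonneg (inv_nonneg.2 hsum.le) hw0, ?_⟩, by rw [Matrix.smul_vecMul, hw]⟩
  simp only [Pi.smul_apply, smul_eq_mul, ← Finset.mul_sum, inv_mul_cancel₀ hsum.ne']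

theorem exists_isStationary [NeZero n] (hP : P ∈ rowStochastic ℝ (Fin n)) :
    ∃ π, IsStationary P π := by
  have hdet : (P - 1).det = 0 := Matrix.exists_mulVec_eq_zero_iff.1
    ⟨1, one_ne_zero, by rw [Matrix.sub_mulVec, hP.2, Matrix.one_mulVec, sub_self]⟩
  obtain ⟨w, hne, hw⟩ := Matrix.exists_vecMul_eq_zero_iff.2 hdet
  rw [Matrix.vecMul_sub, Matrix.vecMul_one, sub_eq_zero] at hw
  by_cases hpos : w⁺ = 0
  · have hneg : (-w)⁺ = -w := posPart_eq_self.2 (neg_nonneg.2 (posPart_eq_zero.1 hpos))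
    exact ⟨_, isStationary_normalize (posPart_nonneg (-w)) (by rwa [hneg, neg_ne_zero])
      (posPart_vecMul_eq hP (by rw [Matrix.neg_vecMul, hw]))⟩
  · exact ⟨_, isStationary_normalize (posPart_nonneg w) hpos (posPart_vecMul_eq hP hw)⟩

theorem exists_disjoint_isStationary (hP : P ∈ rowStochastic ℝ (Fin n)) (hπ : IsStationary P π)
    (hπ' : IsStationary P π') (hne : π' ≠ π) :
    ∃ μ ν, IsStationary P μ ∧ IsStationary P ν ∧ ∀ v, μ v = 0 ∨ ν v = 0 := by
  set w : Fin n → ℝ := π' - π with hw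
  have hw0 : w ≠ 0 := sub_ne_zero.2 hne
  have hwP : w ᵥ* P = w := by rw [hw, Matrix.sub_vecMul, hπ.2, hπ'.2]
  have hsum : ∑ v, w v = 0 := by
    simp only [hw, Pi.sub_apply, Finset.sum_sub_distrib, hπ.1.2, hπ'.1.2, sub_self]
  refine ⟨_, _,
    isStationary_normalize (posPart_nonneg w) (posPart_ne_zero_of_sum_eq_zero hsum hw0)
      (posPart_vecMul_eq hP hwP),
    isStationary_normalize (posPart_nonneg (-w))
      (posPart_ne_zero_of_sum_eq_zero (by simp [hsum]) (neg_ne_zero.2 hw0))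
      (posPart_vecMul_eq hP (by rw [Matrix.neg_vecMul, hwP])), fun v => ?_⟩
  rcases le_total (w v) 0 with hv | hv
  · exact .inl (mul_eq_zero_of_right _ (posPart_eq_zero.2 hv))
  · exact .inr (mul_eq_zero_of_right _ (posPart_eq_zero.2 (neg_nonpos.2 hv)))

theorem IsStationary.pos_of_pos (hP : ∀ u v, 0 ≤ P u v) (hπ : IsStationary P π) {u v : Fin n}
    (hu : 0 < π u) (huv : 0 < P u v) : 0 < π v := by
  rw [← hπ.2]
  exact Finset.sum_pos' (fun z _ => mul_nonneg (hπ.1.1 z) (hP z v))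
    ⟨u, Finset.mem_univ u, mul_pos hu huv⟩

theorem IsStationary.exists_pos (hπ : IsStationary P π) : ∃ v, 0 < π v := by
  obtain ⟨v, -, hv⟩ := Finset.exists_lt_of_sum_lt (s := Finset.univ) (f := 0) (g := π)
    (by simp only [Pi.zero_apply, Finset.sum_const_zero, hπ.1.2, zero_lt_one])
  exact ⟨v, hv⟩

end Stationary

namespace BiDegree

section Uniqueness

open Matrix (rowStochastic)

variable {n : ℕ} {d : BiDegree n} {σ : d.Matching} {α : ℝ} {lam π : Fin n → ℝ} {N : ℕ}

theorem walk_mem_rowStochastic (hout : ∀ v, 0 < d.outDeg v) (σ : d.Matching) :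
    d.walk σ ∈ rowStochastic ℝ (Fin n) := by
  refine ⟨fun u v => by unfold walk; positivity, funext fun u => ?_⟩
  have : NeZero (d.outDeg u) := ⟨(hout u).ne'⟩
  rw [walk_mulVec]
  exact Finset.expect_const Finset.univ_nonempty 1

theorem surfer_mem_rowStochastic (hout : ∀ v, 0 < d.outDeg v) (h0 : 0 ≤ α) (h1 : α ≤ 1)
    (hlam : lam ∈ stdSimplex ℝ (Fin n)) (σ : d.Matching) :
    d.surfer σ α lam ∈ rowStochastic ℝ (Fin n) :=
  Matrix.convex_rowStochastic (walk_mem_rowStochastic hout σ)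
    (Matrix.mem_rowStochastic_iff_sum.2 ⟨fun _ => hlam.1, fun _ => hlam.2⟩ :
      (Matrix.of fun _ => lam) ∈ rowStochastic ℝ (Fin n))
    (sub_nonneg.2 h1) h0 (sub_add_cancel 1 α)

theorem walk_pos (σ : d.Matching) (e : d.Tail) : 0 < d.walk σ e.1 (σ e).1 := by
  have hmult : 0 < d.mult σ e.1 (σ e).1 := Nat.card_pos_iff.2 ⟨⟨⟨e.2, rfl⟩⟩, inferInstance⟩
  have hout : 0 < d.outDeg e.1 := e.2.pos
  unfold walk
  positivity

open scoped Classical in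
theorem absorbing_support (hπ : IsStationary (d.walk σ) π) :
    d.Absorbing σ {v | 0 < π v} := by
  intro e _ he
  rw [Finset.mem_filter_univ] at he ⊢
  exact hπ.pos_of_pos (fun u v => by unfold walk; positivity) he (walk_pos σ e)

theorem isTheStationary_surfer_of_pos (hout : ∀ v, 0 < d.outDeg v) (h0 : 0 < α) (h1 : α ≤ 1)
    (hlam : lam ∈ stdSimplex ℝ (Fin n)) (hpos : ∀ v, 0 < lam v)
    (hπ : IsStationary (d.surfer σ α lam) π) : IsTheStationary (d.surfer σ α lam) π := by
  have hP := surfer_mem_rowStochastic hout h0.le h1 hlam σ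
  refine ⟨hπ, fun π' hπ' => ?_⟩
  by_contra hne
  obtain ⟨μ, ν, hμ, hν, hdisj⟩ := exists_disjoint_isStationary hP hπ hπ' hne
  obtain ⟨u, hu⟩ := hμ.exists_pos
  obtain ⟨v, hv⟩ := hν.exists_pos
  have huv : 0 < d.surfer σ α lam u v := add_pos_of_nonneg_of_pos
    (mul_nonneg (sub_nonneg.2 h1) ((walk_mem_rowStochastic hout σ).1 u v)) (mul_pos h0 (hpos v))
  exact (hdisj v).elim (hμ.pos_of_pos hP.1 hu huv).ne' hv.ne'

theorem isTheStationary_walk (hout : ∀ v, 0 < d.outDeg v)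
    (hlarge : ∀ C, d.Absorbing σ C → C.Nonempty → N ≤ C.card)
    (hsplit : ∀ x x', ¬ d.Split N x x' σ) (hπ : IsStationary (d.walk σ) π) :
    IsTheStationary (d.walk σ) π := by
  classical
  refine ⟨hπ, fun π' hπ' => ?_⟩
  by_contra hne
  obtain ⟨μ, ν, hμ, hν, hdisj⟩ :=
    exists_disjoint_isStationary (walk_mem_rowStochastic hout σ) hπ hπ' hne
  obtain ⟨x, hx⟩ := hμ.exists_pos
  obtain ⟨x', hx'⟩ := hν.exists_pos
  refine hsplit x x' ⟨hlarge, _, _, absorbing_support hμ, absorbing_support hν, ?_,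
    (Finset.mem_filter_univ x).2 hx, (Finset.mem_filter_univ x').2 hx'⟩
  refine Finset.disjoint_filter.2 fun v _ hμv hνv => ?_
  exact (hdisj v).elim hμv.ne' hνv.ne'

end Uniqueness

end BiDegree

section Tail

variable {n : ℕ} {x y : Fin n → ℝ} {s t : ℝ}

open scoped Classical in
theorem tail_eq_card_div (x : Fin n → ℝ) (t : ℝ) :
    tail x t = (Finset.univ.filter fun v => t < x v).card / n := by
  rw [tail, Nat.card_eq_fintype_card, Fintype.card_subtype]

theorem tail_le_one (x : Fin n → ℝ) (t : ℝ) : tail x t ≤ 1 := by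
  classical
  rw [tail_eq_card_div]
  exact div_le_one_of_le₀ (mod_cast card_finset_fin_le _) (Nat.cast_nonneg n)

theorem tail_le_tail (h : ∀ v, s < x v → t < y v) : tail x s ≤ tail y t := by
  classical
  rw [tail_eq_card_div, tail_eq_card_div]
  gcongr ?_ / _
  exact_mod_cast Finset.card_le_card (Finset.monotone_filter_right _ fun v _ => h v)

theorem tail_eq_zero_iff [NeZero n] : tail x t = 0 ↔ ∀ v, x v ≤ t := by
  classical
  have hn : (n : ℝ) ≠ 0 := mod_cast NeZero.ne n
  simp only [tail_eq_card_div, div_eq_zero_iff, hn, or_false, Nat.cast_eq_zero,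
    Finset.card_eq_zero, Finset.filter_eq_empty_iff, Finset.mem_univ, true_imp_iff, not_lt]

end Tail

open scoped Classical in
theorem card_filter_lt_mul_rpow_le {ι : Type*} [Fintype ι] {f : ι → ℝ} {D M κ : ℝ} (hf : 0 ≤ f)
    (hD : 0 ≤ D) (hκ : 1 ≤ κ) (hsum : ∑ v, f v ≤ M) :
    ((Finset.univ.filter fun v => D < f v).card : ℝ) * D ^ κ ≤ M ^ κ := by
  set s := Finset.univ.filter fun v => D < f v
  have hmarkov : (s.card : ℝ) * D ≤ M := by
    rw [← nsmul_eq_mul]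
    exact (Finset.card_nsmul_le_sum s f D fun v hv => (Finset.mem_filter.1 hv).2.le).trans
      ((Finset.sum_le_univ_sum_of_nonneg hf).trans hsum)
  have hcard : (s.card : ℝ) ≤ (s.card : ℝ) ^ κ := by
    rcases s.card.eq_zero_or_pos with h | h
    · rw [h, Nat.cast_zero, Real.zero_rpow (by linarith)]
    · exact Real.self_le_rpow_of_one_le (mod_cast h) hκ
  calc (s.card : ℝ) * D ^ κ ≤ (s.card : ℝ) ^ κ * D ^ κ := by gcongr
    _ = (s.card * D) ^ κ := (Real.mul_rpow (Nat.cast_nonneg _) hD).symm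
    _ ≤ M ^ κ := by gcongr

namespace BiDegree

section Influence

variable {n : ℕ} {d : BiDegree n} {T : ℕ} {σ : d.Matching} {v : Fin n} {D κ Δ : ℝ}

/-- The largest contribution `d⁻_w P ^ t (w, v)` of a single vertex `w` and a single time `t ≤ T`
to the score of `v`, but at least `1`. -/
noncomputable def influence (d : BiDegree n) (T : ℕ) (σ : d.Matching) (v : Fin n) : ℝ :=
  max 1 (⨆ p : Fin (T + 1) × Fin n, (d.inDeg p.2 : ℝ) * (d.walk σ ^ (p.1 : ℕ)) p.2 v)

theorem one_le_influence (T : ℕ) (σ : d.Matching) (v : Fin n) : 1 ≤ d.influence T σ v :=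
  le_max_left _ _

theorem influence_pos (T : ℕ) (σ : d.Matching) (v : Fin n) : 0 < d.influence T σ v :=
  zero_lt_one.trans_le (one_le_influence T σ v)

theorem inDeg_mul_walk_pow_le_influence {t : ℕ} (ht : t ≤ T) (σ : d.Matching) (w v : Fin n) :
    (d.inDeg w : ℝ) * (d.walk σ ^ t) w v ≤ d.influence T σ v :=
  (le_ciSup (f := fun p : Fin (T + 1) × Fin n =>
    (d.inDeg p.2 : ℝ) * (d.walk σ ^ (p.1 : ℕ)) p.2 v) (Set.finite_range _).bddAbove
    (⟨t, Nat.lt_succ_of_le ht⟩, w)).trans (le_max_right _ _)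

theorem exists_lt_of_lt_influence (hD : 1 ≤ D) (h : D < d.influence T σ v) :
    ∃ p : Fin (T + 1) × Fin n, D < (d.inDeg p.2 : ℝ) * (d.walk σ ^ (p.1 : ℕ)) p.2 v := by
  have : Nonempty (Fin (T + 1) × Fin n) := ⟨(0, v)⟩
  exact exists_lt_of_lt_ciSup ((lt_max_iff.1 h).resolve_left hD.not_gt)

theorem influence_le (hΔ1 : 1 ≤ Δ) (hΔ : ∀ w, (d.inDeg w : ℝ) ≤ Δ) (T : ℕ) (σ : d.Matching)
    (v : Fin n) : d.influence T σ v ≤ Δ := by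
  have : Nonempty (Fin (T + 1) × Fin n) := ⟨(0, v)⟩
  refine max_le hΔ1 (ciSup_le fun p => ?_)
  exact (mul_le_of_le_one_right (Nat.cast_nonneg _) (walk_pow_le_one σ _ _ _)).trans (hΔ _)

open scoped Classical in
theorem card_lt_influence_mul_rpow_le (hD : 1 ≤ D) (hκ : 1 ≤ κ) (T : ℕ) (σ : d.Matching) :
    ((Finset.univ.filter fun v => D < d.influence T σ v).card : ℝ) * D ^ κ ≤
      (T + 1) * ∑ w, (d.inDeg w : ℝ) ^ κ := by
  have hD0 : 0 ≤ D := zero_le_one.trans hD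
  set f : Fin (T + 1) × Fin n → Fin n → ℝ :=
    fun p v => (d.inDeg p.2 : ℝ) * (d.walk σ ^ (p.1 : ℕ)) p.2 v with hf
  set s : Fin (T + 1) × Fin n → Finset (Fin n) := fun p => Finset.univ.filter fun v => D < f p v
  have hsub : (Finset.univ.filter fun v => D < d.influence T σ v) ⊆ Finset.univ.biUnion s := by
    intro v hv
    simp only [s, Finset.mem_biUnion, Finset.mem_filter_univ, Finset.mem_univ, true_and] at hv ⊢
    exact exists_lt_of_lt_influence hD hv
  have hmass : ∀ p, ∑ v, f p v ≤ d.inDeg p.2 := fun p => by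
    rw [hf, ← Finset.mul_sum]
    exact mul_le_of_le_one_right (Nat.cast_nonneg _) (sum_walk_pow_le_one σ _ _)
  calc ((Finset.univ.filter fun v => D < d.influence T σ v).card : ℝ) * D ^ κ
      ≤ (∑ p, ((s p).card : ℝ)) * D ^ κ := by
        gcongr
        exact_mod_cast (Finset.card_le_card hsub).trans Finset.card_biUnion_le
    _ ≤ ∑ p : Fin (T + 1) × Fin n, (d.inDeg p.2 : ℝ) ^ κ := by
        rw [Finset.sum_mul]
        exact Finset.sum_le_sum fun p _ => card_filter_lt_mul_rpow_le
          (fun v => mul_nonneg (Nat.cast_nonneg _) (walk_pow_nonneg σ _ _ v)) hD0 hκ (hmass p)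
    _ = (T + 1) * ∑ w, (d.inDeg w : ℝ) ^ κ := by
        simp only [Fintype.sum_prod_type, Finset.sum_const, Finset.card_univ, Fintype.card_fin,
          nsmul_eq_mul, Nat.cast_succ]

theorem tail_influence_mul_rpow_le (hD : 1 ≤ D) (hκ : 1 ≤ κ) (T : ℕ) (σ : d.Matching) :
    tail (d.influence T σ) D * D ^ κ ≤ (T + 1) * (∑ w, (d.inDeg w : ℝ) ^ κ) / n := by
  classical
  rw [tail_eq_card_div, div_mul_eq_mul_div]
  exact div_le_div_of_nonneg_right (card_lt_influence_mul_rpow_le hD hκ T σ) n.cast_nonneg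

end Influence

section PageRankBounds

variable {n : ℕ} {d : BiDegree n} {σ : d.Matching} {α B l : ℝ} {lam π : Fin n → ℝ} {T K : ℕ}
  {v : Fin n}

theorem Absorbing.walk_pow_eq_zero {C : Finset (Fin n)} (hC : d.Absorbing σ C) (t : ℕ)
    {x : Fin n} (hx : x ∈ C) (hv : v ∉ C) : (d.walk σ ^ t) x v = 0 := by
  induction t generalizing x with
  | zero => exact Matrix.one_apply_ne (ne_of_mem_of_not_mem hx hv)
  | succ t ih =>
    have hmul : (d.walk σ ^ (t + 1)) x v = (d.walk σ *ᵥ fun k => (d.walk σ ^ t) k v) x := by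
      rw [pow_succ']
      rfl
    rw [hmul, walk_mulVec]
    exact Finset.expect_eq_zero fun i _ => ih (hC ⟨x, i⟩ (Finset.mem_univ _) hx)

theorem Absorbing.one_le_card_mul {C : Finset (Fin n)} (hC : d.Absorbing σ C)
    (hout : ∀ v, 0 < d.outDeg v) {t : ℕ} {x : Fin n} (hx : x ∈ C)
    (hB : ∀ v, (d.walk σ ^ t) x v ≤ B) : 1 ≤ C.card * B := by
  calc 1 = ∑ v, (d.walk σ ^ t) x v := (Matrix.sum_row_of_mem_rowStochastic
        (pow_mem (walk_mem_rowStochastic hout σ) t) x).symm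
    _ = ∑ v ∈ C, (d.walk σ ^ t) x v := (Finset.sum_subset (Finset.subset_univ C)
        fun v _ hv => hC.walk_pow_eq_zero t hx hv).symm
    _ ≤ C.card * B := by
        rw [← nsmul_eq_mul]
        exact Finset.sum_le_card_nsmul _ _ _ fun v _ => hB v

theorem eq_of_isStationary_surfer (hπ : IsStationary (d.surfer σ α lam) π) :
    π = (1 - α) • (π ᵥ* d.walk σ) + α • lam := by
  have hsurfer : d.surfer σ α lam = (1 - α) • d.walk σ + α • Matrix.vecMulVec 1 lam := by
    ext x y
    simp [surfer]
  conv_lhs => rw [← hπ.2, hsurfer]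
  rw [Matrix.vecMul_add, Matrix.vecMul_smul, Matrix.vecMul_smul, Matrix.vecMul_vecMulVec,
    dotProduct_one, hπ.1.2, one_smul]

theorem isStationary_surfer_le (h0 : 0 ≤ α) (h1 : α ≤ 1)
    (hπ : IsStationary (d.surfer σ α lam) π)
    (hshort : ∀ k < T, (lam ᵥ* d.walk σ ^ k) v ≤ B) (hlong : ∀ x, (d.walk σ ^ T) x v ≤ B) :
    π v ≤ B := by
  suffices ∀ k ≤ T, (π ᵥ* d.walk σ ^ k) v ≤ B by
    simpa only [pow_zero, Matrix.vecMul_one] using this 0 T.zero_le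
  refine fun k hk => Nat.decreasingInduction
    (motive := fun k _ => (π ᵥ* d.walk σ ^ k) v ≤ B) (fun k hk ih => ?_) ?_ hk
  · conv_lhs => rw [eq_of_isStationary_surfer hπ, Matrix.add_vecMul, Matrix.smul_vecMul,
      Matrix.smul_vecMul, Matrix.vecMul_vecMul, ← pow_succ']
    exact convex_Iic B ih (hshort k hk) (sub_nonneg.2 h1) h0 (sub_add_cancel 1 α)
  · calc (π ᵥ* d.walk σ ^ T) v = ∑ x, π x * (d.walk σ ^ T) x v := rfl
      _ ≤ ∑ x, π x * B :=
          Finset.sum_le_sum fun x _ => mul_le_mul_of_nonneg_left (hlong x) (hπ.1.1 x)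
      _ = B := by rw [← Finset.sum_mul, hπ.1.2, one_mul]

theorem sum_mult (σ : d.Matching) (v : Fin n) : ∑ y, d.mult σ y v = d.inDeg v := by
  have hcount : ∑ y, (d.mult σ y v : ℝ) = ∑ e : d.Tail, if (σ e).1 = v then 1 else 0 := by
    simp only [← edgeCount_univ, edgeCount_apply, Finset.mem_univ, true_and, Nat.cast_sum,
      Nat.cast_ite, Nat.cast_one, Nat.cast_zero, Fintype.sum_sigma]
  have hbij := σ.sum_comp fun f => if f.1 = v then (1 : ℝ) else 0
  have hhead := d.sum_head fun w => if w = v then (1 : ℝ) else 0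
  simp only [mul_ite, mul_one, mul_zero, Fintype.sum_ite_eq'] at hhead
  exact_mod_cast hcount.trans (hbij.trans hhead)

theorem inDeg_div_le_sum_walk (hout : ∀ v, 0 < d.outDeg v) (hK : ∀ v, d.outDeg v ≤ K)
    (σ : d.Matching) (v : Fin n) : (d.inDeg v : ℝ) / K ≤ ∑ y, d.walk σ y v := by
  rw [← sum_mult σ v, Nat.cast_sum, Finset.sum_div]
  refine Finset.sum_le_sum fun y _ => ?_
  exact div_le_div_of_nonneg_left (Nat.cast_nonneg _) (mod_cast hout y) (mod_cast hK y)

theorem le_isStationary_surfer (hout : ∀ v, 0 < d.outDeg v) (hK : ∀ v, d.outDeg v ≤ K)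
    (h0 : 0 ≤ α) (h1 : α ≤ 1) (hπ : IsStationary (d.surfer σ α lam) π) (hl0 : 0 ≤ l)
    (hl : ∀ v, l ≤ lam v) (v : Fin n) :
    (1 - α) * (α * l * (d.inDeg v / K)) ≤ π v := by
  have hα : 0 ≤ 1 - α := sub_nonneg.2 h1
  have hfix : ∀ x, π x = (1 - α) * (π ᵥ* d.walk σ) x + α * lam x :=
    congrFun (eq_of_isStationary_surfer hπ)
  have hstep : ∀ x, 0 ≤ (π ᵥ* d.walk σ) x :=
    Matrix.nonneg_vecMul_of_mem_rowStochastic (walk_mem_rowStochastic hout σ) hπ.1.1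
  have hπl : ∀ x, α * l ≤ π x := fun x => by
    rw [hfix x]
    exact le_add_of_nonneg_of_le (mul_nonneg hα (hstep x)) (mul_le_mul_of_nonneg_left (hl x) h0)
  calc (1 - α) * (α * l * (d.inDeg v / K)) ≤ (1 - α) * (α * l * ∑ y, d.walk σ y v) := by
        gcongr
        exact inDeg_div_le_sum_walk hout hK σ v
    _ ≤ (1 - α) * (π ᵥ* d.walk σ) v := by
        rw [Finset.mul_sum]
        refine mul_le_mul_of_nonneg_left (Finset.sum_le_sum fun y _ => ?_) hα
        exact mul_le_mul_of_nonneg_right (hπl y) ((walk_mem_rowStochastic hout σ).1 y v)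
    _ ≤ π v := by
        rw [hfix v]
        exact le_add_of_nonneg_right (mul_nonneg h0 (hl0.trans (hl v)))

end PageRankBounds

section UpperBounds

variable {n : ℕ} {d : BiDegree n} {σ : d.Matching} {κ ε ε' : ℝ} {T : ℕ} {x : Fin n → ℝ}

theorem tail_eq_zero_of_le_influence [NeZero n] (hκ : 0 ≤ κ) (hε' : 0 ≤ ε') (hε : 2 * ε' ≤ ε)
    (hΔ : ∀ w, (d.inDeg w : ℝ) ≤ (n : ℝ) ^ (1 / κ + ε'))
    (hx : ∀ v, x v ≤ (n : ℝ) ^ ε' * d.influence T σ v) :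
    tail x ((n : ℝ) ^ (1 / κ + ε)) = 0 := by
  have hn1 : (1 : ℝ) ≤ n := mod_cast NeZero.one_le
  refine tail_eq_zero_iff.2 fun v => ?_
  calc x v ≤ (n : ℝ) ^ ε' * d.influence T σ v := hx v
    _ ≤ (n : ℝ) ^ ε' * (n : ℝ) ^ (1 / κ + ε') := by
        gcongr
        exact influence_le (Real.one_le_rpow hn1 (by positivity)) hΔ T σ v
    _ = (n : ℝ) ^ (ε' + (1 / κ + ε')) := (Real.rpow_add (by positivity) _ _).symm
    _ ≤ (n : ℝ) ^ (1 / κ + ε) := Real.rpow_le_rpow_of_exponent_le hn1 (by linarith)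

theorem tail_le_of_le_influence [NeZero n] (hκ : 1 ≤ κ) (hε' : 0 ≤ ε') (hε : ε' * (κ + 2) ≤ ε)
    (hT : (T : ℝ) + 1 ≤ (n : ℝ) ^ ε') (hmom : ∑ w, (d.inDeg w : ℝ) ^ κ ≤ (n : ℝ) ^ (1 + ε'))
    (hx : ∀ v, x v ≤ (n : ℝ) ^ ε' * d.influence T σ v) (a : ℝ) :
    tail x ((n : ℝ) ^ a) ≤ (n : ℝ) ^ (-a * κ + ε) := by
  have hn1 : (1 : ℝ) ≤ n := mod_cast NeZero.one_le
  have hn0 : (0 : ℝ) < n := zero_lt_one.trans_le hn1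
  rcases le_or_gt (a * κ) ε with haε | haε
  · exact (tail_le_one _ _).trans (Real.one_le_rpow hn1 (by linarith))
  have ha : ε' ≤ a := by
    by_contra! h
    nlinarith
  set D : ℝ := (n : ℝ) ^ (a - ε') with hD
  have hD1 : 1 ≤ D := Real.one_le_rpow hn1 (sub_nonneg.2 ha)
  have htail : tail x ((n : ℝ) ^ a) ≤ tail (d.influence T σ) D := tail_le_tail fun v hv => by
    rw [hD, Real.rpow_sub hn0, div_lt_iff₀' (by positivity)]
    exact hv.trans_le (hx v)
  calc tail x ((n : ℝ) ^ a)
      ≤ (T + 1) * (∑ w, (d.inDeg w : ℝ) ^ κ) / n / D ^ κ :=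
        htail.trans ((le_div_iff₀ (by positivity)).2 (tail_influence_mul_rpow_le hD1 hκ T σ))
    _ ≤ (n : ℝ) ^ ε' * (n : ℝ) ^ (1 + ε') / n / D ^ κ := by gcongr
    _ = (n : ℝ) ^ (ε' + (1 + ε') - 1 - (a - ε') * κ) := by
        rw [hD, ← Real.rpow_mul hn0.le, Real.rpow_sub hn0, Real.rpow_sub_one hn0.ne',
          Real.rpow_add hn0 ε' (1 + ε')]
    _ ≤ (n : ℝ) ^ (-a * κ + ε) := Real.rpow_le_rpow_of_exponent_le hn1 (by linarith)

theorem upperBounds_of_le_influence [NeZero n] (hκ : 1 ≤ κ) (hε' : 0 ≤ ε')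
    (hε : ε' * (κ + 2) ≤ ε) (hT : (T : ℝ) + 1 ≤ (n : ℝ) ^ ε')
    (hΔ : ∀ w, (d.inDeg w : ℝ) ≤ (n : ℝ) ^ (1 / κ + ε'))
    (hmom : ∑ w, (d.inDeg w : ℝ) ^ κ ≤ (n : ℝ) ^ (1 + ε'))
    (hx : ∀ v, x v ≤ (n : ℝ) ^ ε' * d.influence T σ v) : UpperBounds κ ε x :=
  ⟨tail_eq_zero_of_le_influence (by linarith) hε' (by nlinarith) hΔ hx,
    fun a _ _ => tail_le_of_le_influence hκ hε' hε hT hmom hx a⟩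

end UpperBounds

section Probability

variable {n : ℕ} {d : BiDegree n}

theorem law_real_le_expect_div {p : d.Matching → Prop} {g : d.Matching → ℝ} {a : ℝ} (ha : 0 < a)
    (hg : ∀ σ, 0 ≤ g σ) (h : ∀ σ, p σ → a ≤ g σ) : d.law.real {σ | p σ} ≤ (𝔼 σ, g σ) / a := by
  classical
  rw [law_real_eq_expect, Finset.expect_div]
  refine Finset.expect_le_expect fun σ _ => ?_
  split_ifs with hσ
  · exact (one_le_div ha).2 (h σ hσ)
  · exact div_nonneg (hg σ) ha.le

theorem law_real_exists_le {ι : Type*} [Fintype ι] {p : ι → d.Matching → Prop} {b : ℝ}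
    (h : ∀ i, d.law.real {σ | p i σ} ≤ b) :
    d.law.real {σ | ∃ i, p i σ} ≤ Fintype.card ι * b := by
  rw [Set.ofPred_exists, ← nsmul_eq_mul]
  exact (measureReal_iUnion_fintype_le _).trans (Finset.sum_le_card_nsmul _ _ b fun i _ => h i)

section Spread

variable {R L : ℕ} {ρ x η : ℝ}

theorem law_real_not_spread_le (hC : d.CollisionBound (4 * R) ρ) (hout : ∀ v, 2 ≤ d.outDeg v)
    (hR : ((R : ℝ) + 1) * (1 / 2) ^ R ≤ x) (hx : ((4 * R : ℕ) : ℝ) * ρ ≤ x) (hx1 : x ≤ 1)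
    (hη : 0 < η) :
    d.law.real {σ | ∃ y z, η < (d.walk σ ^ R) y z} ≤ n * (18 * x ^ 2 / η ^ 4) := by
  refine (law_real_exists_le (b := 18 * x ^ 2 / η ^ 4) fun y => ?_).trans_eq
    (by rw [Fintype.card_fin])
  have hnonneg : ∀ σ z, 0 ≤ (d.walk σ ^ R) y z ^ 4 := fun σ z =>
    pow_nonneg (walk_pow_nonneg σ R y z) 4
  refine (law_real_le_expect_div (g := fun σ => ∑ z, (d.walk σ ^ R) y z ^ 4) (pow_pos hη 4)
    (fun σ => Finset.sum_nonneg fun z _ => hnonneg σ z) ?_).trans ?_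
  · rintro σ ⟨z, hz⟩
    exact (pow_le_pow_left₀ hη.le hz.le 4).trans
      (Finset.single_le_sum (fun z _ => hnonneg σ z) (Finset.mem_univ z))
  · gcongr
    exact expect_sum_walk_pow_pow_four_le hC hout hR hx hx1 y

variable {S : Finset d.Tail} {σ : d.Matching}

theorem walkOn_eq_zero {z : Fin n} (hz : ∀ e ∈ S, (σ e).1 ≠ z) (u : Fin n) :
    d.walkOn S σ u z = 0 := by
  rw [walkOn, edgeCount_apply, Finset.sum_eq_zero fun i _ => if_neg fun h => hz _ h.1 h.2,
    Nat.cast_zero, zero_div]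

theorem walkOn_pow_apply_eq_zero {t : ℕ} (ht : t ≠ 0) {z : Fin n}
    (hz : ∀ e ∈ S, (σ e).1 ≠ z) (x : Fin n) : (d.walkOn S σ ^ t) x z = 0 := by
  obtain ⟨t, rfl⟩ := Nat.exists_eq_succ_of_ne_zero ht
  rw [pow_succ, Matrix.mul_apply]
  exact Finset.sum_eq_zero fun u _ => by rw [walkOn_eq_zero hz, mul_zero]

theorem sum_walkOn_pow_le_of_spread (hR : R ≠ 0) (hη : 0 ≤ η)
    (hspread : ∀ y z, (d.walk σ ^ R) y z ≤ η) (hS : S.card ≤ L) (x : Fin n) :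
    ∑ z, (d.walkOn S σ ^ R) x z ≤ L * η := by
  set V := S.image fun e => (σ e).1
  have hsupp : ∀ z ∉ V, (d.walkOn S σ ^ R) x z = 0 := fun z hz =>
    walkOn_pow_apply_eq_zero hR (fun e he h => hz (Finset.mem_image.2 ⟨e, he, h⟩)) x
  calc ∑ z, (d.walkOn S σ ^ R) x z = ∑ z ∈ V, (d.walkOn S σ ^ R) x z :=
        (Finset.sum_subset V.subset_univ fun z _ => hsupp z).symm
    _ ≤ V.card • η := Finset.sum_le_card_nsmul _ _ _ fun z _ =>
        (walkOn_pow_le_walk_pow S σ R x z).trans (hspread x z)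
    _ = V.card * η := nsmul_eq_mul _ _
    _ ≤ L * η := by
        gcongr
        exact Finset.card_image_le.trans hS

theorem walkOn_pow_le_of_spread (hR : R ≠ 0) (hη : 0 ≤ η)
    (hspread : ∀ y z, (d.walk σ ^ R) y z ≤ η) (hS : S.card ≤ L) (J : ℕ) (x v : Fin n) :
    (d.walkOn S σ ^ (J * R)) x v ≤ (L * η) ^ J := by
  induction J generalizing x with
  | zero =>
    rw [zero_mul, pow_zero, pow_zero, Matrix.one_apply]
    split_ifs <;> norm_num
  | succ J ih =>
    rw [Nat.succ_mul, add_comm, pow_add, Matrix.mul_apply]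
    calc ∑ z, (d.walkOn S σ ^ R) x z * (d.walkOn S σ ^ (J * R)) z v
        ≤ ∑ z, (d.walkOn S σ ^ R) x z * (L * η) ^ J := Finset.sum_le_sum fun z _ =>
          mul_le_mul_of_nonneg_left (ih z) (walkOn_pow_nonneg S σ R x z)
      _ = (∑ z, (d.walkOn S σ ^ R) x z) * (L * η) ^ J := (Finset.sum_mul ..).symm
      _ ≤ (L * η) * (L * η) ^ J := by
          gcongr
          exact sum_walkOn_pow_le_of_spread hR hη hspread hS x
      _ = (L * η) ^ (J + 1) := (pow_succ' _ _).symm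

end Spread

section InfluenceTail

variable {T L q : ℕ} {ν : Fin n → ℝ} {β s : ℝ} {v : Fin n}

theorem law_real_influence_lt_le {p : d.Matching → Prop} {t : ℕ} (ht : t ≤ T)
    (hL : L < Fintype.card d.Tail) (hν : 0 ≤ ν) (hν1 : ∑ x, ν x ≤ 1) (hβ0 : 0 ≤ β)
    (hβ : ∀ σ (S : Finset d.Tail), p σ → S.card ≤ L → (ν ᵥ* d.walkOn S σ ^ t) v ≤ β)
    (hq : q * T ≤ L) (hs : 0 < s) :
    d.law.real {σ | p σ ∧ s * d.influence T σ v < (ν ᵥ* d.walk σ ^ t) v} ≤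
      ((β + T * d.entranceRate L) / s) ^ q := by
  classical
  have hrate := entranceRate_nonneg hL.le
  have hinv : ∀ σ, 0 ≤ (d.influence T σ v)⁻¹ := fun σ => inv_nonneg.2 (influence_pos T σ v).le
  have hwalk : ∀ σ, 0 ≤ (ν ᵥ* d.walk σ ^ t) v := fun σ =>
    dotProduct_nonneg_of_nonneg hν fun x => walk_pow_nonneg σ t x v
  have hwalkOn : ∀ S σ, 0 ≤ (ν ᵥ* d.walkOn S σ ^ t) v := fun S σ =>
    dotProduct_nonneg_of_nonneg hν fun x => walkOn_pow_nonneg S σ t x v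
  have hind : ∀ σ, (0 : ℝ) ≤ if p σ then 1 else 0 := fun σ => by split_ifs <;> norm_num
  obtain ⟨σ₀⟩ : Nonempty d.Matching := inferInstance
  have hmoment := expect_mul_vecMul_walk_pow_pow_le (d := d) (g := fun σ => if p σ then 1 else 0)
    (k := fun σ => (d.influence T σ v)⁻¹) hind (fun σ => by split_ifs <;> norm_num) hinv hL
    (fun σ w i hi => inv_mul_le_one_of_le₀
      (inDeg_mul_walk_pow_le_influence (hi.trans ht) σ w v) (influence_pos T σ v).le)
    hν hν1 hβ0
    (fun σ S hσ hS => (mul_le_of_le_one_left (hwalkOn S σ)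
      (inv_le_one_of_one_le₀ (one_le_influence T σ v))).trans
        (hβ σ S (by_contra fun h => hσ (if_neg h)) hS))
    (q := q) (S := ∅) (by simpa using (Nat.mul_le_mul_left q ht).trans hq) σ₀
  rw [cylinder_empty] at hmoment
  refine (law_real_le_expect_div (pow_pos hs q) (fun σ => mul_nonneg (hind σ)
    (pow_nonneg (mul_nonneg (hinv σ) (hwalk σ)) q)) ?_).trans ?_
  · rintro σ ⟨hσ, hlt⟩
    rw [if_pos hσ, one_mul]
    gcongr
    rw [← div_eq_inv_mul, le_div_iff₀ (influence_pos T σ v)]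
    exact hlt.le
  · rw [div_pow]
    gcongr
    refine hmoment.trans ?_
    gcongr

theorem law_real_long_le {R J : ℕ} {η : ℝ} (hR : R ≠ 0) (hη : 0 ≤ η)
    (hL : L < Fintype.card d.Tail) (hq : q * (J * R) ≤ L) (hs : 0 < s) :
    d.law.real {σ | ∃ p : Fin n × Fin n, (∀ y z, (d.walk σ ^ R) y z ≤ η) ∧
      s * d.influence (J * R) σ p.2 < (d.walk σ ^ (J * R)) p.1 p.2} ≤
      (n * n : ℝ) * (((L * η) ^ J + (J * R : ℕ) * d.entranceRate L) / s) ^ q := by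
  refine (law_real_exists_le fun p => ?_).trans_eq
    (by rw [Fintype.card_prod, Fintype.card_fin, Nat.cast_mul])
  have h := law_real_influence_lt_le (d := d) (v := p.2) (ν := Pi.single p.1 1)
    (p := fun σ => ∀ y z, (d.walk σ ^ R) y z ≤ η) (le_refl (J * R)) hL
    (Pi.single_nonneg.2 zero_le_one) (Fintype.sum_pi_single' p.1 1).le
    (β := (L * η) ^ J) (by positivity) (fun σ S hσ hS => by
      rw [Matrix.single_one_vecMul]
      exact walkOn_pow_le_of_spread hR hη hσ hS J p.1 p.2) hq hs
  simpa only [Matrix.single_one_vecMul, Matrix.row_apply] using h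

theorem sum_walkOn_pow_le (S : Finset d.Tail) (σ : d.Matching) (t : ℕ) (v : Fin n) :
    ∑ x, (d.walkOn S σ ^ t) x v ≤ S.card + 1 := by
  set V := insert v (S.image Sigma.fst)
  have hsupp : ∀ x ∉ V, (d.walkOn S σ ^ t) x v = 0 := fun x hx => by
    rw [Finset.mem_insert, not_or] at hx
    exact walkOn_pow_eq_zero (fun e he h => hx.2 (Finset.mem_image.2 ⟨e, he, h⟩)) hx.1 σ t
  calc ∑ x, (d.walkOn S σ ^ t) x v = ∑ x ∈ V, (d.walkOn S σ ^ t) x v :=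
        (Finset.sum_subset V.subset_univ fun x _ => hsupp x).symm
    _ ≤ V.card • 1 := Finset.sum_le_card_nsmul _ _ _ fun x _ =>
        (walkOn_pow_le_walk_pow S σ t x v).trans (walk_pow_le_one σ t x v)
    _ = V.card := nsmul_one _
    _ ≤ S.card + 1 := mod_cast (Finset.card_insert_le _ _).trans
        (Nat.add_le_add_right Finset.card_image_le 1)

theorem law_real_short_le {b : ℝ} (hν : 0 ≤ ν) (hν1 : ∑ x, ν x ≤ 1) (hb0 : 0 ≤ b)
    (hb : ∀ x, ν x ≤ b) (hL : L < Fintype.card d.Tail) (hq : q * T ≤ L) (hs : 0 < s) :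
    d.law.real {σ | ∃ p : Fin T × Fin n,
      s * d.influence T σ p.2 < (ν ᵥ* d.walk σ ^ (p.1 : ℕ)) p.2} ≤
        (T * n : ℝ) * ((b * (L + 1) + T * d.entranceRate L) / s) ^ q := by
  refine (law_real_exists_le fun p => ?_).trans_eq
    (by rw [Fintype.card_prod, Fintype.card_fin, Fintype.card_fin, Nat.cast_mul])
  have h := law_real_influence_lt_le (d := d) (v := p.2) (p := fun _ => True) p.1.2.le hL hν hν1
    (β := b * (L + 1)) (by positivity) (fun σ S _ hS => by
      calc (ν ᵥ* d.walkOn S σ ^ (p.1 : ℕ)) p.2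
          = ∑ x, ν x * (d.walkOn S σ ^ (p.1 : ℕ)) x p.2 := rfl
        _ ≤ ∑ x, b * (d.walkOn S σ ^ (p.1 : ℕ)) x p.2 := Finset.sum_le_sum fun x _ =>
            mul_le_mul_of_nonneg_right (hb x) (walkOn_pow_nonneg S σ _ x p.2)
        _ = b * ∑ x, (d.walkOn S σ ^ (p.1 : ℕ)) x p.2 := (Finset.mul_sum ..).symm
        _ ≤ b * (L + 1) := by
            gcongr
            exact (sum_walkOn_pow_le S σ p.1 p.2).trans (by gcongr)) hq hs
  simpa only [true_and] using h

end InfluenceTail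

theorem law_real_split_le {N L : ℕ} {Δ r γ : ℝ} (hLN : L < N) (hL : L < Fintype.card d.Tail)
    (hΔ : ∀ w, (d.inDeg w : ℝ) ≤ Δ) (hΔ0 : 0 ≤ Δ) (hr0 : 0 < r) (hr1 : r ≤ 1)
    (hr : ∀ k : ℕ, k ≤ Fintype.card d.Tail → (1 - (k : ℝ) / Fintype.card d.Tail) ^ L ≤ r ^ k)
    (hγ0 : 0 ≤ γ)
    (hγ : r + ((L + 1) * Δ * (r⁻¹ - r) + n * (1 - r)) / ((Fintype.card d.Tail : ℝ) - L) ≤ γ) :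
    d.law.real {σ | ∃ p : Fin n × Fin n, d.Split N p.1 p.2 σ} ≤ (n * n : ℝ) * γ ^ L := by
  classical
  refine (law_real_exists_le fun p => ?_).trans_eq
    (by rw [Fintype.card_prod, Fintype.card_fin, Nat.cast_mul])
  obtain ⟨σ₀⟩ : Nonempty d.Matching := inferInstance
  have h := expect_split_le (S := ∅) (A := {p.1}) (x' := p.2) hLN hL hΔ hΔ0 hr0 hr1 hr hγ0 hγ
    (zero_add L) (reaches_singleton ∅ σ₀ p.1) (Finset.card_singleton _).le
    (fun e he => absurd he (Finset.notMem_empty e)) (fun e he => absurd he (Finset.notMem_empty e))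
  rw [cylinder_empty] at h
  rw [law_real_eq_expect]
  exact h.trans (mul_le_of_le_one_right (pow_nonneg hγ0 L) (pow_le_one₀ hr0.le hr1))

end Probability

end BiDegree

section Asymptotics

theorem eventually_le_rpow (C : ℝ) {θ : ℝ} (hθ : 0 < θ) : ∀ᶠ n : ℕ in atTop, C ≤ (n : ℝ) ^ θ :=
  ((tendsto_rpow_atTop hθ).comp tendsto_natCast_atTop_atTop).eventually_ge_atTop C

theorem isBigO_natLog_succ :
    (fun n : ℕ => ((Nat.log 2 n + 1 : ℕ) : ℝ)) =O[atTop] fun n : ℕ => Real.log n := by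
  have hlog2 : 0 < Real.log 2 := Real.log_pos one_lt_two
  refine Asymptotics.IsBigO.of_bound (2 / Real.log 2) ?_
  filter_upwards [eventually_ge_atTop 2] with n hn
  have hn2 : (2 : ℝ) ≤ n := mod_cast hn
  have hone : 1 ≤ Real.log n / Real.log 2 :=
    (one_le_div hlog2).2 (Real.log_le_log two_pos hn2)
  have hlog : (Nat.log 2 n : ℝ) ≤ Real.log n / Real.log 2 := by
    simpa only [Real.logb, Nat.cast_ofNat] using Real.natLog_le_logb n 2
  rw [Real.norm_natCast, Real.norm_of_nonneg (Real.log_nonneg (one_le_two.trans hn2))]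
  push_cast
  linarith [div_mul_eq_mul_div 2 (Real.log 2) (Real.log n), mul_div_assoc 2 (Real.log n)
    (Real.log 2)]

theorem eventually_natLog_le (C : ℝ) (k : ℕ) {θ : ℝ} (hθ : 0 < θ) :
    ∀ᶠ n : ℕ in atTop, C * ((Nat.log 2 n + 1 : ℕ) : ℝ) ^ k ≤ (n : ℝ) ^ θ := by
  have hlog : (fun n : ℕ => Real.log n ^ k) =o[atTop] fun n : ℕ => (n : ℝ) ^ θ := by
    simpa only [Real.rpow_natCast] using
      (isLittleO_log_rpow_rpow_atTop (k : ℝ) hθ).natCast_atTop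
  filter_upwards [(((isBigO_natLog_succ.pow k).trans_isLittleO hlog).const_mul_left C).bound
    zero_lt_one] with n hn
  rw [one_mul, Real.norm_of_nonneg (Real.rpow_nonneg n.cast_nonneg θ)] at hn
  exact (le_abs_self _).trans hn

theorem one_half_pow_natLog_succ_le (n : ℕ) [NeZero n] :
    ((1 : ℝ) / 2) ^ (Nat.log 2 n + 1) ≤ (n : ℝ)⁻¹ := by
  have hn : (0 : ℝ) < n := mod_cast NeZero.pos n
  rw [one_div, inv_pow]
  gcongr
  exact_mod_cast (Nat.lt_pow_succ_log_self one_lt_two n).le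

end Asymptotics

section Moments

theorem rpow_le_mul_one_add_sum {b y κ : ℝ} (hb : 1 ≤ b) (hy : 0 ≤ y) (hκ : 0 ≤ κ) {m : ℕ}
    (hym : y ≤ b ^ (m + 2)) :
    y ^ κ ≤ (b ^ 2) ^ κ *
      (1 + ∑ i ∈ Finset.range m, if b ^ (i + 1) < y then (b ^ (i + 1)) ^ κ else 0) := by
  have : 0 ≤ b := zero_le_one.trans hb
  have hterm : ∀ i, 0 ≤ if b ^ (i + 1) < y then (b ^ (i + 1)) ^ κ else 0 := fun i => by
    split_ifs <;> positivity
  induction m with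
  | zero => simpa using Real.rpow_le_rpow hy hym hκ
  | succ m ih =>
    rw [Finset.sum_range_succ]
    rcases le_or_gt y (b ^ (m + 2)) with hle | hlt
    · refine (ih hle).trans ?_
      gcongr
      exact le_add_of_nonneg_right (hterm m)
    · have hlast : b ^ (m + 1) < y := (pow_le_pow_right₀ hb (Nat.le_succ _)).trans_lt hlt
      have hsum := Finset.sum_nonneg fun i (_ : i ∈ Finset.range m) => hterm i
      calc y ^ κ ≤ (b ^ 2 * b ^ (m + 1)) ^ κ := by
            rw [← pow_add]
            exact Real.rpow_le_rpow hy (hym.trans_eq (by ring)) hκ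
        _ = (b ^ 2) ^ κ * (b ^ (m + 1)) ^ κ := Real.mul_rpow (by positivity) (by positivity)
        _ ≤ _ := by
            gcongr
            rw [if_pos hlast]
            linarith

theorem sum_rpow_le_of_tail_mul_rpow_le {n : ℕ} [NeZero n] {x : Fin n → ℝ} {b κ B : ℝ} {m : ℕ}
    (hb : 1 ≤ b) (hx : 0 ≤ x) (hκ : 0 ≤ κ) (hmax : ∀ v, x v ≤ b ^ (m + 2))
    (htail : ∀ i < m, tail x (b ^ (i + 1)) * (b ^ (i + 1)) ^ κ ≤ B) :
    ∑ v, x v ^ κ ≤ n * (b ^ 2) ^ κ * (1 + m * B) := by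
  classical
  have hn : (n : ℝ) ≠ 0 := mod_cast NeZero.ne n
  have hcount : ∀ i, (∑ v, if b ^ (i + 1) < x v then (b ^ (i + 1)) ^ κ else 0) =
      n * (tail x (b ^ (i + 1)) * (b ^ (i + 1)) ^ κ) := fun i => by
    rw [← Finset.sum_filter, Finset.sum_const, nsmul_eq_mul, tail_eq_card_div, ← mul_assoc,
      mul_div_cancel₀ _ hn]
  calc ∑ v, x v ^ κ ≤ ∑ v, (b ^ 2) ^ κ *
        (1 + ∑ i ∈ Finset.range m, if b ^ (i + 1) < x v then (b ^ (i + 1)) ^ κ else 0) :=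
        Finset.sum_le_sum fun v _ => rpow_le_mul_one_add_sum hb (hx v) hκ (hmax v)
    _ = n * (b ^ 2) ^ κ *
          (1 + ∑ i ∈ Finset.range m, tail x (b ^ (i + 1)) * (b ^ (i + 1)) ^ κ) := by
        rw [← Finset.mul_sum, Finset.sum_add_distrib, Finset.sum_comm]
        simp only [hcount, ← Finset.mul_sum, Finset.sum_const, Finset.card_univ, Fintype.card_fin,
          nsmul_eq_mul]
        ring
    _ ≤ n * (b ^ 2) ^ κ * (1 + m * B) := by
        gcongr
        simpa using Finset.sum_le_card_nsmul (Finset.range m) _ B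
          fun i hi => htail i (Finset.mem_range.1 hi)

end Moments

section PowerLaw

variable {κ ε b θ α : ℝ} {x : ∀ n : ℕ, Fin n → ℝ}

theorem HasPowerLaw.eventually_le (h : HasPowerLaw κ x) (hκ : 0 < κ) (hε : 0 < ε) :
    ∀ᶠ n : ℕ in atTop, ∀ v, x n v ≤ (n : ℝ) ^ (1 / κ + ε) := by
  have hκ' : 0 < 1 / κ := one_div_pos.2 hκ
  filter_upwards [h ε hε (1 / κ / 2) (half_pos hκ') (half_lt_self hκ'), eventually_ne_atTop 0]
    with n hn hn0
  have : NeZero n := ⟨hn0⟩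
  exact tail_eq_zero_iff.1 hn.2.2

theorem exists_mesh (hκ : 0 < κ) (hε : 0 < ε) :
    ∃ m : ℕ, ∃ θ > 0, (m + 1) * θ = 1 / κ ∧ θ * (2 * κ + 2) ≤ ε := by
  obtain ⟨m, hm⟩ := exists_nat_one_div_lt (K := ℝ) (ε := ε * κ / (2 * κ + 2)) (by positivity)
  refine ⟨m, 1 / (κ * (m + 1)), by positivity, by field_simp, ?_⟩
  rw [lt_div_iff₀ (by positivity), div_mul_eq_mul_div, div_lt_iff₀ (by positivity)] at hm
  rw [div_mul_eq_mul_div, div_le_iff₀ (by positivity)]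
  linarith

theorem HasPowerLaw.eventually_sum_rpow_le (h : HasPowerLaw κ x) (hx : ∀ n, 0 ≤ x n)
    (hκ : 0 < κ) (hε : 0 < ε) : ∀ᶠ n : ℕ in atTop, ∑ v, x n v ^ κ ≤ (n : ℝ) ^ (1 + ε) := by
  obtain ⟨m, θ, hθ, hθm, hθε⟩ := exists_mesh hκ hε
  have htail : ∀ᶠ n : ℕ in atTop, ∀ i ∈ Finset.range m,
      tail (x n) ((n : ℝ) ^ ((i + 1) * θ)) ≤ (n : ℝ) ^ (-((i + 1) * θ) * κ + θ) := by
    refine (Filter.eventually_all_finset _).2 fun i hi => ?_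
    have hi' : (i : ℝ) < m := mod_cast Finset.mem_range.1 hi
    exact (h θ hθ ((i + 1) * θ) (by positivity) (by nlinarith)).mono fun n hn => hn.2.1
  filter_upwards [htail, h.eventually_le hκ hθ, eventually_ge_atTop 1,
    eventually_le_rpow ((m : ℝ) + 1) hθ] with n htail hmax hn hmn
  have : NeZero n := ⟨by omega⟩
  have hn1 : (1 : ℝ) ≤ n := mod_cast hn
  have hn0 : (0 : ℝ) < n := zero_lt_one.trans_le hn1
  have hpow : ∀ i : ℕ, ((n : ℝ) ^ θ) ^ i = (n : ℝ) ^ (i * θ) := fun i => by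
    rw [mul_comm, Real.rpow_mul_natCast hn0.le]
  calc ∑ v, x n v ^ κ
      ≤ n * (((n : ℝ) ^ θ) ^ 2) ^ κ * (1 + m * (n : ℝ) ^ θ) := by
        refine sum_rpow_le_of_tail_mul_rpow_le (Real.one_le_rpow hn1 hθ.le) (hx n) hκ.le
          (fun v => (hmax v).trans_eq ?_) fun i hi => ?_
        · rw [hpow, ← hθm]
          congr 1
          push_cast
          ring
        · rw [hpow, Nat.cast_succ, ← Real.rpow_mul hn0.le]
          refine (mul_le_mul_of_nonneg_right (htail i (Finset.mem_range.2 hi))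
            (by positivity)).trans_eq ?_
          rw [← Real.rpow_add hn0]
          ring_nf
    _ ≤ n * (((n : ℝ) ^ θ) ^ 2) ^ κ * ((n : ℝ) ^ θ * (n : ℝ) ^ θ) := by
        gcongr
        nlinarith [Real.one_le_rpow hn1 hθ.le]
    _ = (n : ℝ) ^ (1 + θ * (2 * κ + 2)) := by
        rw [hpow, ← Real.rpow_mul hn0.le, ← Real.rpow_add hn0, ← Real.rpow_one_add' hn0.le
          (by positivity), ← Real.rpow_add hn0]
        congr 1
        push_cast
        ring
    _ ≤ (n : ℝ) ^ (1 + ε) := Real.rpow_le_rpow_of_exponent_le hn1 (by linarith)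

theorem HasPowerLaw.eventually_lowerBounds (h : HasPowerLaw κ x) (hκ : 0 < κ) (hε : 0 < ε)
    (hb : b < 1 / κ) : ∀ᶠ n : ℕ in atTop, LowerBounds κ ε b (x n) := by
  rcases le_or_gt b 0 with hb0 | hb0
  · exact Eventually.of_forall fun n a ha hab => absurd (ha.trans_le hab) hb0.not_gt
  set θ : ℝ := min (ε / (κ + 1)) (1 / κ - b)
  have hθ : 0 < θ := lt_min (by positivity) (sub_pos.2 hb)
  have hθε : θ * (κ + 1) ≤ ε := (le_div_iff₀ (by positivity)).1 (min_le_left _ _)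
  have hθb : b + θ ≤ 1 / κ := by linarith [min_le_right (ε / (κ + 1)) (1 / κ - b)]
  have hceil : ∀ {a : ℝ}, 0 < a → ⌈a / θ⌉₊ * θ < a + θ := fun {a} ha => by
    have := mul_lt_mul_of_pos_right (Nat.ceil_lt_add_one (div_pos ha hθ).le) hθ
    rwa [add_mul, div_mul_cancel₀ _ hθ.ne', one_mul] at this
  have hgrid : ∀ᶠ n : ℕ in atTop, ∀ i ∈ Finset.Icc 1 ⌈b / θ⌉₊,
      (n : ℝ) ^ (-(i * θ) * κ - θ) ≤ tail (x n) ((n : ℝ) ^ (i * θ)) := by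
    refine (Filter.eventually_all_finset _).2 fun i hi => ?_
    obtain ⟨hi1, hib⟩ := Finset.mem_Icc.1 hi
    have : (0 : ℝ) < i := mod_cast hi1
    refine (h θ hθ (i * θ) (by positivity) ?_).mono fun n hn => hn.1
    exact (mul_le_mul_of_nonneg_right (mod_cast hib) hθ.le).trans_lt
      ((hceil hb0).trans_le hθb)
  filter_upwards [hgrid, eventually_ge_atTop 1] with n hgrid hn a ha0 hab
  have hn1 : (1 : ℝ) ≤ n := mod_cast hn
  have hai : a ≤ ⌈a / θ⌉₊ * θ := (div_le_iff₀ hθ).1 (Nat.le_ceil _)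
  calc (n : ℝ) ^ (-a * κ - ε) ≤ (n : ℝ) ^ (-(⌈a / θ⌉₊ * θ) * κ - θ) :=
        Real.rpow_le_rpow_of_exponent_le hn1 (by nlinarith [hceil ha0])
    _ ≤ tail (x n) ((n : ℝ) ^ (⌈a / θ⌉₊ * θ)) := hgrid _ (Finset.mem_Icc.2
        ⟨Nat.one_le_ceil_iff.2 (div_pos ha0 hθ), Nat.ceil_mono (by gcongr)⟩)
    _ ≤ tail (x n) ((n : ℝ) ^ a) :=
        tail_le_tail fun v => (Real.rpow_le_rpow_of_exponent_le hn1 hai).trans_lt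

theorem LowerBounds.of_mul_le {n : ℕ} [NeZero n] {x y : Fin n → ℝ} (h : LowerBounds κ ε b x)
    (hθ : 0 ≤ θ) (hxy : ∀ v, (n : ℝ) ^ (-θ) * x v ≤ y v) :
    LowerBounds κ (ε + θ * κ) (b - θ) y := by
  intro a ha hab
  have hn : (0 : ℝ) < n := mod_cast NeZero.pos n
  calc (n : ℝ) ^ (-a * κ - (ε + θ * κ)) = (n : ℝ) ^ (-(a + θ) * κ - ε) := by ring_nf
    _ ≤ tail x ((n : ℝ) ^ (a + θ)) := h (a + θ) (by linarith) (by linarith)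
    _ ≤ tail y ((n : ℝ) ^ a) := tail_le_tail fun v hv => by
        rw [Real.rpow_add hn, ← lt_div_iff₀ (by positivity)] at hv
        refine hv.trans_le ((hxy v).trans_eq' ?_)
        rw [Real.rpow_neg hn.le, inv_mul_eq_div]

theorem eventually_lowerBounds_pageRank {d : ∀ n : ℕ, BiDegree n} {K : ℕ}
    (hout : ∀ n v, 0 < (d n).outDeg v) (hK : ∀ n v, (d n).outDeg v ≤ K) (hκ : 0 < κ)
    (hφ : HasPowerLaw κ fun n v => ((d n).inDeg v : ℝ)) {lam : ∀ n : ℕ, Fin n → ℝ}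
    (hlam : NearUniform lam) (h0 : 0 < α) (h1 : α < 1) (hε : 0 < ε) (hb : b < 1 / κ) :
    ∀ᶠ n : ℕ in atTop, ∀ (σ : (d n).Matching) (π : Fin n → ℝ),
      IsStationary ((d n).surfer σ α (lam n)) π → LowerBounds κ ε b fun v => (n : ℝ) * π v := by
  have hα : 0 < 1 - α := sub_pos.2 h1
  obtain ⟨θ, hθ, hθε, hθb⟩ : ∃ θ > 0, θ * κ ≤ ε / 2 ∧ b + θ < 1 / κ := by
    refine ⟨min (ε / 2 / κ) ((1 / κ - b) / 2), lt_min (by positivity) (by linarith),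
      (le_div_iff₀ hκ).1 (min_le_left _ _), ?_⟩
    linarith [min_le_right (ε / 2 / κ) ((1 / κ - b) / 2)]
  filter_upwards [hφ.eventually_lowerBounds hκ (half_pos hε) hθb, hlam.2 (θ / 2) (half_pos hθ),
    eventually_ge_atTop 1, eventually_le_rpow (K / ((1 - α) * α)) (half_pos hθ)]
    with n hlower hl hn hKn σ π hπ
  have : NeZero n := ⟨by omega⟩
  have hn0 : (0 : ℝ) < n := mod_cast hn
  have hdeg : ∀ v, (n : ℝ) ^ (-θ) * (d n).inDeg v ≤ n * π v := by
    intro v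
    have hK0 : (0 : ℝ) < K := mod_cast (hout n v).trans_le (hK n v)
    calc (n : ℝ) ^ (-θ) * (d n).inDeg v
        = ((n : ℝ) ^ (θ / 2))⁻¹ * (n : ℝ) ^ (-(θ / 2)) * (d n).inDeg v := by
          rw [← Real.rpow_neg hn0.le, ← Real.rpow_add hn0]
          ring_nf
      _ ≤ (K / ((1 - α) * α))⁻¹ * (n : ℝ) ^ (-(θ / 2)) * (d n).inDeg v := by gcongr
      _ = n * ((1 - α) * (α * (n : ℝ) ^ (-1 - θ / 2) * ((d n).inDeg v / K))) := by
          rw [sub_eq_add_neg (-1) (θ / 2), Real.rpow_add hn0, Real.rpow_neg_one]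
          field_simp
      _ ≤ n * π v := by
          gcongr
          exact BiDegree.le_isStationary_surfer (hout n) (hK n) h0.le h1.le hπ (by positivity)
            (fun v => (hl v).1) v
  intro a ha hab
  refine (Real.rpow_le_rpow_of_exponent_le (mod_cast hn) ?_).trans
    (hlower.of_mul_le hθ.le hdeg a ha (by linarith))
  linarith

end PowerLaw

namespace BiDegree

section TotalDegree

variable {n : ℕ} {d : BiDegree n}

theorem mul_le_card_tail {k : ℕ} (hout : ∀ v, k ≤ d.outDeg v) :
    k * n ≤ Fintype.card d.Tail := by
  simpa [mul_comm] using Finset.sum_le_sum fun v (_ : v ∈ Finset.univ) => hout v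

theorem card_tail_le_mul {K : ℕ} (hK : ∀ v, d.outDeg v ≤ K) :
    Fintype.card d.Tail ≤ K * n := by
  simpa [mul_comm] using Finset.sum_le_sum fun v (_ : v ∈ Finset.univ) => hK v

theorem lt_card_tail {L : ℕ} [NeZero n] (hout : ∀ v, 2 ≤ d.outDeg v) (hL : L ≤ n) :
    L < Fintype.card d.Tail := by
  have := mul_le_card_tail hout
  have := NeZero.pos n
  omega

theorem le_card_tail_sub {L : ℕ} (hout : ∀ v, 2 ≤ d.outDeg v) (hL : L ≤ n) :
    (n : ℝ) ≤ Fintype.card d.Tail - L := by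
  rw [le_sub_iff_add_le]
  exact_mod_cast (by omega : n + L ≤ 2 * n).trans (mul_le_card_tail hout)

theorem collisionBound_of_le [NeZero n] {L : ℕ} {Δ : ℝ} (hout : ∀ v, 2 ≤ d.outDeg v) (hL : L ≤ n)
    (hΔ0 : 0 ≤ Δ) (hΔ : ∀ v, (d.inDeg v : ℝ) ≤ Δ) :
    d.CollisionBound L ((2 * L + 2) * Δ / n) := by
  refine .of_inDeg_le (lt_card_tail hout hL) hΔ0 hΔ ?_
  rw [div_mul_eq_mul_div, le_div_iff₀ (mod_cast NeZero.pos n)]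
  gcongr
  exact le_card_tail_sub hout hL

end TotalDegree

end BiDegree

section Spread

theorem mul_spread_bound_eq {x : ℝ} (γ : ℝ) (hx : 0 < x) :
    x * (18 * (x ^ (-(1 / 2) - 2 * γ)) ^ 2 / (x ^ (-(γ / 2))) ^ 4) = 18 / x ^ (2 * γ) := by
  have hexp : x * (x ^ (-(1 / 2) - 2 * γ)) ^ 2 / (x ^ (-(γ / 2))) ^ 4 = x ^ (-(2 * γ)) := by
    nth_rw 1 [← Real.rpow_one x]
    rw [← Real.rpow_mul_natCast hx.le, ← Real.rpow_mul_natCast hx.le, ← Real.rpow_add hx,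
      ← Real.rpow_sub hx]
    push_cast
    ring_nf
  rw [div_eq_mul_inv 18, ← Real.rpow_neg hx.le, ← hexp]
  ring

variable {d : ∀ n : ℕ, BiDegree n} {γ δ : ℝ}

theorem eventually_law_real_not_spread_le (hout : ∀ n v, 2 ≤ (d n).outDeg v) (hγ : 0 < γ)
    (hγ6 : γ ≤ 1 / 6) (hΔ : ∀ᶠ n : ℕ in atTop, ∀ v, ((d n).inDeg v : ℝ) ≤ n ^ (1 / 2 - 3 * γ))
    (hδ : 0 < δ) :
    ∀ᶠ n : ℕ in atTop, (d n).law.real {σ | ∃ y z,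
      (n : ℝ) ^ (-(γ / 2)) < ((d n).walk σ ^ (Nat.log 2 n + 1)) y z} ≤ δ := by
  filter_upwards [hΔ, eventually_ge_atTop 1, eventually_natLog_le 40 2 hγ,
    eventually_natLog_le 4 1 one_pos, eventually_le_rpow (18 / δ) (mul_pos two_pos hγ)]
    with n hΔ hn hR2 hR1 hδn
  have : NeZero n := ⟨by omega⟩
  have hn1 : (1 : ℝ) ≤ n := mod_cast hn
  have hn0 : (0 : ℝ) < n := by linarith
  set R : ℕ := Nat.log 2 n + 1
  set Δ : ℝ := (n : ℝ) ^ (1 / 2 - 3 * γ) with hΔ_def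
  have hR1' : (1 : ℝ) ≤ R := mod_cast Nat.succ_pos _
  have hRn : 4 * R ≤ n := by
    rw [Real.rpow_one, pow_one] at hR1
    exact_mod_cast hR1
  have hΔ1 : 1 ≤ Δ := Real.one_le_rpow hn1 (by linarith)
  have hx : (n : ℝ) ^ γ * Δ / n = (n : ℝ) ^ (-(1 / 2) - 2 * γ) := by
    rw [hΔ_def, ← Real.rpow_add hn0, ← Real.rpow_sub_one hn0.ne']
    ring_nf
  refine (BiDegree.law_real_not_spread_le (x := (n : ℝ) ^ γ * Δ / n)
    (BiDegree.collisionBound_of_le (hout n) hRn (by positivity) hΔ) (hout n)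
    ?_ ?_ ?_ (by positivity)).trans ?_
  · calc ((R : ℝ) + 1) * (1 / 2) ^ R ≤ (n : ℝ) ^ γ * (n : ℝ)⁻¹ := by
          gcongr
          · nlinarith
          · exact one_half_pow_natLog_succ_le n
      _ ≤ (n : ℝ) ^ γ * Δ * (n : ℝ)⁻¹ := by
          gcongr
          exact le_mul_of_one_le_right (by positivity) hΔ1
  · rw [mul_div_assoc', ← mul_assoc]
    gcongr
    push_cast
    nlinarith
  · rw [hx]
    exact Real.rpow_le_one_of_one_le_of_nonpos hn1 (by linarith)
  · rw [hx, mul_spread_bound_eq γ hn0]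
    exact (div_le_comm₀ (by positivity) hδ).2 hδn

end Spread

section Influence

variable {d : ∀ n : ℕ, BiDegree n} {lam : ∀ n : ℕ, Fin n → ℝ} {c ε δ : ℝ}

theorem eventually_mul_entranceRate_le (hout : ∀ n v, 2 ≤ (d n).outDeg v) (a : ℕ) (hε : 0 < ε) :
    ∀ᶠ n : ℕ in atTop, ((a * (Nat.log 2 n + 1) : ℕ) : ℝ) *
      (d n).entranceRate (a * (Nat.log 2 n + 1)) ≤ (n : ℝ) ^ (ε - 1) := by
  filter_upwards [eventually_ge_atTop 1, eventually_natLog_le (3 * (a : ℝ) ^ 2) 2 hε,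
    eventually_natLog_le a 1 one_pos] with n hn hL2 hL1
  have hn0 : (0 : ℝ) < n := mod_cast hn
  set L : ℕ := a * (Nat.log 2 n + 1) with hL
  rw [pow_one, Real.rpow_one] at hL1
  rw [mul_assoc, ← mul_pow, ← Nat.cast_mul, ← hL] at hL2
  have hLn : (n : ℝ) ≤ Fintype.card (d n).Tail - L :=
    BiDegree.le_card_tail_sub (hout n) (mod_cast hL1)
  have hLL : (L : ℝ) ≤ (L : ℝ) ^ 2 := mod_cast Nat.le_self_pow two_ne_zero L
  calc (L : ℝ) * (d n).entranceRate L ≤ L * ((L + 2) / n) := by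
        unfold BiDegree.entranceRate
        gcongr
    _ = (L ^ 2 + 2 * L) / n := by ring
    _ ≤ (n : ℝ) ^ ε / n := by
        gcongr
        linarith
    _ = (n : ℝ) ^ (ε - 1) := (Real.rpow_sub_one hn0.ne' _).symm

theorem eventually_sq_mul_rpow_neg_three_le (hδ : 0 < δ) :
    ∀ᶠ n : ℕ in atTop, (n * n : ℝ) * (n : ℝ) ^ (-3 : ℝ) ≤ δ := by
  filter_upwards [eventually_ge_atTop 1, eventually_ge_atTop ⌈δ⁻¹⌉₊] with n hn hδn
  have hn0 : (0 : ℝ) < n := mod_cast hn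
  calc (n * n : ℝ) * (n : ℝ) ^ (-3 : ℝ) = (n : ℝ)⁻¹ := by
        rw [Real.rpow_neg hn0.le, Real.rpow_ofNat]
        field_simp
    _ ≤ δ := inv_le_of_inv_le₀ hδ (Nat.ceil_le.1 hδn)

theorem sq_mul_add_div_pow_le {n : ℕ} [NeZero n] {q : ℕ} {x y : ℝ}
    (hn : 2 ≤ (n : ℝ) ^ (ε / 4)) (hx : 0 ≤ x) (hx' : x ≤ (n : ℝ) ^ (ε / 4 - 1))
    (hy : 0 ≤ y) (hy' : y ≤ (n : ℝ) ^ (ε / 4 - 1)) (hq : 3 ≤ ε / 2 * q) :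
    ((x + y) / (n : ℝ) ^ (ε - 1)) ^ q ≤ (n : ℝ) ^ (-3 : ℝ) := by
  have hn1 : (1 : ℝ) ≤ n := mod_cast NeZero.one_le
  have hn0 : (0 : ℝ) < n := by linarith
  have hxy : x + y ≤ (n : ℝ) ^ (ε / 2 - 1) := by
    calc x + y ≤ 2 * (n : ℝ) ^ (ε / 4 - 1) := by linarith
      _ ≤ (n : ℝ) ^ (ε / 4) * (n : ℝ) ^ (ε / 4 - 1) := by gcongr
      _ = (n : ℝ) ^ (ε / 2 - 1) := by
          rw [← Real.rpow_add hn0]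
          ring_nf
  calc ((x + y) / (n : ℝ) ^ (ε - 1)) ^ q
      ≤ ((n : ℝ) ^ (ε / 2 - 1) / (n : ℝ) ^ (ε - 1)) ^ q := by gcongr
    _ = (n : ℝ) ^ (-(ε / 2 * q)) := by
        rw [← Real.rpow_sub hn0, ← Real.rpow_mul_natCast hn0.le]
        ring_nf
    _ ≤ (n : ℝ) ^ (-3 : ℝ) := Real.rpow_le_rpow_of_exponent_le hn1 (by linarith)

theorem exists_nat_le_mul (hε : 0 < ε) (a : ℝ) : ∃ q : ℕ, a ≤ ε * q :=
  (exists_nat_ge (a / ε)).imp fun _ hq => (div_le_iff₀' hε).1 hq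

theorem eventually_law_real_long_le (hout : ∀ n v, 2 ≤ (d n).outDeg v) (hc : 0 < c) (hε : 0 < ε)
    {J : ℕ} (hJ : 2 ≤ c * J) (hδ : 0 < δ) :
    ∀ᶠ n : ℕ in atTop, (d n).law.real {σ | ∃ p : Fin n × Fin n,
      (∀ y z, ((d n).walk σ ^ (Nat.log 2 n + 1)) y z ≤ (n : ℝ) ^ (-c)) ∧
      (n : ℝ) ^ (ε - 1) * (d n).influence (J * (Nat.log 2 n + 1)) σ p.2 <
        ((d n).walk σ ^ (J * (Nat.log 2 n + 1))) p.1 p.2} ≤ δ := by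
  obtain ⟨q, hq⟩ := exists_nat_le_mul (half_pos hε) 3
  filter_upwards [eventually_ge_atTop 1,
    eventually_mul_entranceRate_le hout (q * J) (by positivity : 0 < ε / 4),
    eventually_natLog_le (q * J : ℕ) 1 (half_pos hc),
    eventually_natLog_le (q * J : ℕ) 1 one_pos,
    eventually_le_rpow 2 (by positivity : 0 < ε / 4),
    eventually_sq_mul_rpow_neg_three_le hδ] with n hn hrate hLc hL1 h2 hδn
  have : NeZero n := ⟨by omega⟩
  have hn1 : (1 : ℝ) ≤ n := mod_cast hn
  have hn0 : (0 : ℝ) < n := by linarith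
  set R : ℕ := Nat.log 2 n + 1
  rw [pow_one, ← Nat.cast_mul] at hLc hL1
  rw [Real.rpow_one, Nat.cast_le] at hL1
  set L : ℕ := q * J * R with hL
  have hLm : L < Fintype.card (d n).Tail := BiDegree.lt_card_tail (hout n) hL1
  have hrate0 : 0 ≤ (d n).entranceRate L := BiDegree.entranceRate_nonneg hLm.le
  have hTL : J * R ≤ L := by
    rw [hL, mul_assoc]
    exact Nat.le_mul_of_pos_left _ (Nat.pos_of_ne_zero (by rintro rfl; norm_num at hq))
  refine (BiDegree.law_real_long_le (Nat.succ_ne_zero _) (by positivity) hLm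
    (mul_assoc _ _ _).ge (by positivity)).trans (le_trans ?_ hδn)
  gcongr
  refine sq_mul_add_div_pow_le h2 (by positivity) ?_ (by positivity)
    ((by gcongr : _ ≤ (L : ℝ) * _).trans hrate) hq
  calc (L * (n : ℝ) ^ (-c)) ^ J ≤ ((n : ℝ) ^ (c / 2) * (n : ℝ) ^ (-c)) ^ J := by gcongr
    _ = (n : ℝ) ^ (-(c * J / 2)) := by
        rw [← Real.rpow_add hn0, ← Real.rpow_mul_natCast hn0.le]
        ring_nf
    _ ≤ (n : ℝ) ^ (ε / 4 - 1) := Real.rpow_le_rpow_of_exponent_le hn1 (by linarith)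

theorem eventually_law_real_short_le (hout : ∀ n v, 2 ≤ (d n).outDeg v) (hlam : NearUniform lam)
    (hε : 0 < ε) (J : ℕ) (hδ : 0 < δ) :
    ∀ᶠ n : ℕ in atTop, (d n).law.real {σ | ∃ p : Fin (J * (Nat.log 2 n + 1)) × Fin n,
      (n : ℝ) ^ (ε - 1) * (d n).influence (J * (Nat.log 2 n + 1)) σ p.2 <
        (lam n ᵥ* (d n).walk σ ^ (p.1 : ℕ)) p.2} ≤ δ := by
  obtain ⟨q, hq⟩ := exists_nat_le_mul (half_pos hε) 3
  filter_upwards [eventually_ge_atTop 1,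
    eventually_mul_entranceRate_le hout (q * J) (by positivity : 0 < ε / 4),
    eventually_natLog_le (2 * (q * J : ℕ)) 1 (by positivity : 0 < ε / 8),
    eventually_natLog_le (q * J : ℕ) 1 one_pos,
    eventually_le_rpow 2 (by positivity : 0 < ε / 8),
    eventually_le_rpow 2 (by positivity : 0 < ε / 4),
    hlam.2 (ε / 8) (by positivity),
    eventually_sq_mul_rpow_neg_three_le hδ] with n hn hrate hLε hL1 h2' h2 hl hδn
  have : NeZero n := ⟨by omega⟩
  have hn0 : (0 : ℝ) < n := mod_cast hn
  set R : ℕ := Nat.log 2 n + 1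
  rw [pow_one, ← Nat.cast_mul, Real.rpow_one, Nat.cast_le] at hL1
  rw [pow_one, mul_assoc, ← Nat.cast_mul] at hLε
  set L : ℕ := q * J * R with hL
  have hLm : L < Fintype.card (d n).Tail := BiDegree.lt_card_tail (hout n) hL1
  have hrate0 : 0 ≤ (d n).entranceRate L := BiDegree.entranceRate_nonneg hLm.le
  have hTL : J * R ≤ L := by
    rw [hL, mul_assoc]
    exact Nat.le_mul_of_pos_left _ (Nat.pos_of_ne_zero (by rintro rfl; norm_num at hq))
  refine (BiDegree.law_real_short_le (hlam.1 n hn).1 (hlam.1 n hn).2.le (by positivity)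
    (fun x => (hl x).2) hLm (mul_assoc _ _ _).ge (by positivity)).trans (le_trans ?_ hδn)
  gcongr ?_ * n * ?_
  · exact_mod_cast hTL.trans hL1
  refine sq_mul_add_div_pow_le h2 (by positivity) ?_ (by positivity)
    ((by gcongr : _ ≤ (L : ℝ) * _).trans hrate) hq
  calc (n : ℝ) ^ (-1 + ε / 8) * (L + 1) ≤ (n : ℝ) ^ (-1 + ε / 8) * (n : ℝ) ^ (ε / 8) := by
        gcongr
        linarith
    _ = (n : ℝ) ^ (ε / 4 - 1) := by
        rw [← Real.rpow_add hn0]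
        ring_nf

end Influence

section Split

theorem half_le_one_sub_exp_neg {u : ℝ} (h0 : 0 ≤ u) (h1 : u ≤ 1) :
    u / 2 ≤ 1 - Real.exp (-u) := by
  have hexp : Real.exp (-u) ≤ (1 + u)⁻¹ := by
    rw [Real.exp_neg]
    gcongr
    linarith [Real.add_one_le_exp u]
  have hinv : (1 + u)⁻¹ ≤ 1 - u / 2 := by
    rw [inv_le_iff_one_le_mul₀ (by linarith)]
    nlinarith
  linarith

theorem inv_sub_self_le {r : ℝ} (h2 : 1 / 2 ≤ r) (h1 : r ≤ 1) : r⁻¹ - r ≤ 4 * (1 - r) := by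
  have hr : r⁻¹ ≤ 2 := inv_le_of_inv_le₀ two_pos (by linarith)
  calc r⁻¹ - r = (1 - r) * ((1 + r) * r⁻¹) := by
        have : r ≠ 0 := by linarith
        field_simp
        ring
    _ ≤ (1 - r) * (2 * 2) := by
        gcongr
        linarith
    _ = 4 * (1 - r) := by ring

theorem add_div_le_one_sub {r a b m : ℝ} (h2 : 1 / 2 ≤ r) (h1 : r ≤ 1) (ha : 0 ≤ a) (hm : 0 < m)
    (hab : 4 * a + b ≤ 3 / 4 * m) :
    r + (a * (r⁻¹ - r) + b * (1 - r)) / m ≤ 1 - (1 - r) / 4 := by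
  have hnum : a * (r⁻¹ - r) + b * (1 - r) ≤ 3 / 4 * (1 - r) * m := by
    calc a * (r⁻¹ - r) + b * (1 - r) ≤ a * (4 * (1 - r)) + b * (1 - r) := by
          gcongr
          exact inv_sub_self_le h2 h1
      _ = (4 * a + b) * (1 - r) := by ring
      _ ≤ 3 / 4 * m * (1 - r) := by gcongr
      _ = 3 / 4 * (1 - r) * m := by ring
  linarith [(div_le_iff₀ hm).2 hnum]

theorem one_sub_div_pow_le_exp_pow {k m : ℕ} (hkm : k ≤ m) (L : ℕ) :
    (1 - (k : ℝ) / m) ^ L ≤ Real.exp (-(L / m)) ^ k := by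
  have hk : (k : ℝ) / m ≤ 1 := div_le_one_of_le₀ (mod_cast hkm) (Nat.cast_nonneg m)
  calc (1 - (k : ℝ) / m) ^ L ≤ Real.exp (-(k / m)) ^ L :=
        pow_le_pow_left₀ (sub_nonneg.2 hk) (Real.one_sub_le_exp_neg _) L
    _ = Real.exp (-(L / m)) ^ k := by
        rw [← Real.exp_nat_mul, ← Real.exp_nat_mul]
        ring_nf

theorem BiDegree.law_real_split_le_exp {n N : ℕ} [NeZero n] {d : BiDegree n} {Δ : ℝ}
    (hout : ∀ v, 2 ≤ d.outDeg v) (hΔ1 : 1 ≤ Δ) (hΔ : ∀ v, (d.inDeg v : ℝ) ≤ Δ)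
    (hN : 10 * ((N + 1) * Δ) ≤ n) :
    d.law.real {σ | ∃ p : Fin n × Fin n, d.Split (N + 1) p.1 p.2 σ} ≤
      (n * n : ℝ) * Real.exp (-(N ^ 2 / (8 * Fintype.card d.Tail))) := by
  set m : ℝ := (Fintype.card d.Tail : ℝ) with hm
  set u : ℝ := N / m with hu
  set r : ℝ := Real.exp (-u)
  have hNn : 10 * ((N : ℝ) + 1) ≤ n :=
    hN.trans' (by gcongr; exact le_mul_of_one_le_right (by positivity) hΔ1)
  have hNn' : N ≤ n := by
    rify
    linarith
  have hm2 : 2 * (n : ℝ) ≤ m := by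
    rw [hm]
    exact_mod_cast mul_le_card_tail hout
  have hmN : 0 < m - N := by linarith
  have hu0 : 0 ≤ u := by positivity
  have hu2 : u ≤ 1 / 2 := by
    rw [hu, div_le_iff₀ (by linarith)]
    linarith
  have hr1 : r ≤ 1 := Real.exp_le_one_iff.2 (by linarith)
  have hr2 : 1 / 2 ≤ r := by linarith [Real.one_sub_le_exp_neg u]
  have hγ : r + ((N + 1) * Δ * (r⁻¹ - r) + n * (1 - r)) / (m - N) ≤ 1 - (1 - r) / 4 :=
    add_div_le_one_sub hr2 hr1 (by positivity) hmN (by linarith)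
  calc d.law.real {σ | ∃ p : Fin n × Fin n, d.Split (N + 1) p.1 p.2 σ}
      ≤ (n * n : ℝ) * (1 - (1 - r) / 4) ^ N :=
        law_real_split_le N.lt_succ_self (lt_card_tail hout hNn') hΔ (by linarith)
          (Real.exp_pos _) hr1 (fun k hk => one_sub_div_pow_le_exp_pow hk N) (by linarith) hγ
    _ ≤ (n * n : ℝ) * Real.exp (-(u / 8)) ^ N := by
        gcongr
        · linarith
        · linarith [half_le_one_sub_exp_neg hu0 (by linarith), Real.one_sub_le_exp_neg (u / 8)]
    _ = (n * n : ℝ) * Real.exp (-(N ^ 2 / (8 * m))) := by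
        rw [← Real.exp_nat_mul, hu]
        ring_nf

theorem natCeil_add_one_le {x : ℝ} (hx : 1 ≤ x) : (⌈x⌉₊ : ℝ) + 1 ≤ 3 * x := by
  linarith [Nat.ceil_lt_add_one (zero_le_one.trans hx)]

theorem three_mul_log_le_sq_div {x γ k m : ℝ} (hx : 0 < x) (hγ : 0 < γ) (hm : 0 < m)
    (hmk : m ≤ k * x) (hk : 24 * k / γ ≤ x ^ γ) :
    3 * Real.log x ≤ (x ^ (1 / 2 + γ)) ^ 2 / (8 * m) := by
  rw [le_div_iff₀ (by positivity)]
  calc 3 * Real.log x * (8 * m) ≤ 3 * (x ^ γ / γ) * (8 * (k * x)) := by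
        gcongr
        exact Real.log_le_rpow_div hx.le hγ
    _ = 24 * k / γ * x ^ γ * x := by ring
    _ ≤ x ^ γ * x ^ γ * x := by gcongr
    _ = (x ^ (1 / 2 + γ)) ^ 2 := by
        rw [← Real.rpow_mul_natCast hx.le, ← Real.rpow_add hx, ← Real.rpow_add_one hx.ne']
        ring_nf

variable {d : ∀ n : ℕ, BiDegree n} {K : ℕ} {γ δ : ℝ}

theorem eventually_law_real_split_le (hout : ∀ n v, 2 ≤ (d n).outDeg v)
    (hK : ∀ n v, (d n).outDeg v ≤ K) (hγ : 0 < γ) (hγ6 : γ ≤ 1 / 6)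
    (hΔ : ∀ᶠ n : ℕ in atTop, ∀ v, ((d n).inDeg v : ℝ) ≤ n ^ (1 / 2 - 3 * γ)) (hδ : 0 < δ) :
    ∀ᶠ n : ℕ in atTop, (d n).law.real {σ | ∃ p : Fin n × Fin n,
      (d n).Split (⌈(n : ℝ) ^ (1 / 2 + γ)⌉₊ + 1) p.1 p.2 σ} ≤ δ := by
  filter_upwards [hΔ, eventually_ge_atTop 1, eventually_le_rpow 30 (mul_pos two_pos hγ),
    eventually_le_rpow (24 * K / γ) hγ, eventually_sq_mul_rpow_neg_three_le hδ]
    with n hΔ hn h30 hKn hδn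
  have : NeZero n := ⟨by omega⟩
  have hn1 : (1 : ℝ) ≤ n := mod_cast hn
  have hn0 : (0 : ℝ) < n := by linarith
  set z : ℝ := (n : ℝ) ^ (1 / 2 + γ) with hz
  have hz1 : 1 ≤ z := Real.one_le_rpow hn1 (by positivity)
  have hzΔ : 10 * ((⌈z⌉₊ + 1) * (n : ℝ) ^ (1 / 2 - 3 * γ)) ≤ n := by
    calc 10 * ((⌈z⌉₊ + 1) * (n : ℝ) ^ (1 / 2 - 3 * γ))
        ≤ 10 * (3 * z * (n : ℝ) ^ (1 / 2 - 3 * γ)) := by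
          gcongr
          exact natCeil_add_one_le hz1
      _ = 30 * (n : ℝ) ^ (1 - 2 * γ) := by
          rw [hz, mul_assoc 3, ← Real.rpow_add hn0, ← mul_assoc]
          ring_nf
      _ ≤ (n : ℝ) ^ (2 * γ) * (n : ℝ) ^ (1 - 2 * γ) := by gcongr
      _ = n := by rw [← Real.rpow_add hn0, add_sub_cancel, Real.rpow_one]
  have hm0 : (0 : ℝ) < Fintype.card (d n).Tail :=
    mod_cast (Nat.zero_le _).trans_lt (BiDegree.lt_card_tail (hout n) (Nat.zero_le n))
  have hlog : 3 * Real.log n ≤ (⌈z⌉₊ : ℝ) ^ 2 / (8 * Fintype.card (d n).Tail) :=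
    (three_mul_log_le_sq_div hn0 hγ hm0
      (mod_cast BiDegree.card_tail_le_mul (hK n)) hKn).trans (by gcongr; exact Nat.le_ceil z)
  calc (d n).law.real {σ | ∃ p : Fin n × Fin n, (d n).Split (⌈z⌉₊ + 1) p.1 p.2 σ}
      ≤ (n * n : ℝ) * Real.exp (-((⌈z⌉₊ : ℝ) ^ 2 / (8 * Fintype.card (d n).Tail))) :=
        BiDegree.law_real_split_le_exp (hout n) (Real.one_le_rpow hn1 (by linarith)) hΔ hzΔ
    _ ≤ (n * n : ℝ) * Real.exp (Real.log n * -3) := by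
        gcongr
        linarith
    _ = (n * n : ℝ) * (n : ℝ) ^ (-3 : ℝ) := by rw [Real.rpow_def_of_pos hn0]
    _ ≤ δ := hδn

end Split

/-- The event on which PageRank is controlled up to the horizon `T`: the surfer that teleported
fewer than `T` steps ago and the walk of length exactly `T` put mass at most `s` times the influence
on each vertex, and no two vertices are split by disjoint absorbing sets of size at least `N`. -/
structure BiDegree.IsTypical {n : ℕ} (d : BiDegree n) (lam : Fin n → ℝ) (T N : ℕ) (s : ℝ)
    (σ : d.Matching) : Prop where
  short : ∀ k < T, ∀ v, (lam ᵥ* d.walk σ ^ k) v ≤ s * d.influence T σ v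
  long : ∀ x v, (d.walk σ ^ T) x v ≤ s * d.influence T σ v
  not_split : ∀ x x', ¬d.Split N x x' σ

theorem BiDegree.surfer_zero {n : ℕ} (d : BiDegree n) (σ : d.Matching) (lam : Fin n → ℝ) :
    d.surfer σ 0 lam = d.walk σ := by
  ext x y
  simp [surfer]

theorem BiDegree.IsTypical.exists_isTheStationary {n T N : ℕ} [NeZero n] {d : BiDegree n}
    {lam : Fin n → ℝ} {s Δ α : ℝ} {σ : d.Matching} (h : d.IsTypical lam T N s σ)
    (hout : ∀ v, 0 < d.outDeg v) (hlam : lam ∈ stdSimplex ℝ (Fin n)) (hpos : ∀ v, 0 < lam v)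
    (hs : 0 < s) (hΔ1 : 1 ≤ Δ) (hΔ : ∀ v, (d.inDeg v : ℝ) ≤ Δ) (hN : N * (s * Δ) ≤ 1)
    (h0 : 0 ≤ α) (h1 : α ≤ 1) :
    ∃ π, IsTheStationary (d.surfer σ α lam) π ∧ ∀ v, π v ≤ s * d.influence T σ v := by
  obtain ⟨π, hπ⟩ := exists_isStationary (surfer_mem_rowStochastic hout h0 h1 hlam σ)
  refine ⟨π, ?_, fun v => isStationary_surfer_le h0 h1 hπ (fun k hk => h.short k hk v)
    fun x => h.long x v⟩
  rcases h0.eq_or_lt with rfl | h0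
  · rw [surfer_zero] at hπ ⊢
    have hlarge : ∀ C, d.Absorbing σ C → C.Nonempty → N ≤ C.card := by
      rintro C hC ⟨x, hx⟩
      have hcard : 1 ≤ C.card * (s * Δ) := hC.one_le_card_mul hout hx fun v =>
        (h.long x v).trans (by gcongr; exact influence_le hΔ1 hΔ T σ v)
      exact_mod_cast le_of_mul_le_mul_right (hN.trans hcard) (by positivity)
    exact isTheStationary_walk hout hlarge h.not_split hπ
  · exact isTheStationary_surfer_of_pos hout h0 h1 hlam hpos hπ

theorem BiDegree.IsTypical.exists_upperBounds {n T : ℕ} [NeZero n] {d : BiDegree n}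
    {lam : Fin n → ℝ} {κ γ ε ε' α : ℝ} {σ : d.Matching}
    (h : d.IsTypical lam T (⌈(n : ℝ) ^ (1 / 2 + γ)⌉₊ + 1) (n ^ (ε' - 1)) σ)
    (hout : ∀ v, 0 < d.outDeg v) (hlam : lam ∈ stdSimplex ℝ (Fin n)) (hpos : ∀ v, 0 < lam v)
    (hκ : 1 ≤ κ) (hγ : 0 ≤ γ) (hκγ : 1 / κ = 1 / 2 - 4 * γ) (h3 : 3 ≤ (n : ℝ) ^ γ) (hε' : 0 ≤ ε')
    (hε'γ : ε' ≤ γ) (hε : ε' * (κ + 2) ≤ ε) (hT : (T : ℝ) + 1 ≤ n ^ ε')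
    (hΔ : ∀ w, (d.inDeg w : ℝ) ≤ n ^ (1 / κ + ε'))
    (hmom : ∑ w, (d.inDeg w : ℝ) ^ κ ≤ n ^ (1 + ε')) (h0 : 0 ≤ α) (h1 : α ≤ 1) :
    ∃ π, IsTheStationary (d.surfer σ α lam) π ∧ UpperBounds κ ε fun v => (n : ℝ) * π v := by
  have hn1 : (1 : ℝ) ≤ n := mod_cast NeZero.one_le
  have hn0 : (0 : ℝ) < n := by linarith
  have hN : ((⌈(n : ℝ) ^ (1 / 2 + γ)⌉₊ + 1 : ℕ) : ℝ) *
      ((n : ℝ) ^ (ε' - 1) * (n : ℝ) ^ (1 / κ + ε')) ≤ 1 := by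
    push_cast
    calc ((⌈(n : ℝ) ^ (1 / 2 + γ)⌉₊ : ℝ) + 1) * ((n : ℝ) ^ (ε' - 1) * (n : ℝ) ^ (1 / κ + ε'))
        ≤ ((n : ℝ) ^ γ * (n : ℝ) ^ (1 / 2 + γ)) *
            ((n : ℝ) ^ (ε' - 1) * (n : ℝ) ^ (1 / κ + ε')) := by
          gcongr
          refine (natCeil_add_one_le (Real.one_le_rpow hn1 (by linarith))).trans ?_
          gcongr
      _ = (n : ℝ) ^ (2 * (ε' - γ)) := by
          rw [← Real.rpow_add hn0, ← Real.rpow_add hn0, ← Real.rpow_add hn0, hκγ]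
          ring_nf
      _ ≤ 1 := Real.rpow_le_one_of_one_le_of_nonpos hn1 (by linarith)
  obtain ⟨π, hπ, hle⟩ := h.exists_isTheStationary hout hlam hpos (by positivity)
    (Real.one_le_rpow hn1 (by positivity)) hΔ hN h0 h1
  refine ⟨π, hπ, upperBounds_of_le_influence (T := T) (σ := σ) hκ hε' hε hT hΔ hmom fun v => ?_⟩
  calc (n : ℝ) * π v ≤ n * ((n : ℝ) ^ (ε' - 1) * d.influence T σ v) := by
        gcongr
        exact hle v
    _ = (n : ℝ) ^ ε' * d.influence T σ v := by
        rw [Real.rpow_sub_one hn0.ne']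
        field_simp

theorem BiDegree.law_real_compl_isTypical_le {n : ℕ} (d : BiDegree n) (lam : Fin n → ℝ)
    (R J N : ℕ) (s η : ℝ) :
    d.law.real {σ | d.IsTypical lam (J * R) N s σ}ᶜ ≤
      d.law.real {σ | ∃ y z, η < (d.walk σ ^ R) y z} +
      d.law.real {σ | ∃ p : Fin n × Fin n, (∀ y z, (d.walk σ ^ R) y z ≤ η) ∧
        s * d.influence (J * R) σ p.2 < (d.walk σ ^ (J * R)) p.1 p.2} +
      d.law.real {σ | ∃ p : Fin (J * R) × Fin n,
        s * d.influence (J * R) σ p.2 < (lam ᵥ* d.walk σ ^ (p.1 : ℕ)) p.2} +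
      d.law.real {σ | ∃ p : Fin n × Fin n, d.Split N p.1 p.2 σ} := by
  refine (measureReal_mono fun σ hσ => ?_).trans <| (measureReal_union_le _ _).trans <|
    add_le_add_left ((measureReal_union_le _ _).trans <|
      add_le_add_left (measureReal_union_le _ _) _) _
  contrapose! hσ
  simp only [Set.mem_union, Set.mem_ofPred_eq, not_or, not_exists, not_and, not_lt] at hσ
  obtain ⟨⟨⟨hspread, hlong⟩, hshort⟩, hsplit⟩ := hσ
  exact fun hnot => hnot ⟨fun k hk v => hshort (⟨k, hk⟩, v), fun x v => hlong (x, v) hspread,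
    fun x x' => hsplit (x, x')⟩

section PageRank

variable {d : ∀ n : ℕ, BiDegree n} {lam : ∀ n : ℕ, Fin n → ℝ} {K : ℕ} {κ γ ε δ : ℝ}

theorem exists_eventually_le_law_real_isTypical (hout : ∀ n v, 2 ≤ (d n).outDeg v)
    (hK : ∀ n v, (d n).outDeg v ≤ K) (hlam : NearUniform lam) (hγ : 0 < γ) (hγ6 : γ ≤ 1 / 6)
    (hΔ : ∀ᶠ n : ℕ in atTop, ∀ v, ((d n).inDeg v : ℝ) ≤ n ^ (1 / 2 - 3 * γ))
    (hε : 0 < ε) (hδ : 0 < δ) :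
    ∃ J : ℕ, ∀ᶠ n : ℕ in atTop, 1 - δ ≤ (d n).law.real {σ | (d n).IsTypical (lam n)
      (J * (Nat.log 2 n + 1)) (⌈(n : ℝ) ^ (1 / 2 + γ)⌉₊ + 1) (n ^ (ε - 1)) σ} := by
  obtain ⟨J, hJ⟩ := exists_nat_le_mul (half_pos hγ) 2
  have hδ4 : 0 < δ / 4 := by positivity
  refine ⟨J, ?_⟩
  filter_upwards [eventually_law_real_not_spread_le hout hγ hγ6 hΔ hδ4,
    eventually_law_real_long_le hout (half_pos hγ) hε hJ hδ4,
    eventually_law_real_short_le hout hlam hε J hδ4,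
    eventually_law_real_split_le hout hK hγ hγ6 hΔ hδ4] with n hspread hlong hshort hsplit
  rw [sub_le_comm, ← probReal_compl_eq_one_sub .of_discrete]
  refine ((d n).law_real_compl_isTypical_le (lam n) (Nat.log 2 n + 1) J _ _ _).trans
    ((add_le_add (add_le_add (add_le_add hspread hlong) hshort) hsplit).trans_eq ?_)
  ring

theorem eventually_le_law_real_forall_upperBounds (hout : ∀ n v, 2 ≤ (d n).outDeg v)
    (hK : ∀ n v, (d n).outDeg v ≤ K) (hκ : 2 < κ)
    (hφ : HasPowerLaw κ fun n v => ((d n).inDeg v : ℝ)) (hlam : NearUniform lam)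
    (hε : 0 < ε) (hδ : 0 < δ) :
    ∀ᶠ n : ℕ in atTop, 1 - δ ≤ (d n).law.real {σ | ∀ α : ℝ, 0 ≤ α → α ≤ 1 →
      ∃ π, IsTheStationary ((d n).surfer σ α (lam n)) π ∧
        UpperBounds κ ε fun v => (n : ℝ) * π v} := by
  have hκ0 : 0 < κ := by linarith
  obtain ⟨γ, hγ⟩ : ∃ γ : ℝ, 1 / κ = 1 / 2 - 4 * γ := ⟨(1 / 2 - 1 / κ) / 4, by ring⟩
  have hγ0 : 0 < γ := by linarith [one_div_lt_one_div_of_lt two_pos hκ]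
  have hγ6 : γ ≤ 1 / 6 := by linarith [one_div_pos.2 hκ0]
  obtain ⟨e, he, heγ, heε⟩ : ∃ e > 0, e ≤ γ ∧ e * (κ + 2) ≤ ε :=
    ⟨min γ (ε / (κ + 2)), lt_min hγ0 (by positivity), min_le_left _ _,
      (le_div_iff₀ (by positivity)).1 (min_le_right _ _)⟩
  have hΔ : ∀ᶠ n : ℕ in atTop, ∀ v, ((d n).inDeg v : ℝ) ≤ n ^ (1 / 2 - 3 * γ) :=
    (hφ.eventually_le hκ0 hγ0).mono fun n hn v => (hn v).trans_eq (by rw [hγ]; ring_nf)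
  obtain ⟨J, hJ⟩ := exists_eventually_le_law_real_isTypical hout hK hlam hγ0 hγ6 hΔ he hδ
  filter_upwards [hJ, hφ.eventually_le hκ0 he,
    hφ.eventually_sum_rpow_le (fun n v => Nat.cast_nonneg _) hκ0 he, hlam.2 e he,
    eventually_ge_atTop 1, eventually_natLog_le (J + 1 : ℕ) 1 he, eventually_le_rpow 3 hγ0]
    with n htypical hmax hmom hl hn hT h3
  have : NeZero n := ⟨by omega⟩
  have hT' : ((J * (Nat.log 2 n + 1) : ℕ) : ℝ) + 1 ≤ (n : ℝ) ^ e := by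
    refine hT.trans' ?_
    rw [pow_one]
    exact_mod_cast (by rw [add_one_mul]; omega)
  exact htypical.trans (measureReal_mono fun σ hσ α h0 h1 =>
    hσ.exists_upperBounds (fun v => two_pos.trans_le (hout n v)) (hlam.1 n hn)
      (fun v => (hl v).1.trans_lt' (by positivity)) (by linarith) hγ0.le hγ h3 he.le heγ heε hT'
      hmax hmom h0 h1)

end PageRank

end DCM

theorem mainTheorem3_general {d : ∀ n : ℕ, DCM.BiDegree n} {K : ℕ}
    (hout : ∀ n v, 2 ≤ (d n).outDeg v) (hK : ∀ n v, (d n).outDeg v ≤ K) {κ : ℝ} (hκ : 2 < κ)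
    (hφ : DCM.HasPowerLaw κ fun n v => ((d n).inDeg v : ℝ)) {lam : ∀ n : ℕ, Fin n → ℝ}
    (hlam : DCM.NearUniform lam) :
    (∀ α : ℝ, 0 < α → α < 1 → ∀ ε : ℝ, 0 < ε → ∀ b : ℝ, 0 < b → b < 1 / κ →
      Tendsto (fun n : ℕ => (d n).law.real
          {σ | ∃ π : Fin n → ℝ, DCM.IsTheStationary ((d n).surfer σ α (lam n)) π ∧
            DCM.UpperBounds κ ε (fun v => (n : ℝ) * π v) ∧
            DCM.LowerBounds κ ε b (fun v => (n : ℝ) * π v)})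
        atTop (𝓝 1)) ∧
    (∀ ε : ℝ, 0 < ε → ∀ δ : ℝ, 0 < δ → ∀ᶠ n : ℕ in atTop,
      1 - δ ≤ (d n).law.real
          {σ | ∀ α : ℝ, 0 ≤ α → α ≤ 1 →
            ∃ π : Fin n → ℝ, DCM.IsTheStationary ((d n).surfer σ α (lam n)) π ∧
              DCM.UpperBounds κ ε (fun v => (n : ℝ) * π v)}) := by
  have hupper : ∀ ε : ℝ, 0 < ε → ∀ δ : ℝ, 0 < δ → _ := fun ε hε δ hδ =>
    DCM.eventually_le_law_real_forall_upperBounds hout hK hκ hφ hlam hε hδ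
  refine ⟨fun α h0 h1 ε hε b _ hb => tendsto_order.2 ⟨fun c hc => ?_, fun c hc =>
    Eventually.of_forall fun n => measureReal_le_one.trans_lt hc⟩, hupper⟩
  filter_upwards [hupper ε hε ((1 - c) / 2) (by linarith),
    DCM.eventually_lowerBounds_pageRank (fun n v => two_pos.trans_le (hout n v)) hK
      (two_pos.trans hκ) hφ hlam h0 h1 hε hb] with n hupper hlower
  refine (hupper.trans (measureReal_mono fun σ hσ => ?_)).trans_lt' (by linarith)
  obtain ⟨π, hπ, hπupper⟩ := hσ α h0.le h1.le
  exact ⟨π, hπ, hπupper, hlower σ π hπ.1⟩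

theorem mainTheorem3 (d : ∀ n : ℕ, DCM.BiDegree n) (hd : DCM.DegreeAssumption d)
    (κ : ℝ) (hκ : 2 < κ)
    (hφ : DCM.HasPowerLaw κ (fun n v => ((d n).inDeg v : ℝ)))
    (lam : ∀ n : ℕ, Fin n → ℝ) (hlam : DCM.NearUniform lam) :
    (∀ α : ℝ, 0 < α → α < 1 → ∀ ε : ℝ, 0 < ε → ∀ b : ℝ, 0 < b → b < 1 / κ →
      Tendsto (fun n : ℕ => (d n).law.real
          {σ | ∃ π : Fin n → ℝ, DCM.IsTheStationary ((d n).surfer σ α (lam n)) π ∧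
            DCM.UpperBounds κ ε (fun v => (n : ℝ) * π v) ∧
            DCM.LowerBounds κ ε b (fun v => (n : ℝ) * π v)})
        atTop (𝓝 1)) ∧
    (∀ ε : ℝ, 0 < ε → ∀ δ : ℝ, 0 < δ → ∀ᶠ n : ℕ in atTop, ∀ α : ℝ, 0 ≤ α → α ≤ 1 →
      1 - δ ≤ (d n).law.real
          {σ | ∃ π : Fin n → ℝ, DCM.IsTheStationary ((d n).surfer σ α (lam n)) π ∧
            DCM.UpperBounds κ ε (fun v => (n : ℝ) * π v)}) := by
  obtain ⟨_, _, _, -, -, -, hdeg⟩ := hd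
  obtain ⟨hlim, hupper⟩ :=
    mainTheorem3_general (fun n => (hdeg n).1) (fun n => (hdeg n).2.1) hκ hφ hlam
  exact ⟨hlim, fun ε hε δ hδ => (hupper ε hε δ hδ).mono fun n hn α h0 h1 =>
    hn.trans (measureReal_mono fun σ hσ => hσ α h0 h1)⟩
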